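/- **Setting.** $SK$-calculus has the combinators $M,N ::= S \mid K \mid MN$. Its reduction $\to$ is generated by $SMNX\to MX(NX)$ and $KXY\to X$, and it is closed under both components of an application ($M\to M'$ implies $MN\to M'N$ and $NM\to NM'$), so that no reduction strategy is fixed. We write $\Rightarrow$ for the reflexive transitive closure of a reduction relation. Concurrent pattern calculus (CPC) has patterns $p ::= \lambda x\mid x\mid \ulcorner x\urcorner\mid p\bullet p$ with pairwise distinct binding names, and processes $P ::= 0\mid \mathsf{ok}\mid P|P\mid {!P}\mid(\nu a)P\mid p\to P$, taken up to $\alpha$-conversion. A pattern is communicable if it contains no $\lambda x$ and no $\ulcorner x\urcorner$. Structural equivalence $\equiv$ is the least congruence for which $|$ is commutative and associative with unit $0$, and with $!P\equiv P|{!P}$, $(\nu n)0\equiv 0$, $(\nu n)(\nu m)P\equiv(\nu m)(\nu n)P$, and $P|(\nu n)Q\equiv(\nu n)(P|Q)$ for $n\notin\mathrm{fn}(P)$. Unification $\{p\,\|\,q\}=(\sigma,\rho)$ is given as follows: $x$ or $\ulcorner x\urcorner$ unifies with $x$ or $\ulcorner x\urcorner$; $\lambda x$ unifies with any communicable pattern,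 which is then bound to $x$; compounds unify componentwise. Reduction is generated by $(p\to P)|(q\to Q)\to\sigma P|\rho Q$ when $\{p\,\|\,q\}=(\sigma,\rho)$, closed under $|$, $\nu$ and $\equiv$. We write $P\Downarrow$ if $P\Rightarrow P'\equiv P''|\mathsf{ok}$ for some $P',P''$. The barb $P\downarrow_{A}$ means that $P\equiv(\nu\tilde n)(p\to P'|P'')$ where no protected name of $p$ is in $\tilde n$ and $A=\mathrm{fn}(p)\setminus\tilde n$. Let $\simeq$ be weak barbed congruence: the largest symmetric relation which is weakly reduction-closed, weakly preserves barbs and preserves $\Downarrow$, and is closed under all process contexts. **Theorem.** Let $s\neq k$ be two reserved names of CPC, and let $\langle S\rangle=s$, $\langle K\rangle=k$, $\langle MN\rangle=\langle M\rangle\bullet\langle N\rangle$. There is a translation $[\![\cdot]\!]_c$ of $SK$-combinators into CPC processes, parametrised by a non-reserved name $c$, together with a renaming policy $\varphi$ (mapping every name to an $r$-tuple of non-reserved names, $r>0$, with disjoint tuples for distinct names), that is a parallel encoding. That is, for all non-reserved $c$ and all combinators $M,N$: 1. *Compositionality*: for every $j$-ary operator $\mathrm{op}$ (namely $S$, $K$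 or application) and every set of names $X$ there are a $j$-ary context $C$, in which each hole occurs exactly once, and non-reserved names $d_1,\dots,d_j$ such that $[\![\mathrm{op}(M_1,\dots,M_j)]\!]_c=C[[\![M_1]\!]_{d_1};\dots;[\![M_j]\!]_{d_j}]$ whenever $\mathrm{fn}(M_1,\dots,M_j)=X$. 2. *Name invariance*: if $\sigma$ is a name substitution and $\sigma'$ is a name substitution that fixes $s$ and $k$, maps $c$ to a non-reserved name, and satisfies $\varphi(\sigma(a))=\sigma'(\varphi(a))$ for all names $a$, then $[\![\sigma M]\!]_{\sigma'(c)}=\sigma'[\![M]\!]_c$ if $\sigma$ is injective, and $[\![\sigma M]\!]_{\sigma'(c)}\simeq\sigma'[\![M]\!]_c$ otherwise. (Combinators contain no names, so $\mathrm{fn}(M)=\emptyset$ and $\sigma M=M$.) 3. *Operational correspondence*: if $M\Rightarrow M'$ then $[\![M]\!]_c\Rightarrow\simeq[\![M']\!]_c$; and if $[\![M]\!]_c\Rightarrow T$ then there is $M'$ with $M\Rightarrow M'$ and $T\Rightarrow\simeq[\![M']\!]_c$. 4. *Divergence reflection*: if $[\![M]\!]_c$ has an infinite reduction sequence then so does $M$.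 5. *Parallelisation*: there is a process $\mathcal A$ parametrised by three names such that, for all distinct non-reserved $n_1,n_2$ different from $c$, $[\![MN]\!]_c=(\nu n_1)(\nu n_2)(\mathcal A(c,n_1,n_2)\,|\,[\![M]\!]_{n_1}\,|\,[\![N]\!]_{n_2})$. Moreover, the translation delivers constructions over the reserved names on $c$ and does not fix a reduction strategy: for all non-reserved $c$ and all combinators $M,N$, $$M\Rightarrow N\quad\Longleftrightarrow\quad \bigl([\![M]\!]_c\,|\,(c\bullet\langle N\rangle\to\mathsf{ok})\bigr)\Downarrow .$$ -/

import Mathlib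

/-! ## SK-calculus -/

/-- Combinators of SK-calculus. -/
inductive SK : Type
  | S : SK
  | K : SK
  | app : SK → SK → SK

namespace SK

/-- One reduction step.  Reduction is allowed in both components of every application,
so no reduction strategy is fixed. -/
inductive Step : SK → SK → Prop
  | ruleS (M N X : SK) : Step (app (app (app S M) N) X) (app (app M X) (app N X))
  | ruleK (X Y : SK) : Step (app (app K X) Y) X
  | appL {M M' : SK} (N : SK) : Step M M' → Step (app M N) (app M' N)
  | appR (M : SK) {N N' : SK} : Step N N' → Step (app M N) (app M N')

/-- Reflexive transitive closure of reduction. -/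
def Steps : SK → SK → Prop := Relation.ReflTransGen Step

/-- `M` has an infinite reduction sequence. -/
def Diverges (M : SK) : Prop := ∃ f : ℕ → SK, f 0 = M ∧ ∀ i, Step (f i) (f (i + 1))

/-- The operators of SK-calculus. -/
inductive Op : Type
  | S : Op
  | K : Op
  | app : Op

def Op.arity : Op → ℕ
  | .S => 0
  | .K => 0
  | .app => 2

def Op.apply : (o : Op) → (Fin o.arity → SK) → SK
  | .S, _ => SK.S
  | .K, _ => SK.K
  | .app, args => SK.app (args (0 : Fin 2)) (args (1 : Fin 2))

end SK

/-! ## Concurrent pattern calculus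

Free names are natural numbers and bound names are well-scoped de Bruijn indices, so processes
are taken up to alpha-conversion.  `Proc n` is the type of processes in the scope of `n` binders;
the processes of the calculus are the elements of `Proc 0`. -/

namespace CPC

abbrev Name : Type := ℕ

/-- A free name, or a reference to one of the `n` enclosing binders (the innermost binder
has the largest index). -/
inductive Var (n : ℕ) : Type
  | free (a : Name) : Var n
  | bound (i : Fin n) : Var n

/-- Communicable patterns: built from variable names only. -/
inductive CPat (n : ℕ) : Type
  | nm (x : Var n) : CPat n
  | comp (d e : CPat n) : CPat n

/-- `Pat n k`: patterns in scope `n` with `k` binding names, which are numbered from left to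
right and hence pairwise distinct. -/
inductive Pat (n : ℕ) : ℕ → Type
  | lam : Pat n 1
  | nm (x : Var n) : Pat n 0
  | prot (x : Var n) : Pat n 0
  | comp {j k : ℕ} (p : Pat n j) (q : Pat n k) : Pat n (j + k)

/-- A communicable pattern as a pattern. -/
def CPat.toPat {n : ℕ} : CPat n → Pat n 0
  | .nm x => .nm x
  | .comp d e => .comp d.toPat e.toPat

/-- Protection extended to communicable patterns. -/
def CPat.toProt {n : ℕ} : CPat n → Pat n 0
  | .nm x => .prot x
  | .comp d e => .comp d.toProt e.toProt

/-- Processes: null, success, parallel composition, replication, restriction `(ν a) P`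
and the case `p → P`. -/
inductive Proc : ℕ → Type
  | zero {n : ℕ} : Proc n
  | ok {n : ℕ} : Proc n
  | par {n : ℕ} (P Q : Proc n) : Proc n
  | rep {n : ℕ} (P : Proc n) : Proc n
  | res {n : ℕ} (P : Proc (n + 1)) : Proc n
  | caseOf {n k : ℕ} (p : Pat n k) (P : Proc (n + k)) : Proc n

/-! ### Substitution -/

def Var.wk {n : ℕ} (k : ℕ) : Var n → Var (n + k)
  | .free a => .free a
  | .bound i => .bound (Fin.castAdd k i)

def CPat.wk {n : ℕ} (k : ℕ) : CPat n → CPat (n + k)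
  | .nm x => .nm (x.wk k)
  | .comp d e => .comp (d.wk k) (e.wk k)

/-- Extension of a substitution under `k` further binders. -/
def lift {n m : ℕ} (θ : Var n → CPat m) (k : ℕ) : Var (n + k) → CPat (m + k)
  | .free a => (θ (.free a)).wk k
  | .bound i =>
      Fin.addCases (fun i => (θ (.bound i)).wk k)
        (fun j => CPat.nm (Var.bound (Fin.natAdd m j))) i

def Pat.subst {n m : ℕ} (θ : Var n → CPat m) : {k : ℕ} → Pat n k → Pat m k
  | _, .lam => .lam
  | _, .nm x => (θ x).toPat
  | _, .prot x => (θ x).toProt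
  | _, .comp p q => .comp (p.subst θ) (q.subst θ)

/-- Capture-avoiding substitution of communicable patterns for names. -/
def Proc.subst : {n m : ℕ} → (Var n → CPat m) → Proc n → Proc m
  | _, _, _, .zero => .zero
  | _, _, _, .ok => .ok
  | _, _, θ, .par P Q => .par (P.subst θ) (Q.subst θ)
  | _, _, θ, .rep P => .rep (P.subst θ)
  | _, _, θ, .res P => .res (P.subst (lift θ 1))
  | _, _, θ, .caseOf (k := k) p P => .caseOf (p.subst θ) (P.subst (lift θ k))

/-- Renaming of the free names. -/
def Proc.rename {n : ℕ} (f : Name → Name) (P : Proc n) : Proc n :=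
  P.subst fun x => .nm (match x with
    | .free a => .free (f a)
    | .bound i => .bound i)

def Proc.wk {n : ℕ} (k : ℕ) (P : Proc n) : Proc (n + k) := P.subst fun x => .nm (x.wk k)

/-- Replaces the `k` innermost binders by the given communicable patterns. -/
def Proc.inst {n k : ℕ} (P : Proc (n + k)) (σ : Fin k → CPat n) : Proc n :=
  P.subst fun x => match x with
    | .free a => .nm (.free a)
    | .bound i => Fin.addCases (fun i => .nm (.bound i)) σ i

/-- Exchanges the two innermost binders. -/
def Proc.swap {n : ℕ} (P : Proc (n + 1 + 1)) : Proc (n + 1 + 1) :=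
  P.subst fun x => .nm (match x with
    | .free a => .free a
    | .bound i => .bound (Equiv.swap (Fin.last (n + 1)) (Fin.last n).castSucc i))

/-- Turns the distinct free names `x 0, …, x (k-1)` into references to `k` new binders. -/
noncomputable def Proc.bindNames {n k : ℕ} (x : Fin k ↪ Name) (P : Proc n) : Proc (n + k) :=
  P.subst fun y => .nm (match y with
    | .free a => (match Function.partialInv x a with
        | some j => .bound (Fin.natAdd n j)
        | none => .free a)
    | .bound i => .bound (Fin.castAdd k i))

/-- The restriction `(ν a) P` of a free name `a`. -/
noncomputable def nu {n : ℕ} (a : Name) (P : Proc n) : Proc n :=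
  .res (P.bindNames (k := 1) ⟨fun _ => a, Function.injective_of_subsingleton _⟩)

/-- `(ν a₁) … (ν aₗ) P`. -/
noncomputable def nus {n : ℕ} (as : List Name) (P : Proc n) : Proc n := as.foldr nu P

/-! ### Semantics -/

/-- Pattern unification `{p ∥ q} = (σ, ρ)`. -/
inductive Unify {n : ℕ} : {j k : ℕ} → Pat n j → Pat n k →
    (Fin j → CPat n) → (Fin k → CPat n) → Prop
  | nm_nm (x : Var n) : Unify (.nm x) (.nm x) Fin.elim0 Fin.elim0
  | nm_prot (x : Var n) : Unify (.nm x) (.prot x) Fin.elim0 Fin.elim0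
  | prot_nm (x : Var n) : Unify (.prot x) (.nm x) Fin.elim0 Fin.elim0
  | prot_prot (x : Var n) : Unify (.prot x) (.prot x) Fin.elim0 Fin.elim0
  | lam_left (d : CPat n) : Unify .lam d.toPat (fun _ => d) Fin.elim0
  | lam_right (d : CPat n) : Unify d.toPat .lam Fin.elim0 (fun _ => d)
  | comp {j₁ j₂ k₁ k₂ : ℕ} {p₁ : Pat n j₁} {p₂ : Pat n j₂} {q₁ : Pat n k₁} {q₂ : Pat n k₂}
      {σ₁ : Fin j₁ → CPat n} {σ₂ : Fin j₂ → CPat n}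
      {ρ₁ : Fin k₁ → CPat n} {ρ₂ : Fin k₂ → CPat n} :
      Unify p₁ q₁ σ₁ ρ₁ → Unify p₂ q₂ σ₂ ρ₂ →
      Unify (.comp p₁ p₂) (.comp q₁ q₂) (Fin.append σ₁ σ₂) (Fin.append ρ₁ ρ₂)

/-- Structural equivalence, the least congruence with the usual laws. -/
inductive StrEq : {n : ℕ} → Proc n → Proc n → Prop
  | refl {n : ℕ} (P : Proc n) : StrEq P P
  | symm {n : ℕ} {P Q : Proc n} : StrEq P Q → StrEq Q P
  | trans {n : ℕ} {P Q R : Proc n} : StrEq P Q → StrEq Q R → StrEq P R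
  | par_congr {n : ℕ} {P P' Q Q' : Proc n} :
      StrEq P P' → StrEq Q Q' → StrEq (.par P Q) (.par P' Q')
  | rep_congr {n : ℕ} {P P' : Proc n} : StrEq P P' → StrEq (.rep P) (.rep P')
  | res_congr {n : ℕ} {P P' : Proc (n + 1)} : StrEq P P' → StrEq (.res P) (.res P')
  | case_congr {n k : ℕ} (p : Pat n k) {P P' : Proc (n + k)} :
      StrEq P P' → StrEq (.caseOf p P) (.caseOf p P')
  | par_zero {n : ℕ} (P : Proc n) : StrEq (.par P .zero) P
  | par_comm {n : ℕ} (P Q : Proc n) : StrEq (.par P Q) (.par Q P)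
  | par_assoc {n : ℕ} (P Q R : Proc n) : StrEq (.par P (.par Q R)) (.par (.par P Q) R)
  | rep_unfold {n : ℕ} (P : Proc n) : StrEq (.rep P) (.par P (.rep P))
  | res_zero {n : ℕ} : StrEq (.res .zero) (.zero : Proc n)
  | res_swap {n : ℕ} (P : Proc (n + 1 + 1)) : StrEq (.res (.res P)) (.res (.res P.swap))
  | extrude {n : ℕ} (P : Proc n) (Q : Proc (n + 1)) :
      StrEq (.par P (.res Q)) (.res (.par (P.wk 1) Q))

/-- One reduction step. -/
inductive Red : {n : ℕ} → Proc n → Proc n → Prop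
  | comm {n j k : ℕ} {p : Pat n j} {q : Pat n k} {σ : Fin j → CPat n} {ρ : Fin k → CPat n}
      (P : Proc (n + j)) (Q : Proc (n + k)) :
      Unify p q σ ρ → Red (.par (.caseOf p P) (.caseOf q Q)) (.par (P.inst σ) (Q.inst ρ))
  | par {n : ℕ} {P P' : Proc n} (Q : Proc n) : Red P P' → Red (.par P Q) (.par P' Q)
  | res {n : ℕ} {P P' : Proc (n + 1)} : Red P P' → Red (.res P) (.res P')
  | struct {n : ℕ} {P Q Q' P' : Proc n} : StrEq P Q → Red Q Q' → StrEq Q' P' → Red P P'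

/-- Reflexive transitive closure of reduction. -/
def Reds : Proc 0 → Proc 0 → Prop := Relation.ReflTransGen Red

/-- `P` has an infinite reduction sequence. -/
def Diverges (P : Proc 0) : Prop := ∃ f : ℕ → Proc 0, f 0 = P ∧ ∀ i, Red (f i) (f (i + 1))

/-- `P ⇓`: some reduct of `P` is structurally a parallel composition with the success process. -/
def Succeeds (P : Proc 0) : Prop := ∃ P' P'' : Proc 0, Reds P P' ∧ StrEq P' (.par P'' .ok)

/-! ### Behavioural equivalence -/

/-- Protected (free) names of a pattern. -/
def Pat.protNames : {k : ℕ} → Pat 0 k → Set Name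
  | _, .lam => ∅
  | _, .nm _ => ∅
  | _, .prot x => {a | x = .free a}
  | _, .comp p q => p.protNames ∪ q.protNames

/-- Free (variable or protected) names of a pattern. -/
def Pat.freeNames : {k : ℕ} → Pat 0 k → Set Name
  | _, .lam => ∅
  | _, .nm x => {a | x = .free a}
  | _, .prot x => {a | x = .free a}
  | _, .comp p q => p.freeNames ∪ q.freeNames

/-- The barb `P ↓ m`: `P` is structurally `(ν as)(p → P' | R)`, no protected name of `p` is
restricted, and `m` is the set of unrestricted free names of `p`. -/
def Barb (P : Proc 0) (m : Set Name) : Prop :=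
  ∃ (as : List Name) (k : ℕ) (p : Pat 0 k) (P' : Proc (0 + k)) (R : Proc 0),
    StrEq P (nus as (.par (.caseOf p P') R)) ∧
    (∀ a ∈ p.protNames, a ∉ as) ∧ m = {a | a ∈ p.freeNames ∧ a ∉ as}

def WeakBarb (P : Proc 0) (m : Set Name) : Prop := ∃ P', Reds P P' ∧ Barb P' m

/-- Process contexts with holes numbered by `Fin k`.  Binders carry names, which may capture
free names of the processes put into the holes. -/
inductive Ctx (k : ℕ) : Type
  | hole (i : Fin k) : Ctx k
  | zero : Ctx k
  | ok : Ctx k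
  | par (C D : Ctx k) : Ctx k
  | rep (C : Ctx k) : Ctx k
  | nu (a : Name) (C : Ctx k) : Ctx k
  | caseOf {j : ℕ} (p : Pat 0 j) (x : Fin j ↪ Name) (C : Ctx k) : Ctx k

noncomputable def Ctx.fill {k : ℕ} (Ps : Fin k → Proc 0) : Ctx k → Proc 0
  | .hole i => Ps i
  | .zero => .zero
  | .ok => .ok
  | .par C D => .par (C.fill Ps) (D.fill Ps)
  | .rep C => .rep (C.fill Ps)
  | .nu a C => CPC.nu a (C.fill Ps)
  | .caseOf p x C => .caseOf p ((C.fill Ps).bindNames x)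

/-- Number of occurrences of the `i`-th hole. -/
def Ctx.count {k : ℕ} (i : Fin k) : Ctx k → ℕ
  | .hole j => if i = j then 1 else 0
  | .zero => 0
  | .ok => 0
  | .par C D => C.count i + D.count i
  | .rep C => C.count i
  | .nu _ C => C.count i
  | .caseOf _ _ C => C.count i

/-- Every hole occurs exactly once. -/
def Ctx.Linear {k : ℕ} (C : Ctx k) : Prop := ∀ i, C.count i = 1

/-- `R` is a (weak) barbed bisimulation that is closed under all contexts. -/
structure IsBarbedCongruence (R : Proc 0 → Proc 0 → Prop) : Prop where
  symm : ∀ P Q, R P Q → R Q P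
  barb : ∀ P Q, R P Q → ∀ m, Barb P m → WeakBarb Q m
  succ : ∀ P Q, R P Q → Succeeds P → Succeeds Q
  red : ∀ P Q, R P Q → ∀ P', Red P P' → ∃ Q', Reds Q Q' ∧ R P' Q'
  ctx : ∀ P Q, R P Q → ∀ C : Ctx 1, C.Linear → R (C.fill fun _ => P) (C.fill fun _ => Q)

/-- Weak barbed congruence, the reference behavioural equivalence. -/
def BEq (P Q : Proc 0) : Prop := ∃ R, IsBarbedCongruence R ∧ R P Q

end CPC

/-! ## Parallel encodings of SK-calculus into CPC -/

namespace SKtoCPC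

open CPC (Name Proc)

/-- Combinators contain no names. -/
def freeNames (_ : SK) : Set Name := ∅

/-- A name substitution acts trivially on combinators. -/
def rename (_ : Name → Name) (M : SK) : SK := M

/-- The construction `⟨M⟩`: the combinator `M` as a pattern over the reserved names `s`, `k`. -/
def construct (s k : Name) : SK → CPC.CPat 0
  | .S => .nm (.free s)
  | .K => .nm (.free k)
  | .app M N => .comp (construct s k M) (construct s k N)

/-- The observer `c • ⟨N⟩ → ok`. -/
def observer (s k c : Name) (N : SK) : Proc 0 :=
  .caseOf (.comp (.nm (.free c)) (construct s k N).toPat) .ok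

/-- The translation `tr c M = ⟦M⟧_c`, with reserved names `s` and `k` and renaming policy `φ`,
is a parallel encoding. The parameter `c` ranges over the names that are not reserved. -/
structure IsParallelEncoding (s k : Name) (tr : Name → SK → Proc 0) {r : ℕ}
    (φ : Name → Fin r → Name) : Prop where
  policy_pos : 0 < r
  policy_reserved : ∀ a i, φ a i ≠ s ∧ φ a i ≠ k
  policy_disjoint : ∀ a b i j, φ a i = φ b j → a = b
  compositionality : ∀ c, c ≠ s → c ≠ k → ∀ (o : SK.Op) (N : Set Name),
    ∃ (C : CPC.Ctx o.arity) (d : Fin o.arity → Name), C.Linear ∧ (∀ i, d i ≠ s ∧ d i ≠ k) ∧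
      ∀ args : Fin o.arity → SK, (⋃ i, freeNames (args i)) = N →
        tr c (o.apply args) = C.fill fun i => tr (d i) (args i)
  name_invariance : ∀ (σ σ' : Name → Name), σ' s = s → σ' k = k →
    (∀ a i, φ (σ a) i = σ' (φ a i)) →
    ∀ c, c ≠ s → c ≠ k → σ' c ≠ s → σ' c ≠ k → ∀ M,
      (Function.Injective σ → tr (σ' c) (rename σ M) = (tr c M).rename σ') ∧
      (¬ Function.Injective σ → CPC.BEq (tr (σ' c) (rename σ M)) ((tr c M).rename σ'))
  completeness : ∀ c, c ≠ s → c ≠ k → ∀ M M', SK.Steps M M' →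
    ∃ T, CPC.Reds (tr c M) T ∧ CPC.BEq T (tr c M')
  soundness : ∀ c, c ≠ s → c ≠ k → ∀ M T, CPC.Reds (tr c M) T →
    ∃ M' T', SK.Steps M M' ∧ CPC.Reds T T' ∧ CPC.BEq T' (tr c M')
  divergence_reflection : ∀ c, c ≠ s → c ≠ k → ∀ M, CPC.Diverges (tr c M) → SK.Diverges M
  parallelisation : ∃ A : Name → Name → Name → Proc 0,
    ∀ c n₁ n₂, c ≠ s → c ≠ k → n₁ ≠ s → n₁ ≠ k → n₂ ≠ s → n₂ ≠ k →
      n₁ ≠ c → n₂ ≠ c → n₁ ≠ n₂ → ∀ M N,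
      tr c (.app M N) = CPC.nu n₁ (CPC.nu n₂ (.par (.par (A c n₁ n₂) (tr n₁ M)) (tr n₂ N)))

end SKtoCPC

namespace CPC

/-! ### Substitution calculus -/

def CPat.subst {n m : ℕ} (θ : Var n → CPat m) : CPat n → CPat m
  | .nm x => θ x
  | .comp d e => .comp (d.subst θ) (e.subst θ)

def Var.map {n m : ℕ} (f : Fin n → Fin m) : Var n → Var m
  | .free a => .free a
  | .bound i => .bound (f i)

/-- The substitution that renames bound indices along `f`. -/
def renS {n m : ℕ} (f : Fin n → Fin m) : Var n → CPat m := fun x => .nm (x.map f)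

/-- The weakening substitution. -/
def wkS {n : ℕ} (k : ℕ) : Var n → CPat (n + k) := renS (Fin.castAdd k)

/-- The substitution that instantiates the innermost `k` binders. -/
def instS {n k : ℕ} (σ : Fin k → CPat n) : Var (n + k) → CPat n := fun x => match x with
    | .free a => .nm (.free a)
    | .bound i => Fin.addCases (fun i => .nm (.bound i)) σ i

def swapF (n : ℕ) : Fin (n + 1 + 1) → Fin (n + 1 + 1) :=
  Equiv.swap (Fin.last (n + 1)) (Fin.last n).castSucc

def liftF {n m : ℕ} (f : Fin n → Fin m) (k : ℕ) : Fin (n + k) → Fin (m + k) := fun i =>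
  Fin.addCases (fun i => Fin.castAdd k (f i)) (fun j => Fin.natAdd m j) i

theorem CPat.subst_nm {n : ℕ} (d : CPat n) : d.subst CPat.nm = d := by
  induction d with
  | nm x => rfl
  | comp d e h1 h2 => simp [CPat.subst, h1, h2]

theorem CPat.subst_subst {n m l : ℕ} (θ : Var n → CPat m) (θ' : Var m → CPat l) (d : CPat n) :
    (d.subst θ).subst θ' = d.subst (fun x => (θ x).subst θ') := by
  induction d with
  | nm x => rfl
  | comp d e h1 h2 => simp [CPat.subst, h1, h2]

theorem Var.wk_eq_map {n : ℕ} (k : ℕ) (x : Var n) : x.wk k = x.map (Fin.castAdd k) := by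
  cases x <;> rfl

theorem CPat.wk_eq_subst {n : ℕ} (k : ℕ) (d : CPat n) : d.wk k = d.subst (wkS k) := by
  induction d with
  | nm x => simp [CPat.wk, CPat.subst, wkS, renS, Var.wk_eq_map]
  | comp d e h1 h2 => simp [CPat.wk, CPat.subst, h1, h2]

theorem CPat.wk_subst_lift {n m : ℕ} (θ : Var n → CPat m) (k : ℕ) (d : CPat n) :
    (d.wk k).subst (lift θ k) = (d.subst θ).wk k := by
  induction d with
  | nm x => cases x <;> simp [CPat.wk, CPat.subst, Var.wk, lift]
  | comp d e h1 h2 => simp [CPat.wk, CPat.subst, h1, h2]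

theorem CPat.wk_subst_instS {n k : ℕ} (σ : Fin k → CPat n) (d : CPat n) :
    (d.wk k).subst (instS σ) = d := by
  induction d with
  | nm x => cases x <;> simp [CPat.wk, CPat.subst, Var.wk, instS]
  | comp d e h1 h2 => simp [CPat.wk, CPat.subst, h1, h2]

theorem CPat.toPat_subst {n m : ℕ} (θ : Var n → CPat m) (d : CPat n) :
    d.toPat.subst θ = (d.subst θ).toPat := by
  induction d with
  | nm x => rfl
  | comp d e h1 h2 =>
    show Pat.comp (d.toPat.subst θ) (e.toPat.subst θ) = _
    rw [h1, h2]; rfl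

theorem CPat.toProt_subst {n m : ℕ} (θ : Var n → CPat m) (d : CPat n) :
    d.toProt.subst θ = (d.subst θ).toProt := by
  induction d with
  | nm x => rfl
  | comp d e h1 h2 =>
    show Pat.comp (d.toProt.subst θ) (e.toProt.subst θ) = _
    rw [h1, h2]; rfl

theorem lift_nm {n : ℕ} (k : ℕ) : lift (CPat.nm : Var n → CPat n) k = CPat.nm := by
  funext x
  cases x with
  | free a => rfl
  | bound i =>
    induction i using Fin.addCases <;> simp [lift, CPat.wk, Var.wk]

theorem lift_comp {n m l : ℕ} (θ : Var n → CPat m) (θ' : Var m → CPat l) (k : ℕ) :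
    (fun x => (lift θ k x).subst (lift θ' k)) = lift (fun x => (θ x).subst θ') k := by
  funext x
  cases x with
  | free a => simp [lift, CPat.wk_subst_lift]
  | bound i =>
    induction i using Fin.addCases with
    | left i => simp [lift, CPat.wk_subst_lift]
    | right i => simp [lift, CPat.subst]

theorem lift_renS {n m : ℕ} (f : Fin n → Fin m) (k : ℕ) :
    lift (renS f) k = renS (liftF f k) := by
  funext x
  cases x with
  | free a => rfl
  | bound i =>
    induction i using Fin.addCases <;> simp [lift, renS, liftF, CPat.wk, Var.wk, Var.map]

theorem Pat.subst_nm {n k : ℕ} (p : Pat n k) : p.subst CPat.nm = p := by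
  induction p with
  | lam => rfl
  | nm x => rfl
  | prot x => rfl
  | comp p q h1 h2 => simp [Pat.subst, h1, h2]

theorem Pat.subst_subst {n m l k : ℕ} (θ : Var n → CPat m) (θ' : Var m → CPat l) (p : Pat n k) :
    (p.subst θ).subst θ' = p.subst (fun x => (θ x).subst θ') := by
  induction p with
  | lam => rfl
  | nm x => simp [Pat.subst, CPat.toPat_subst]
  | prot x => simp [Pat.subst, CPat.toProt_subst]
  | comp p q h1 h2 => simp [Pat.subst, h1, h2]

theorem Proc.subst_nm {n : ℕ} (P : Proc n) : P.subst CPat.nm = P := by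
  induction P with
  | zero => rfl
  | ok => rfl
  | par P Q h1 h2 => simp [Proc.subst, h1, h2]
  | rep P h => simp [Proc.subst, h]
  | res P h => simp [Proc.subst, lift_nm, h]
  | caseOf p P h => simp [Proc.subst, lift_nm, h, Pat.subst_nm]

theorem Proc.subst_subst {n m l : ℕ} (θ : Var n → CPat m) (θ' : Var m → CPat l) (P : Proc n) :
    (P.subst θ).subst θ' = P.subst (fun x => (θ x).subst θ') := by
  induction P generalizing m l with
  | zero => rfl
  | ok => rfl
  | par P Q h1 h2 => simp [Proc.subst, h1, h2]
  | rep P h => simp [Proc.subst, h]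
  | res P h => simp [Proc.subst, h, lift_comp]
  | caseOf p P h => simp [Proc.subst, h, lift_comp, Pat.subst_subst]

theorem Proc.wk_eq {n : ℕ} (k : ℕ) (P : Proc n) : P.wk k = P.subst (wkS k) := by
  simp only [Proc.wk, wkS, Var.wk_eq_map]; rfl

theorem Proc.inst_eq {n k : ℕ} (P : Proc (n + k)) (σ : Fin k → CPat n) :
    P.inst σ = P.subst (instS σ) := rfl

theorem Proc.swap_eq {n : ℕ} (P : Proc (n + 1 + 1)) : P.swap = P.subst (renS (swapF n)) := by
  unfold Proc.swap renS swapF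
  congr 1
  funext x; cases x <;> rfl

theorem instS_subst {n m k : ℕ} (σ : Fin k → CPat n) (θ : Var n → CPat m) :
    (fun x => (instS σ x).subst θ) =
      fun x => (lift θ k x).subst (instS (fun i => (σ i).subst θ)) := by
  funext x
  cases x with
  | free a => simp [lift, instS, CPat.wk_subst_instS, CPat.subst]
  | bound i =>
    induction i using Fin.addCases <;> simp [lift, instS, CPat.wk_subst_instS, CPat.subst]

theorem Proc.inst_subst {n m k : ℕ} (P : Proc (n + k)) (σ : Fin k → CPat n) (θ : Var n → CPat m) :
    (P.inst σ).subst θ = (P.subst (lift θ k)).inst (fun i => (σ i).subst θ) := by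
  simp only [Proc.inst_eq, Proc.subst_subst, instS_subst]

theorem Proc.inst_zero {n : ℕ} (P : Proc n) (σ : Fin 0 → CPat n) :
    Proc.inst (n := n) (k := 0) P σ = P := by
  have h : instS (n := n) (k := 0) σ = CPat.nm := by
    funext x
    cases x with
    | free a => rfl
    | bound i =>
      show instS (n := n) (k := 0) σ (.bound (Fin.castAdd 0 i)) = _
      simp only [instS, Fin.addCases_left]
  rw [Proc.inst_eq, h]
  exact Proc.subst_nm P

theorem wkS_subst_lift {n m : ℕ} (θ : Var n → CPat m) (k : ℕ) :
    (fun x => (wkS k x).subst (lift θ k)) = fun x => (θ x).subst (wkS k) := by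
  funext x
  have := CPat.wk_subst_lift θ k (.nm x)
  simpa [CPat.wk_eq_subst, CPat.subst] using this

theorem Proc.wk_subst_lift {n m : ℕ} (θ : Var n → CPat m) (k : ℕ) (P : Proc n) :
    (P.subst (wkS k)).subst (lift θ k) = (P.subst θ).subst (wkS k) := by
  rw [Proc.subst_subst, Proc.subst_subst, wkS_subst_lift]

theorem Pat.wk_subst_lift {n m j : ℕ} (θ : Var n → CPat m) (k : ℕ) (P : Pat n j) :
    (P.subst (wkS k)).subst (lift θ k) = (P.subst θ).subst (wkS k) := by
  rw [Pat.subst_subst, Pat.subst_subst, wkS_subst_lift]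

theorem Proc.wk_subst_lift' {n m j : ℕ} (θ : Var n → CPat m) (k : ℕ) (P : Proc (n + j)) :
    (P.subst (lift (wkS k) j)).subst (lift (lift θ k) j) =
      (P.subst (lift θ j)).subst (lift (wkS k) j) := by
  rw [Proc.subst_subst, Proc.subst_subst, lift_comp, lift_comp, wkS_subst_lift]

theorem swapF_last (n : ℕ) : swapF n (Fin.last (n + 1)) = (Fin.last n).castSucc := by
  simp [swapF]

theorem swapF_last' (n : ℕ) : swapF n (Fin.last n).castSucc = Fin.last (n + 1) := by
  simp [swapF]

theorem swapF_old {n : ℕ} (i : Fin n) : swapF n i.castSucc.castSucc = i.castSucc.castSucc := by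
  apply Equiv.swap_apply_of_ne_of_ne
  · exact Fin.ne_of_lt (by simp [Fin.lt_def])
  · exact Fin.ne_of_lt (by simp [Fin.lt_def])

theorem CPat.wk_wk_swap {n : ℕ} (d : CPat n) :
    ((d.wk 1).wk 1).subst (renS (swapF n)) = (d.wk 1).wk 1 := by
  induction d with
  | nm x =>
    cases x with
    | free a => rfl
    | bound i =>
      have := swapF_old i
      simp only [CPat.wk, Var.wk, CPat.subst, renS, Var.map]
      congr 2
  | comp d e h1 h2 => simp [CPat.wk, CPat.subst, h1, h2]

/-- The values of `θ` are weakened twice, so they mention neither of the two innermost binders and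
the exchange leaves them alone. -/
theorem swap_lift {n m : ℕ} (θ : Var n → CPat m) :
    (fun x => (renS (swapF n) x).subst (lift (lift θ 1) 1)) =
      fun x => (lift (lift θ 1) 1 x).subst (renS (swapF m)) := by
  funext x
  cases x with
  | free a => simp [renS, Var.map, CPat.subst, lift, CPat.wk_wk_swap]
  | bound i =>
    have hl : ∀ k : ℕ, Fin.last (k) = Fin.natAdd k (0 : Fin 1) := fun k => by
      ext; simp
    have hc : ∀ (k : ℕ) (i : Fin k), i.castSucc = Fin.castAdd 1 i := fun k i => rfl
    induction i using Fin.lastCases with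
    | last =>
      simp only [renS, Var.map, CPat.subst, swapF_last]
      simp only [lift, hl, hc, Fin.addCases_left, Fin.addCases_right, CPat.wk, Var.wk, CPat.subst,
        renS, Var.map]
      congr 2
      rw [← hl, ← hc, ← hl, swapF_last]
    | cast i =>
      induction i using Fin.lastCases with
      | last =>
        simp only [renS, Var.map, CPat.subst, swapF_last']
        simp only [lift, hl, hc, Fin.addCases_left, Fin.addCases_right, CPat.wk, Var.wk, CPat.subst,
          renS, Var.map]
        congr 2
        rw [← hl, ← hc, ← hl, swapF_last']
      | cast i =>
        simp only [renS, Var.map, CPat.subst, swapF_old]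
        simp only [lift, hc, Fin.addCases_left, CPat.wk_wk_swap]

/-- Arbitrary pattern-valued substitutions are needed, since a continuation receives patterns when
its prefix reacts. Only the two scope laws need an argument: exchange and weakening commute with
lifted substitutions. -/
theorem StrEq.subst {n : ℕ} {P Q : Proc n} (h : StrEq P Q) :
    ∀ {m : ℕ} (θ : Var n → CPat m), StrEq (P.subst θ) (Q.subst θ) := by
  induction h with
  | refl P => intro m θ; exact .refl _
  | symm _ ih => intro m θ; exact .symm (ih θ)
  | trans _ _ ih1 ih2 => intro m θ; exact .trans (ih1 θ) (ih2 θ)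
  | par_congr _ _ ih1 ih2 => intro m θ; exact .par_congr (ih1 θ) (ih2 θ)
  | rep_congr _ ih => intro m θ; exact .rep_congr (ih θ)
  | res_congr _ ih => intro m θ; exact .res_congr (ih _)
  | case_congr p _ ih => intro m θ; exact .case_congr _ (ih _)
  | par_zero P => intro m θ; exact .par_zero _
  | par_comm P Q => intro m θ; exact .par_comm _ _
  | par_assoc P Q R => intro m θ; exact .par_assoc _ _ _
  | rep_unfold P => intro m θ; exact .rep_unfold _
  | res_zero => intro m θ; exact .res_zero
  | res_swap P =>
    intro m θ
    have := StrEq.res_swap (P.subst (lift (lift θ 1) 1))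
    rwa [Proc.swap_eq, Proc.subst_subst, ← swap_lift, ← Proc.subst_subst, ← Proc.swap_eq] at this
  | extrude P Q =>
    intro m θ
    have := StrEq.extrude (P.subst θ) (Q.subst (lift θ 1))
    rwa [Proc.wk_eq, ← Proc.wk_subst_lift, ← Proc.wk_eq] at this

/-! ### Unification on raw patterns -/

/-- Patterns without the index that counts binding names. -/
inductive RPat (n : ℕ) : Type
  | lam : RPat n
  | nm (x : Var n) : RPat n
  | prot (x : Var n) : RPat n
  | comp (p q : RPat n) : RPat n

def Pat.raw {n : ℕ} : {k : ℕ} → Pat n k → RPat n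
  | _, .lam => .lam
  | _, .nm x => .nm x
  | _, .prot x => .prot x
  | _, .comp p q => .comp p.raw q.raw

/-- The communicable pattern that a raw pattern is, if it is one. -/
def RPat.toC {n : ℕ} : RPat n → Option (CPat n)
  | .lam => none
  | .nm x => some (.nm x)
  | .prot _ => none
  | .comp p q => match p.toC, q.toC with
    | some d, some e => some (.comp d e)
    | _, _ => none

open Classical in
/-- Unification as a partial function. -/
noncomputable def runify {n : ℕ} : RPat n → RPat n → Option (List (CPat n) × List (CPat n))
  | .lam, q => match q.toC with
    | some d => some ([d], [])
    | none => none
  | .nm x, .lam => some ([], [.nm x])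
  | .nm x, .nm y => if x = y then some ([], []) else none
  | .nm x, .prot y => if x = y then some ([], []) else none
  | .nm _, .comp _ _ => none
  | .prot _, .lam => none
  | .prot x, .nm y => if x = y then some ([], []) else none
  | .prot x, .prot y => if x = y then some ([], []) else none
  | .prot _, .comp _ _ => none
  | .comp p q, .lam => match (RPat.comp p q).toC with
    | some d => some ([], [d])
    | none => none
  | .comp _ _, .nm _ => none
  | .comp _ _, .prot _ => none
  | .comp p q, .comp p' q' => match runify p p', runify q q' with
    | some r, some r' => some (r.1 ++ r'.1, r.2 ++ r'.2)
    | _, _ => none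

theorem toC_toPat {n : ℕ} (d : CPat n) : d.toPat.raw.toC = some d := by
  induction d with
  | nm x => rfl
  | comp d e h1 h2 =>
    show RPat.toC (.comp d.toPat.raw e.toPat.raw) = _
    simp [RPat.toC, h1, h2]

/-- Communicability excludes `λ`, so the number of binding names, which `raw` forgets, must be zero.
-/
theorem toC_eq_some {n k : ℕ} (p : Pat n k) (d : CPat n) (h : p.raw.toC = some d) :
    ∃ hk : k = 0, hk ▸ p = d.toPat := by
  induction p generalizing d with
  | lam => simp [Pat.raw, RPat.toC] at h
  | nm x =>
    simp only [Pat.raw, RPat.toC, Option.some.injEq] at h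
    subst h; exact ⟨rfl, rfl⟩
  | prot x => simp [Pat.raw, RPat.toC] at h
  | comp p q h1 h2 =>
    simp only [Pat.raw, RPat.toC] at h
    split at h
    · next d1 d2 e1 e2 =>
      obtain ⟨hk1, r1⟩ := h1 _ e1
      obtain ⟨hk2, r2⟩ := h2 _ e2
      subst hk1 hk2
      simp only [Option.some.injEq] at h
      subst h
      dsimp only at r1 r2
      subst r1 r2
      exact ⟨rfl, rfl⟩
    · simp at h

theorem runify_length {n : ℕ} {j k : ℕ} (p : Pat n j) (q : Pat n k) :
    ∀ r, runify p.raw q.raw = some r → r.1.length = j ∧ r.2.length = k := by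
  induction p generalizing k with
  | lam =>
    intro r h
    simp only [Pat.raw, runify] at h
    split at h
    · next d hd =>
      obtain ⟨hk, _⟩ := toC_eq_some _ _ hd
      simp only [Option.some.injEq] at h
      subst h hk; simp
    · simp at h
  | nm x =>
    intro r h
    cases q <;> simp [Pat.raw, runify] at h <;> grind
  | prot x =>
    intro r h
    cases q <;> simp [Pat.raw, runify] at h <;> grind
  | comp p1 p2 h1 h2 =>
    intro r h
    cases q with
    | lam =>
      simp only [Pat.raw, runify] at h
      split at h
      · next d hd =>
        obtain ⟨hk, _⟩ := toC_eq_some (Pat.comp p1 p2) d hd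
        simp only [Option.some.injEq] at h
        subst h; simp [hk]
      · simp at h
    | nm => simp [Pat.raw, runify] at h
    | prot => simp [Pat.raw, runify] at h
    | comp q1 q2 =>
      simp only [Pat.raw, runify] at h
      split at h
      · next r1 r2 e1 e2 =>
        simp only [Option.some.injEq] at h
        subst h
        simp [h1 _ _ e1, h2 _ _ e2]
      · simp at h

theorem runify_of_Unify {n j k : ℕ} {p : Pat n j} {q : Pat n k} {σ : Fin j → CPat n}
    {ρ : Fin k → CPat n} (h : Unify p q σ ρ) :
    runify p.raw q.raw = some (List.ofFn σ, List.ofFn ρ) := by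
  induction h with
  | nm_nm x => simp [Pat.raw, runify]
  | nm_prot x => simp [Pat.raw, runify]
  | prot_nm x => simp [Pat.raw, runify]
  | prot_prot x => simp [Pat.raw, runify]
  | lam_left d => simp [Pat.raw, runify, toC_toPat]
  | lam_right d =>
    have := toC_toPat d
    cases d with
    | nm x => simp [Pat.raw, CPat.toPat, runify]
    | comp d e =>
      simp only [CPat.toPat, Pat.raw, runify] at this ⊢
      rw [this]; simp
  | comp _ _ h1 h2 =>
    simp only [Pat.raw, runify, h1, h2, List.ofFn_fin_append]

theorem Unify_of_runify {n j k : ℕ} (p : Pat n j) (q : Pat n k) (σ : Fin j → CPat n)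
    (ρ : Fin k → CPat n) (h : runify p.raw q.raw = some (List.ofFn σ, List.ofFn ρ)) :
    Unify p q σ ρ := by
  induction p generalizing k with
  | lam =>
    simp only [Pat.raw, runify] at h
    split at h
    · next d hd =>
      obtain ⟨hk, hq⟩ := toC_eq_some _ _ hd
      subst hk
      dsimp only at hq
      subst hq
      have e1 : σ = fun _ => d := by
        funext i
        have := congrArg (fun r => r.map Prod.fst) h
        simp at this
        rw [Subsingleton.elim i 0, this]
      have e2 : ρ = Fin.elim0 := Subsingleton.elim _ _
      rw [e1, e2]; exact .lam_left d
    · simp at h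
  | nm x =>
    have e1 : σ = Fin.elim0 := Subsingleton.elim _ _
    cases q with
    | lam =>
      have e2 : ρ = fun _ => .nm x := by
        funext i
        simp [Pat.raw, runify] at h
        rw [Subsingleton.elim i 0, ← h]
      rw [e1, e2]; exact .lam_right (.nm x)
    | nm y =>
      have e2 : ρ = Fin.elim0 := Subsingleton.elim _ _
      simp [Pat.raw, runify] at h
      rw [e1, e2, h]; exact .nm_nm y
    | prot y =>
      have e2 : ρ = Fin.elim0 := Subsingleton.elim _ _
      simp [Pat.raw, runify] at h
      rw [e1, e2, h]; exact .nm_prot y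
    | comp q1 q2 => simp [Pat.raw, runify] at h
  | prot x =>
    have e1 : σ = Fin.elim0 := Subsingleton.elim _ _
    cases q with
    | lam => simp [Pat.raw, runify] at h
    | nm y =>
      have e2 : ρ = Fin.elim0 := Subsingleton.elim _ _
      simp [Pat.raw, runify] at h
      rw [e1, e2, h]; exact .prot_nm y
    | prot y =>
      have e2 : ρ = Fin.elim0 := Subsingleton.elim _ _
      simp [Pat.raw, runify] at h
      rw [e1, e2, h]; exact .prot_prot y
    | comp q1 q2 => simp [Pat.raw, runify] at h
  | @comp j1 j2 p1 p2 h1 h2 =>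
    cases q with
    | lam =>
      simp only [Pat.raw, runify] at h
      split at h
      · next d hd =>
        obtain ⟨hk, hq⟩ := toC_eq_some (Pat.comp p1 p2) d hd
        obtain ⟨rfl, rfl⟩ : j1 = 0 ∧ j2 = 0 := by omega
        dsimp only at hq
        have e2 : ρ = fun _ => d := by
          funext i
          have := congrArg (fun r => r.map Prod.snd) h
          simp at this
          rw [Subsingleton.elim i 0, this]
        have e1 : σ = Fin.elim0 := Subsingleton.elim (α := Fin 0 → CPat n) _ _
        rw [hq, e1, e2]
        exact .lam_right d
      · simp at h
    | nm => simp [Pat.raw, runify] at h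
    | prot => simp [Pat.raw, runify] at h
    | @comp k1 k2 q1 q2 =>
      simp only [Pat.raw, runify] at h
      split at h
      · next r1 r2 e1 e2 =>
        have l1 := runify_length _ _ _ e1
        have l2 := runify_length _ _ _ e2
        simp only [Option.some.injEq, Prod.mk.injEq] at h
        have a1 := Fin.append_castAdd_natAdd (f := σ)
        have a2 := Fin.append_castAdd_natAdd (f := ρ)
        rw [← a1, ← a2, List.ofFn_fin_append, List.ofFn_fin_append] at h
        have b1 := List.append_inj h.1 (by simp [l1])
        have b2 := List.append_inj h.2 (by simp [l1])
        rw [← a1, ← a2]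
        refine .comp (h1 _ _ _ ?_) (h2 _ _ _ ?_)
        · rw [e1, ← b1.1, ← b2.1]
        · rw [e2, ← b1.2, ← b2.2]
      · simp at h

/-- The indices `j + k` of compound patterns obstruct inversion of `Unify`. With lists in place of
tuples, unification can be computed, and cases are refuted by evaluation. -/
theorem Unify_iff {n j k : ℕ} {p : Pat n j} {q : Pat n k} {σ : Fin j → CPat n}
    {ρ : Fin k → CPat n} :
    Unify p q σ ρ ↔ runify p.raw q.raw = some (List.ofFn σ, List.ofFn ρ) :=
  ⟨runify_of_Unify, Unify_of_runify _ _ _ _⟩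

theorem Unify.swap {n j k : ℕ} {p : Pat n j} {q : Pat n k} {σ : Fin j → CPat n}
    {ρ : Fin k → CPat n} (h : Unify p q σ ρ) : Unify q p ρ σ := by
  induction h with
  | nm_nm x => exact .nm_nm x
  | nm_prot x => exact .prot_nm x
  | prot_nm x => exact .nm_prot x
  | prot_prot x => exact .prot_prot x
  | lam_left d => exact .lam_right d
  | lam_right d => exact .lam_left d
  | comp _ _ h1 h2 => exact .comp h1 h2

theorem Unify.congr {n j k : ℕ} {p : Pat n j} {q : Pat n k} {σ σ' : Fin j → CPat n}
    {ρ ρ' : Fin k → CPat n} (h : Unify p q σ ρ) (h1 : σ = σ') (h2 : ρ = ρ') :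
    Unify p q σ' ρ' := h1 ▸ h2 ▸ h

theorem Unify_toPat_toPat {n : ℕ} (d : CPat n) :
    Unify d.toPat d.toPat Fin.elim0 Fin.elim0 := by
  induction d with
  | nm x => exact .nm_nm x
  | comp d e h1 h2 =>
    exact (Unify.comp h1 h2).congr (Subsingleton.elim (α := Fin 0 → CPat n) _ _)
      (Subsingleton.elim (α := Fin 0 → CPat n) _ _)

theorem Unify_toPat_toProt {n : ℕ} (d : CPat n) :
    Unify d.toPat d.toProt Fin.elim0 Fin.elim0 := by
  induction d with
  | nm x => exact .nm_prot x
  | comp d e h1 h2 =>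
    exact (Unify.comp h1 h2).congr (Subsingleton.elim (α := Fin 0 → CPat n) _ _)
      (Subsingleton.elim (α := Fin 0 → CPat n) _ _)

theorem Unify_toProt_toProt {n : ℕ} (d : CPat n) :
    Unify d.toProt d.toProt Fin.elim0 Fin.elim0 := by
  induction d with
  | nm x => exact .prot_prot x
  | comp d e h1 h2 =>
    exact (Unify.comp h1 h2).congr (Subsingleton.elim (α := Fin 0 → CPat n) _ _)
      (Subsingleton.elim (α := Fin 0 → CPat n) _ _)

/-- Two matching occurrences of a name become copies of one pattern, each plain or protected
throughout, and such copies unify without binding anything. -/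
theorem Unify.subst {n m j k : ℕ} {p : Pat n j} {q : Pat n k} {σ : Fin j → CPat n}
    {ρ : Fin k → CPat n} (θ : Var n → CPat m) (h : Unify p q σ ρ) :
    Unify (p.subst θ) (q.subst θ) (fun i => (σ i).subst θ) (fun i => (ρ i).subst θ) := by
  have e0 : ∀ f : Fin 0 → CPat m, f = Fin.elim0 := fun f => Subsingleton.elim _ _
  induction h with
  | nm_nm x => rw [e0 (fun i => _)]; exact Unify_toPat_toPat _
  | nm_prot x => rw [e0 (fun i => _)]; exact Unify_toPat_toProt _
  | prot_nm x => rw [e0 (fun i => _)]; exact (Unify_toPat_toProt _).swap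
  | prot_prot x => rw [e0 (fun i => _)]; exact Unify_toProt_toProt _
  | lam_left d => rw [e0 (fun i : Fin 0 => _), CPat.toPat_subst]; exact .lam_left _
  | lam_right d => rw [e0 (fun i : Fin 0 => _), CPat.toPat_subst]; exact .lam_right _
  | comp _ _ h1 h2 =>
    refine (Unify.comp h1 h2).congr ?_ ?_
    · funext i; induction i using Fin.addCases <;> simp
    · funext i; induction i using Fin.addCases <;> simp

/-! ### Reflection of unification along injective renamings -/

def RPat.map {n m : ℕ} (f : Fin n → Fin m) : RPat n → RPat m
  | .lam => .lam
  | .nm x => .nm (x.map f)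
  | .prot x => .prot (x.map f)
  | .comp p q => .comp (p.map f) (q.map f)

theorem raw_ren {n m k : ℕ} (f : Fin n → Fin m) (p : Pat n k) :
    (p.subst (renS f)).raw = p.raw.map f := by
  induction p with
  | lam => rfl
  | nm x => rfl
  | prot x => rfl
  | comp p q h1 h2 => simp [Pat.subst, Pat.raw, RPat.map, h1, h2]

theorem Var.map_inj {n m : ℕ} {f : Fin n → Fin m} (hf : Function.Injective f) :
    Function.Injective (Var.map f) := by
  intro x y h
  cases x <;> cases y <;> simp_all [Var.map]
  exact hf h

theorem toC_map {n m : ℕ} (f : Fin n → Fin m) (p : RPat n) :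
    (p.map f).toC = p.toC.map (CPat.subst (renS f)) := by
  induction p with
  | lam => rfl
  | nm x => rfl
  | prot x => rfl
  | comp p q h1 h2 =>
    simp only [RPat.map, RPat.toC, h1, h2]
    cases p.toC <;> cases q.toC <;> simp [CPat.subst]

/-- Injectivity is essential: identifying two names creates new matches. -/
theorem runify_map {n m : ℕ} {f : Fin n → Fin m} (hf : Function.Injective f) (p q : RPat n) :
    runify (p.map f) (q.map f) = (runify p q).map
      (fun r => (r.1.map (CPat.subst (renS f)), r.2.map (CPat.subst (renS f)))) := by
  have hi := Var.map_inj hf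
  induction p generalizing q with
  | lam =>
    simp only [RPat.map, runify, toC_map]
    cases q.toC <;> simp
  | nm x =>
    cases q with
    | lam => simp [RPat.map, runify, CPat.subst, renS]
    | nm y => by_cases h : x = y <;> simp [RPat.map, runify, hi.eq_iff, h]
    | prot y => by_cases h : x = y <;> simp [RPat.map, runify, hi.eq_iff, h]
    | comp => simp [RPat.map, runify]
  | prot x =>
    cases q with
    | lam => simp [RPat.map, runify]
    | nm y => by_cases h : x = y <;> simp [RPat.map, runify, hi.eq_iff, h]
    | prot y => by_cases h : x = y <;> simp [RPat.map, runify, hi.eq_iff, h]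
    | comp => simp [RPat.map, runify]
  | comp p1 p2 h1 h2 =>
    cases q with
    | lam =>
      have := toC_map f (RPat.comp p1 p2)
      simp only [RPat.map] at this
      simp only [RPat.map, runify, this]
      cases (RPat.comp p1 p2).toC <;> simp
    | nm y => simp [RPat.map, runify]
    | prot y => simp [RPat.map, runify]
    | comp q1 q2 =>
      simp only [RPat.map, runify, h1, h2]
      cases runify p1 q1 <;> cases runify p2 q2 <;> simp

theorem Unify.reflect {n m j k : ℕ} {f : Fin n → Fin m} (hf : Function.Injective f)
    {p : Pat n j} {q : Pat n k} {σ : Fin j → CPat m} {ρ : Fin k → CPat m}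
    (h : Unify (p.subst (renS f)) (q.subst (renS f)) σ ρ) :
    ∃ σ₀ ρ₀, Unify p q σ₀ ρ₀ ∧ σ = (fun i => (σ₀ i).subst (renS f)) ∧
      ρ = (fun i => (ρ₀ i).subst (renS f)) := by
  rw [Unify_iff, raw_ren, raw_ren, runify_map hf] at h
  rcases hr : runify p.raw q.raw with _ | ⟨l1, l2⟩
  · simp [hr] at h
  · have hl := runify_length _ _ _ hr
    dsimp only at hl
    obtain ⟨rfl, rfl⟩ := hl
    refine ⟨l1.get, l2.get, ?_, ?_, ?_⟩
    · rw [Unify_iff, hr]; simp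
    · simp only [hr, Option.map_some, Option.some.injEq, Prod.mk.injEq] at h
      apply List.ofFn_injective
      rw [← h.1]
      conv_lhs => rw [← List.ofFn_get l1, List.map_ofFn]
      rfl
    · simp only [hr, Option.map_some, Option.some.injEq, Prod.mk.injEq] at h
      apply List.ofFn_injective
      rw [← h.2]
      conv_lhs => rw [← List.ofFn_get l2, List.map_ofFn]
      rfl

/-! ### A structural transition system -/

/-- `Int P q D X`: some exposed thread of `P` communicates with the thread `q → D`,
and `X` is what `P | (q → D)` becomes. -/
inductive Int : {n : ℕ} → Proc n → {k : ℕ} → Pat n k → Proc (n + k) → Proc n → Prop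
  | comm {n j k : ℕ} {p : Pat n j} {q : Pat n k} {σ : Fin j → CPat n} {ρ : Fin k → CPat n}
      (C : Proc (n + j)) (D : Proc (n + k)) (h : Unify p q σ ρ) :
      Int (.caseOf p C) q D (.par (C.inst σ) (D.inst ρ))
  | parL {n k : ℕ} {P X : Proc n} {q : Pat n k} {D : Proc (n + k)} (Q : Proc n) :
      Int P q D X → Int (.par P Q) q D (.par X Q)
  | parR {n k : ℕ} {Q X : Proc n} {q : Pat n k} {D : Proc (n + k)} (P : Proc n) :
      Int Q q D X → Int (.par P Q) q D (.par P X)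
  | rep {n k : ℕ} {P X : Proc n} {q : Pat n k} {D : Proc (n + k)} :
      Int P q D X → Int (.rep P) q D (.par X (.rep P))
  | res {n k : ℕ} {P X : Proc (n + 1)} {q : Pat n k} {D : Proc (n + k)} :
      Int P (q.subst (wkS 1)) (D.subst (lift (wkS 1) k)) X → Int (.res P) q D (.res X)

/-- `Com P Q X`: an exposed thread of `P` communicates with an exposed thread of `Q`, and `P | Q`
becomes `X`. -/
inductive Com : {n : ℕ} → Proc n → Proc n → Proc n → Prop
  | case {n k : ℕ} {p : Pat n k} {C : Proc (n + k)} {Q X : Proc n} :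
      Int Q p C X → Com (.caseOf p C) Q X
  | parL {n : ℕ} {P Q X : Proc n} (P' : Proc n) : Com P Q X → Com (.par P P') Q (.par X P')
  | parR {n : ℕ} {P' Q X : Proc n} (P : Proc n) : Com P' Q X → Com (.par P P') Q (.par P X)
  | rep {n : ℕ} {P Q X : Proc n} : Com P Q X → Com (.rep P) Q (.par X (.rep P))
  | res {n : ℕ} {P X : Proc (n + 1)} {Q : Proc n} :
      Com P (Q.subst (wkS 1)) X → Com (.res P) Q (.res X)

/-- Structural reduction. -/
inductive Tau : {n : ℕ} → Proc n → Proc n → Prop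
  | com {n : ℕ} {P Q X : Proc n} : Com P Q X → Tau (.par P Q) X
  | parL {n : ℕ} {P P' : Proc n} (Q : Proc n) : Tau P P' → Tau (.par P Q) (.par P' Q)
  | parR {n : ℕ} {Q Q' : Proc n} (P : Proc n) : Tau Q Q' → Tau (.par P Q) (.par P Q')
  | rep {n : ℕ} {P P' : Proc n} : Tau P P' → Tau (.rep P) (.par P' (.rep P))
  | repCom {n : ℕ} {P X : Proc n} : Com P P X → Tau (.rep P) (.par X (.rep P))
  | res {n : ℕ} {P P' : Proc (n + 1)} : Tau P P' → Tau (.res P) (.res P')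

namespace StrEq

theorem parL {n : ℕ} {P P' : Proc n} (Q : Proc n) (h : StrEq P P') :
    StrEq (.par P Q) (.par P' Q) := .par_congr h (.refl _)

theorem parR {n : ℕ} {Q Q' : Proc n} (P : Proc n) (h : StrEq Q Q') :
    StrEq (.par P Q) (.par P Q') := .par_congr (.refl _) h

theorem assoc' {n : ℕ} (P Q R : Proc n) :
    StrEq (.par (.par P Q) R) (.par P (.par Q R)) := .symm (.par_assoc _ _ _)

theorem right_comm {n : ℕ} (P Q R : Proc n) :
    StrEq (.par (.par P Q) R) (.par (.par P R) Q) :=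
  .trans (assoc' _ _ _) (.trans (parR _ (.par_comm _ _)) (.par_assoc _ _ _))

theorem left_comm {n : ℕ} (P Q R : Proc n) :
    StrEq (.par P (.par Q R)) (.par Q (.par P R)) :=
  .trans (.par_assoc _ _ _) (.trans (parL _ (.par_comm _ _)) (assoc' _ _ _))

theorem par_par_comm {n : ℕ} (P Q R S : Proc n) :
    StrEq (.par (.par P Q) (.par R S)) (.par (.par P R) (.par Q S)) :=
  .trans (assoc' _ _ _) (.trans (parR _ (left_comm _ _ _)) (.par_assoc _ _ _))

theorem zero_par {n : ℕ} (P : Proc n) : StrEq (.par .zero P) P :=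
  .trans (.par_comm _ _) (.par_zero _)

theorem extrude' {n : ℕ} (P : Proc n) (Q : Proc (n + 1)) :
    StrEq (.par P (.res Q)) (.res (.par (P.subst (wkS 1)) Q)) := by
  have := StrEq.extrude P Q
  rwa [Proc.wk_eq] at this

theorem extrudeL {n : ℕ} (P : Proc n) (Q : Proc (n + 1)) :
    StrEq (.par (.res Q) P) (.res (.par Q (P.subst (wkS 1)))) :=
  .trans (.par_comm _ _) (.trans (extrude' _ _) (.res_congr (.par_comm _ _)))

theorem inst {n k : ℕ} {P Q : Proc (n + k)} (h : StrEq P Q) (σ : Fin k → CPat n) :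
    StrEq (P.inst σ) (Q.inst σ) := h.subst _

end StrEq

/-! ### Stability under substitution -/

theorem Int.subst {n k : ℕ} {P X : Proc n} {q : Pat n k} {D : Proc (n + k)}
    (h : Int P q D X) : ∀ {m : ℕ} (θ : Var n → CPat m),
      Int (P.subst θ) (q.subst θ) (D.subst (lift θ k)) (X.subst θ) := by
  induction h with
  | comm C D h =>
    intro m θ
    simp only [Proc.subst, Proc.inst_subst]
    exact .comm _ _ (h.subst θ)
  | parL Q _ ih => intro m θ; exact .parL _ (ih θ)
  | parR Q _ ih => intro m θ; exact .parR _ (ih θ)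
  | rep _ ih => intro m θ; exact .rep (ih θ)
  | res _ ih =>
    intro m θ
    refine .res ?_
    have := ih (lift θ 1)
    rwa [Pat.wk_subst_lift, Proc.wk_subst_lift'] at this

theorem Com.subst {n : ℕ} {P Q X : Proc n} (h : Com P Q X) : ∀ {m : ℕ} (θ : Var n → CPat m),
    Com (P.subst θ) (Q.subst θ) (X.subst θ) := by
  induction h with
  | case h => intro m θ; exact .case (h.subst θ)
  | parL Q _ ih => intro m θ; exact .parL _ (ih θ)
  | parR Q _ ih => intro m θ; exact .parR _ (ih θ)
  | rep _ ih => intro m θ; exact .rep (ih θ)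
  | res _ ih =>
    intro m θ
    refine .res ?_
    have := ih (lift θ 1)
    rwa [Proc.wk_subst_lift] at this

theorem Tau.subst {n : ℕ} {P X : Proc n} (h : Tau P X) : ∀ {m : ℕ} (θ : Var n → CPat m),
    Tau (P.subst θ) (X.subst θ) := by
  induction h with
  | com h => intro m θ; exact .com (h.subst θ)
  | parL Q _ ih => intro m θ; exact .parL _ (ih θ)
  | parR Q _ ih => intro m θ; exact .parR _ (ih θ)
  | rep _ ih => intro m θ; exact .rep (ih θ)
  | repCom h => intro m θ; exact .repCom (h.subst θ)
  | res _ ih => intro m θ; exact .res (ih _)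

/-! ### Reflection along injective renamings -/

theorem liftF_inj {n m : ℕ} {f : Fin n → Fin m} (hf : Function.Injective f) (k : ℕ) :
    Function.Injective (liftF f k) := by
  intro x y h
  induction x using Fin.addCases with
  | left x =>
    induction y using Fin.addCases with
    | left y =>
      simp only [liftF, Fin.addCases_left] at h
      rw [hf (Fin.castAdd_injective _ _ h)]
    | right y =>
      simp only [liftF, Fin.addCases_left, Fin.addCases_right] at h
      have := congrArg Fin.val h
      simp at this
      omega
  | right x =>
    induction y using Fin.addCases with
    | left y =>
      simp only [liftF, Fin.addCases_left, Fin.addCases_right] at h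
      have := congrArg Fin.val h
      simp at this
      omega
    | right y =>
      simp only [liftF, Fin.addCases_right] at h
      rw [Fin.natAdd_injective _ _ h]

/-- This serves the extrusion law read from right to left, where a move of a weakened process has to
come from a move of the process itself. The corresponding results for `Com` and `Tau` have the same
purpose. -/
theorem Int.reflect {m k : ℕ} {P' X' : Proc m} {q' : Pat m k} {D' : Proc (m + k)}
    (h : Int P' q' D' X') : ∀ {n : ℕ} {f : Fin n → Fin m} (_ : Function.Injective f)
      (P : Proc n) (q : Pat n k) (D : Proc (n + k)), P.subst (renS f) = P' →
      q.subst (renS f) = q' → D.subst (lift (renS f) k) = D' →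
      ∃ X, Int P q D X ∧ X.subst (renS f) = X' := by
  induction h with
  | comm C D h =>
    intro n f hf P q D0 hP hq hD
    cases P with
    | caseOf p C0 =>
      simp only [Proc.subst, Proc.caseOf.injEq] at hP
      obtain ⟨rfl, rfl, h2⟩ := hP
      rename_i hh
      subst hq hD
      cases h2
      obtain ⟨σ0, ρ0, hu, rfl, rfl⟩ := Unify.reflect hf h
      refine ⟨_, .comm _ _ hu, ?_⟩
      simp [Proc.subst, Proc.inst_subst]
    | _ => simp [Proc.subst] at hP
  | parL Q _ ih =>
    intro n f hf P q D hP hq hD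
    cases P with
    | par P1 P2 =>
      simp only [Proc.subst, Proc.par.injEq] at hP
      obtain ⟨X, hX, rfl⟩ := ih hf _ _ _ hP.1 hq hD
      exact ⟨_, .parL _ hX, by simp [Proc.subst, hP.2]⟩
    | _ => simp [Proc.subst] at hP
  | parR Q _ ih =>
    intro n f hf P q D hP hq hD
    cases P with
    | par P1 P2 =>
      simp only [Proc.subst, Proc.par.injEq] at hP
      obtain ⟨X, hX, rfl⟩ := ih hf _ _ _ hP.2 hq hD
      exact ⟨_, .parR _ hX, by simp [Proc.subst, hP.1]⟩
    | _ => simp [Proc.subst] at hP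
  | rep _ ih =>
    intro n f hf P q D hP hq hD
    cases P with
    | rep P1 =>
      simp only [Proc.subst, Proc.rep.injEq] at hP
      obtain ⟨X, hX, rfl⟩ := ih hf _ _ _ hP hq hD
      exact ⟨_, .rep hX, by simp [Proc.subst, hP]⟩
    | _ => simp [Proc.subst] at hP
  | res _ ih =>
    intro n f hf P q D hP hq hD
    cases P with
    | res P1 =>
      simp only [Proc.subst, Proc.res.injEq, lift_renS] at hP
      subst hq hD
      obtain ⟨X, hX, rfl⟩ := ih (liftF_inj hf 1) P1 (q.subst (wkS 1)) (D.subst (lift (wkS 1) _)) hP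
        (by rw [← lift_renS, Pat.wk_subst_lift])
        (by rw [← lift_renS, Proc.wk_subst_lift'])
      exact ⟨_, .res hX, by simp [Proc.subst, lift_renS]⟩
    | _ => simp [Proc.subst] at hP

theorem Com.reflect {m : ℕ} {P' Q' X' : Proc m} (h : Com P' Q' X') :
    ∀ {n : ℕ} {f : Fin n → Fin m} (_ : Function.Injective f) (P Q : Proc n),
      P.subst (renS f) = P' → Q.subst (renS f) = Q' →
      ∃ X, Com P Q X ∧ X.subst (renS f) = X' := by
  induction h with
  | case h =>
    intro n f hf P Q hP hQ
    cases P with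
    | caseOf p C0 =>
      simp only [Proc.subst, Proc.caseOf.injEq] at hP
      obtain ⟨rfl, h1, h2⟩ := hP
      cases h1; cases h2
      obtain ⟨X, hX, rfl⟩ := h.reflect hf Q p C0 hQ rfl rfl
      exact ⟨_, .case hX, rfl⟩
    | _ => simp [Proc.subst] at hP
  | parL Q _ ih =>
    intro n f hf P Q hP hQ
    cases P with
    | par P1 P2 =>
      simp only [Proc.subst, Proc.par.injEq] at hP
      obtain ⟨X, hX, rfl⟩ := ih hf _ _ hP.1 hQ
      exact ⟨_, .parL _ hX, by simp [Proc.subst, hP.2]⟩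
    | _ => simp [Proc.subst] at hP
  | parR Q _ ih =>
    intro n f hf P Q hP hQ
    cases P with
    | par P1 P2 =>
      simp only [Proc.subst, Proc.par.injEq] at hP
      obtain ⟨X, hX, rfl⟩ := ih hf _ _ hP.2 hQ
      exact ⟨_, .parR _ hX, by simp [Proc.subst, hP.1]⟩
    | _ => simp [Proc.subst] at hP
  | rep _ ih =>
    intro n f hf P Q hP hQ
    cases P with
    | rep P1 =>
      simp only [Proc.subst, Proc.rep.injEq] at hP
      obtain ⟨X, hX, rfl⟩ := ih hf _ _ hP hQ
      exact ⟨_, .rep hX, by simp [Proc.subst, hP]⟩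
    | _ => simp [Proc.subst] at hP
  | res _ ih =>
    intro n f hf P Q hP hQ
    cases P with
    | res P1 =>
      simp only [Proc.subst, Proc.res.injEq, lift_renS] at hP
      subst hQ
      obtain ⟨X, hX, rfl⟩ := ih (liftF_inj hf 1) P1 (Q.subst (wkS 1)) hP
        (by rw [← lift_renS, Proc.wk_subst_lift])
      exact ⟨_, .res hX, by simp [Proc.subst, lift_renS]⟩
    | _ => simp [Proc.subst] at hP

theorem Tau.reflect {m : ℕ} {P' X' : Proc m} (h : Tau P' X') :
    ∀ {n : ℕ} {f : Fin n → Fin m} (_ : Function.Injective f) (P : Proc n),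
      P.subst (renS f) = P' → ∃ X, Tau P X ∧ X.subst (renS f) = X' := by
  induction h with
  | com h =>
    intro n f hf P hP
    cases P with
    | par P1 P2 =>
      simp only [Proc.subst, Proc.par.injEq] at hP
      obtain ⟨X, hX, rfl⟩ := h.reflect hf _ _ hP.1 hP.2
      exact ⟨_, .com hX, rfl⟩
    | _ => simp [Proc.subst] at hP
  | parL Q _ ih =>
    intro n f hf P hP
    cases P with
    | par P1 P2 =>
      simp only [Proc.subst, Proc.par.injEq] at hP
      obtain ⟨X, hX, rfl⟩ := ih hf _ hP.1
      exact ⟨_, .parL _ hX, by simp [Proc.subst, hP.2]⟩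
    | _ => simp [Proc.subst] at hP
  | parR Q _ ih =>
    intro n f hf P hP
    cases P with
    | par P1 P2 =>
      simp only [Proc.subst, Proc.par.injEq] at hP
      obtain ⟨X, hX, rfl⟩ := ih hf _ hP.2
      exact ⟨_, .parR _ hX, by simp [Proc.subst, hP.1]⟩
    | _ => simp [Proc.subst] at hP
  | rep _ ih =>
    intro n f hf P hP
    cases P with
    | rep P1 =>
      simp only [Proc.subst, Proc.rep.injEq] at hP
      obtain ⟨X, hX, rfl⟩ := ih hf _ hP
      exact ⟨_, .rep hX, by simp [Proc.subst, hP]⟩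
    | _ => simp [Proc.subst] at hP
  | repCom h =>
    intro n f hf P hP
    cases P with
    | rep P1 =>
      simp only [Proc.subst, Proc.rep.injEq] at hP
      obtain ⟨X, hX, rfl⟩ := h.reflect hf _ _ hP hP
      exact ⟨_, .repCom hX, by simp [Proc.subst, hP]⟩
    | _ => simp [Proc.subst] at hP
  | res _ ih =>
    intro n f hf P hP
    cases P with
    | res P1 =>
      simp only [Proc.subst, Proc.res.injEq, lift_renS] at hP
      obtain ⟨X, hX, rfl⟩ := ih (liftF_inj hf 1) P1 hP
      exact ⟨_, .res hX, by simp [Proc.subst, lift_renS]⟩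
    | _ => simp [Proc.subst] at hP

theorem castAdd_inj (n : ℕ) : Function.Injective (Fin.castAdd 1 : Fin n → Fin (n + 1)) :=
  Fin.castAdd_injective _ _

/-! ### Structural equivalence and the structural transition system -/

theorem wk_wk_swap {n : ℕ} :
    (fun x : Var n => (wkS 1 x).subst (fun y => (wkS 1 y).subst (renS (swapF n)))) =
      fun x => (wkS 1 x).subst (wkS 1) := by
  funext x
  rw [← CPat.subst_subst]
  have := CPat.wk_wk_swap (.nm x)
  simpa [CPat.wk_eq_subst, CPat.subst] using this

theorem renS_subst_renS {n m l : ℕ} (f : Fin n → Fin m) (g : Fin m → Fin l) :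
    (fun x => (renS f x).subst (renS g)) = renS (g ∘ f) := by
  funext x; cases x <;> rfl

theorem swapF_swapF (n : ℕ) : swapF n ∘ swapF n = id := by
  funext x; simp [swapF]

theorem renS_id (n : ℕ) : renS (id : Fin n → Fin n) = CPat.nm := by
  funext x; cases x <;> rfl

theorem swap_swap {n : ℕ} (P : Proc (n + 1 + 1)) :
    (P.subst (renS (swapF n))).subst (renS (swapF n)) = P := by
  rw [Proc.subst_subst, renS_subst_renS, swapF_swapF, renS_id, Proc.subst_nm]

theorem lift_wkS_swap {n : ℕ} :
    (fun x : Var (n + 1) => (lift (wkS 1) 1 x).subst (renS (swapF n))) = wkS 1 := by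
  unfold wkS
  rw [lift_renS, renS_subst_renS]
  congr 1
  funext i
  induction i using Fin.lastCases with
  | last =>
    have : Fin.last n = Fin.natAdd n (0 : Fin 1) := by ext; simp
    rw [Function.comp, this]
    simp only [liftF, Fin.addCases_right]
    have : Fin.natAdd (n + 1) (0 : Fin 1) = Fin.last (n + 1) := by ext; simp
    rw [this, swapF_last]; ext; simp
  | cast i =>
    show swapF n (liftF _ 1 (Fin.castAdd 1 i)) = _
    simp only [liftF, Fin.addCases_left]
    exact swapF_old i

theorem wkS_swap {n : ℕ} :
    (fun x : Var (n + 1) => (wkS 1 x).subst (renS (swapF n))) = lift (wkS 1) 1 := by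
  rw [← lift_wkS_swap]
  funext x
  rw [CPat.subst_subst, renS_subst_renS, swapF_swapF, renS_id, CPat.subst_nm]

/-- After unfolding `!P`, the move may come from the replicated half; the idle copy of `P` is then
folded back. -/
theorem StrEq.absorb {n : ℕ} (P X : Proc n) :
    StrEq (.par P (.par X (.rep P))) (.par X (.rep P)) :=
  .trans (.left_comm _ _ _) (.parR _ (.symm (.rep_unfold P)))

def IntSim {n : ℕ} (P P' : Proc n) : Prop := ∀ (k : ℕ) (q : Pat n k) (D : Proc (n + k)) (X : Proc n),
  Int P q D X → ∃ X', Int P' q D X' ∧ StrEq X X'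

theorem IntSim.res_swap {n : ℕ} (P : Proc (n + 1 + 1)) : IntSim (.res (.res P))
    (.res (.res (P.subst (renS (swapF n))))) := by
  intro k q D X h
  cases h with
  | res h =>
    cases h with
    | res h =>
      have := h.subst (renS (swapF n))
      rw [Pat.subst_subst, Pat.subst_subst, Proc.subst_subst, Proc.subst_subst, lift_comp,
        lift_comp, wk_wk_swap, ← Pat.subst_subst, ← lift_comp, ← Proc.subst_subst] at this
      refine ⟨_, .res (.res this), ?_⟩
      rw [← Proc.swap_eq]
      exact .res_swap _

/-- Both directions are proved together so that the symmetry rule is immediate in the induction. -/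
theorem IntSim.of_strEq {n : ℕ} {P P' : Proc n} (h : StrEq P P') : IntSim P P' ∧ IntSim P' P := by
  induction h with
  | refl P => exact ⟨fun _ q D X h => ⟨X, h, .refl _⟩, fun _ q D X h => ⟨X, h, .refl _⟩⟩
  | symm _ ih => exact ⟨ih.2, ih.1⟩
  | trans _ _ ih1 ih2 =>
    constructor
    · intro k q D X h
      obtain ⟨X1, h1, e1⟩ := ih1.1 _ _ _ _ h
      obtain ⟨X2, h2, e2⟩ := ih2.1 _ _ _ _ h1
      exact ⟨X2, h2, e1.trans e2⟩
    · intro k q D X h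
      obtain ⟨X1, h1, e1⟩ := ih2.2 _ _ _ _ h
      obtain ⟨X2, h2, e2⟩ := ih1.2 _ _ _ _ h1
      exact ⟨X2, h2, e1.trans e2⟩
  | par_congr e1 e2 ih1 ih2 =>
    constructor
    · intro k q D X h
      cases h with
      | parL _ h => obtain ⟨X1, h1, e⟩ := ih1.1 _ _ _ _ h; exact ⟨_, .parL _ h1, .par_congr e e2⟩
      | parR _ h => obtain ⟨X1, h1, e⟩ := ih2.1 _ _ _ _ h; exact ⟨_, .parR _ h1, .par_congr e1 e⟩
    · intro k q D X h
      cases h with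
      | parL _ h => obtain ⟨X1, h1, e⟩ := ih1.2 _ _ _ _ h; exact ⟨_, .parL _ h1, .par_congr e e2.symm⟩
      | parR _ h => obtain ⟨X1, h1, e⟩ := ih2.2 _ _ _ _ h; exact ⟨_, .parR _ h1, .par_congr e1.symm e⟩
  | rep_congr e ih =>
    constructor
    · intro k q D X h
      cases h with
      | rep h =>
        obtain ⟨X1, h1, e'⟩ := ih.1 _ _ _ _ h
        exact ⟨_, .rep h1, .par_congr e' (.rep_congr e)⟩
    · intro k q D X h
      cases h with
      | rep h =>
        obtain ⟨X1, h1, e'⟩ := ih.2 _ _ _ _ h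
        exact ⟨_, .rep h1, .par_congr e' (.rep_congr e.symm)⟩
  | res_congr e ih =>
    constructor
    · intro k q D X h
      cases h with
      | res h => obtain ⟨X1, h1, e'⟩ := ih.1 _ _ _ _ h; exact ⟨_, .res h1, .res_congr e'⟩
    · intro k q D X h
      cases h with
      | res h => obtain ⟨X1, h1, e'⟩ := ih.2 _ _ _ _ h; exact ⟨_, .res h1, .res_congr e'⟩
  | case_congr p e ih =>
    constructor
    · intro k q D X h
      cases h with
      | comm C D h => exact ⟨_, .comm _ _ h, .parL _ (e.inst _)⟩
    · intro k q D X h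
      cases h with
      | comm C D h => exact ⟨_, .comm _ _ h, .parL _ (e.symm.inst _)⟩
  | par_zero P =>
    constructor
    · intro k q D X h
      cases h with
      | parL _ h => exact ⟨_, h, .par_zero _⟩
      | parR _ h => cases h
    · intro k q D X h
      exact ⟨_, .parL _ h, .symm (.par_zero _)⟩
  | par_comm P Q =>
    constructor <;>
    · intro k q D X h
      cases h with
      | parL _ h => exact ⟨_, .parR _ h, .par_comm _ _⟩
      | parR _ h => exact ⟨_, .parL _ h, .par_comm _ _⟩
  | par_assoc P Q R =>
    constructor
    · intro k q D X h
      cases h with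
      | parL _ h => exact ⟨_, .parL _ (.parL _ h), .par_assoc _ _ _⟩
      | parR _ h =>
        cases h with
        | parL _ h => exact ⟨_, .parL _ (.parR _ h), .par_assoc _ _ _⟩
        | parR _ h => exact ⟨_, .parR _ h, .par_assoc _ _ _⟩
    · intro k q D X h
      cases h with
      | parR _ h => exact ⟨_, .parR _ (.parR _ h), .assoc' _ _ _⟩
      | parL _ h =>
        cases h with
        | parL _ h => exact ⟨_, .parL _ h, .assoc' _ _ _⟩
        | parR _ h => exact ⟨_, .parR _ (.parL _ h), .assoc' _ _ _⟩
  | rep_unfold P =>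
    constructor
    · intro k q D X h
      cases h with
      | rep h => exact ⟨_, .parL _ h, .refl _⟩
    · intro k q D X h
      cases h with
      | parL _ h => exact ⟨_, .rep h, .refl _⟩
      | parR _ h =>
        cases h with
        | rep h => exact ⟨_, .rep h, .absorb _ _⟩
  | res_zero =>
    constructor
    · rintro k q D X (⟨⟩ | ⟨⟩ | ⟨⟩ | ⟨⟩ | h)
      cases h
    · intro k q D X h; cases h
  | res_swap P =>
    rw [Proc.swap_eq]
    refine ⟨IntSim.res_swap P, ?_⟩
    have := IntSim.res_swap (P.subst (renS (swapF _)))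
    rwa [swap_swap] at this
  | extrude P Q =>
    rw [Proc.wk_eq]
    constructor
    · intro k q D X h
      cases h with
      | parL _ h => exact ⟨_, .res (.parL _ (h.subst (wkS 1))), .extrude' _ _⟩
      | parR _ h =>
        cases h with
        | res h => exact ⟨_, .res (.parR _ h), .extrude' _ _⟩
    · intro k q D X h
      cases h with
      | res h =>
        cases h with
        | parL _ h =>
          -- The weakened `P` moved under the binder; since it does not use the new name, neither
          -- does its residual, which can leave the scope again.
          obtain ⟨Y, hY, rfl⟩ := h.reflect (castAdd_inj _) P q D rfl rfl rfl
          exact ⟨_, .parL _ hY, .symm (.extrude' _ _)⟩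
        | parR _ h => exact ⟨_, .parR _ (.res h), .symm (.extrude' _ _)⟩

theorem Int.congr_left {n k : ℕ} {P P' X : Proc n} {q : Pat n k} {D : Proc (n + k)}
    (h : Int P q D X) (e : StrEq P P') : ∃ X', Int P' q D X' ∧ StrEq X X' :=
  (IntSim.of_strEq e).1 _ _ _ _ h

theorem Com.congr_right {n : ℕ} {P Q X : Proc n} (h : Com P Q X) :
    ∀ {Q'}, StrEq Q Q' → ∃ X', Com P Q' X' ∧ StrEq X X' := by
  induction h with
  | case h =>
    intro Q' e; obtain ⟨X', h', e'⟩ := h.congr_left e; exact ⟨_, .case h', e'⟩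
  | parL Q _ ih => intro D' e; obtain ⟨X', h, e'⟩ := ih e; exact ⟨_, .parL _ h, .parL _ e'⟩
  | parR Q _ ih => intro D' e; obtain ⟨X', h, e'⟩ := ih e; exact ⟨_, .parR _ h, .parR _ e'⟩
  | rep _ ih => intro D' e; obtain ⟨X', h, e'⟩ := ih e; exact ⟨_, .rep h, .parL _ e'⟩
  | res _ ih =>
    intro D' e; obtain ⟨X', h, e'⟩ := ih (e.subst _); exact ⟨_, .res h, .res_congr e'⟩

theorem Com.par_right {n : ℕ} {P Q X : Proc n} (h : Com P Q X) :
    ∀ R, ∃ X', Com P (.par Q R) X' ∧ StrEq X' (.par X R) := by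
  induction h with
  | case h => intro R; exact ⟨_, .case (.parL _ h), .refl _⟩
  | parL Q _ ih =>
    intro R; obtain ⟨X', h, e'⟩ := ih R
    exact ⟨_, .parL _ h, .trans (.parL _ e') (.right_comm _ _ _)⟩
  | parR Q _ ih =>
    intro R; obtain ⟨X', h, e'⟩ := ih R
    exact ⟨_, .parR _ h, .trans (.parR _ e') (.par_assoc _ _ _)⟩
  | rep _ ih =>
    intro R; obtain ⟨X', h, e'⟩ := ih R
    exact ⟨_, .rep h, .trans (.parL _ e') (.right_comm _ _ _)⟩
  | res _ ih =>
    intro R; obtain ⟨X', h, e'⟩ := ih (R.subst (wkS 1))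
    exact ⟨_, .res h, .trans (.res_congr e') (.symm (.extrudeL _ _))⟩

theorem Com.rep_right {n : ℕ} {P Q X : Proc n} (h : Com P Q X) :
    ∃ X', Com P (.rep Q) X' ∧ StrEq X' (.par X (.rep Q)) := by
  obtain ⟨X1, h1, e1⟩ := h.par_right (.rep Q)
  obtain ⟨X2, h2, e2⟩ := h1.congr_right (.symm (.rep_unfold Q))
  exact ⟨X2, h2, e2.symm.trans e1⟩

/-- `Com` analyses its left argument before its right one, so a restriction on the right is moved
out by induction on the left process. When a restriction on the left is crossed, the two binders
meet in the wrong order and are exchanged. -/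
theorem Com.res_right {n : ℕ} (P : Proc n) : ∀ (Q X : Proc (n + 1)), Com (P.subst (wkS 1)) Q X →
    ∃ X', Com P (.res Q) X' ∧ StrEq X' (.res X) := by
  induction P with
  | zero => rintro Q X ⟨⟩
  | ok => rintro Q X ⟨⟩
  | par P1 P2 ih1 ih2 =>
    intro Q X h
    cases h with
    | parL _ h =>
      obtain ⟨X', h', e'⟩ := ih1 _ _ h
      exact ⟨_, .parL _ h', .trans (.parL _ e') (.extrudeL _ _)⟩
    | parR _ h =>
      obtain ⟨X', h', e'⟩ := ih2 _ _ h
      exact ⟨_, .parR _ h', .trans (.parR _ e') (.extrude' _ _)⟩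
  | rep P ih =>
    intro Q X h
    cases h with
    | rep h =>
      obtain ⟨X', h', e'⟩ := ih _ _ h
      exact ⟨_, .rep h', .trans (.parL _ e') (.extrudeL _ _)⟩
  | res P ih =>
    intro Q X h
    cases h with
    | res h =>
      have h2 := h.subst (renS (swapF _))
      rw [Proc.subst_subst, lift_wkS_swap, Proc.subst_subst, wkS_swap] at h2
      obtain ⟨X', h', e'⟩ := ih _ _ h2
      refine ⟨_, .res h', .trans (.res_congr e') ?_⟩
      rw [← Proc.swap_eq]
      exact .symm (.res_swap _)
  | caseOf p C ih =>
    intro Q X h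
    cases h with
    | case h => exact ⟨_, .case (.res h), .refl _⟩

theorem Int.toCom {n k : ℕ} {P X : Proc n} {q : Pat n k} {D : Proc (n + k)}
    (h : Int P q D X) : ∃ X', Com P (.caseOf q D) X' ∧ StrEq X' X := by
  induction h with
  | comm C D h => exact ⟨_, .case (.comm _ _ h.swap), .par_comm _ _⟩
  | parL Q _ ih => obtain ⟨X', h, e'⟩ := ih; exact ⟨_, .parL _ h, .parL _ e'⟩
  | parR Q _ ih => obtain ⟨X', h, e'⟩ := ih; exact ⟨_, .parR _ h, .parR _ e'⟩
  | rep _ ih => obtain ⟨X', h, e'⟩ := ih; exact ⟨_, .rep h, .parL _ e'⟩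
  | res _ ih => obtain ⟨X', h, e'⟩ := ih; exact ⟨_, .res h, .res_congr e'⟩

/-- The definition is lopsided. Every constructor peeled off on the left is put back on the right,
by `Com.par_right`, `Com.rep_right` and `Com.res_right`. -/
theorem Com.symm {n : ℕ} {P Q X : Proc n} (h : Com P Q X) :
    ∃ X', Com Q P X' ∧ StrEq X' X := by
  induction h with
  | case h => exact h.toCom
  | parL Q _ ih =>
    obtain ⟨X', h, e'⟩ := ih
    obtain ⟨X2, h2, e2⟩ := h.par_right Q
    exact ⟨_, h2, .trans e2 (.parL _ e')⟩
  | parR Q _ ih =>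
    obtain ⟨X', h, e'⟩ := ih
    obtain ⟨X2, h2, e2⟩ := h.par_right Q
    obtain ⟨X3, h3, e3⟩ := h2.congr_right (.par_comm _ _)
    exact ⟨_, h3, .trans e3.symm (.trans e2 (.trans (.parL _ e') (.par_comm _ _)))⟩
  | rep _ ih =>
    obtain ⟨X', h, e'⟩ := ih
    obtain ⟨X2, h2, e2⟩ := h.rep_right
    exact ⟨_, h2, .trans e2 (.parL _ e')⟩
  | res _ ih =>
    obtain ⟨X', h, e'⟩ := ih
    obtain ⟨X2, h2, e2⟩ := Com.res_right _ _ _ h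
    exact ⟨_, h2, .trans e2 (.res_congr e')⟩

theorem Com.congr_left {n : ℕ} {P P' Q X : Proc n} (h : Com P Q X) (e : StrEq P P') :
    ∃ X', Com P' Q X' ∧ StrEq X X' := by
  obtain ⟨X1, h1, e1⟩ := h.symm
  obtain ⟨X2, h2, e2⟩ := h1.congr_right e
  obtain ⟨X3, h3, e3⟩ := h2.symm
  exact ⟨X3, h3, .trans e1.symm (.trans e2 e3.symm)⟩

theorem Com.congr {n : ℕ} {P P' Q Q' X : Proc n} (h : Com P Q X) (e : StrEq P P')
    (e' : StrEq Q Q') : ∃ X', Com P' Q' X' ∧ StrEq X X' := by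
  obtain ⟨X1, h1, e1⟩ := h.congr_left e
  obtain ⟨X2, h2, e2⟩ := h1.congr_right e'
  exact ⟨X2, h2, e1.trans e2⟩

def TauSim {n : ℕ} (P P' : Proc n) : Prop := ∀ X, Tau P X → ∃ X', Tau P' X' ∧ StrEq X X'

theorem TauSim.res_swap {n : ℕ} (P : Proc (n + 1 + 1)) : TauSim (.res (.res P))
    (.res (.res (P.subst (renS (swapF n))))) := by
  intro X h
  cases h with
  | res h =>
    cases h with
    | res h =>
      refine ⟨_, .res (.res (h.subst (renS (swapF n)))), ?_⟩
      rw [← Proc.swap_eq]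
      exact .res_swap _

/-- Reassociating or extruding turns a communication between siblings into one inside a component or
across a binder. Symmetry of `Com` brings the component that is decomposed to the left. -/
theorem TauSim.of_strEq {n : ℕ} {P P' : Proc n} (h : StrEq P P') : TauSim P P' ∧ TauSim P' P := by
  induction h with
  | refl P => exact ⟨fun X h => ⟨X, h, .refl _⟩, fun X h => ⟨X, h, .refl _⟩⟩
  | symm _ ih => exact ⟨ih.2, ih.1⟩
  | trans _ _ ih1 ih2 =>
    constructor
    · intro X h
      obtain ⟨X1, h1, e1⟩ := ih1.1 _ h
      obtain ⟨X2, h2, e2⟩ := ih2.1 _ h1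
      exact ⟨X2, h2, e1.trans e2⟩
    · intro X h
      obtain ⟨X1, h1, e1⟩ := ih2.2 _ h
      obtain ⟨X2, h2, e2⟩ := ih1.2 _ h1
      exact ⟨X2, h2, e1.trans e2⟩
  | par_congr e1 e2 ih1 ih2 =>
    constructor
    · intro X h
      cases h with
      | com h => obtain ⟨X1, h1, e⟩ := h.congr e1 e2; exact ⟨_, .com h1, e⟩
      | parL _ h => obtain ⟨X1, h1, e⟩ := ih1.1 _ h; exact ⟨_, .parL _ h1, .par_congr e e2⟩
      | parR _ h => obtain ⟨X1, h1, e⟩ := ih2.1 _ h; exact ⟨_, .parR _ h1, .par_congr e1 e⟩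
    · intro X h
      cases h with
      | com h => obtain ⟨X1, h1, e⟩ := h.congr e1.symm e2.symm; exact ⟨_, .com h1, e⟩
      | parL _ h => obtain ⟨X1, h1, e⟩ := ih1.2 _ h; exact ⟨_, .parL _ h1, .par_congr e e2.symm⟩
      | parR _ h => obtain ⟨X1, h1, e⟩ := ih2.2 _ h; exact ⟨_, .parR _ h1, .par_congr e1.symm e⟩
  | rep_congr e ih =>
    constructor
    · intro X h
      cases h with
      | rep h =>
        obtain ⟨X1, h1, e'⟩ := ih.1 _ h
        exact ⟨_, .rep h1, .par_congr e' (.rep_congr e)⟩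
      | repCom h =>
        obtain ⟨X1, h1, e'⟩ := h.congr e e
        exact ⟨_, .repCom h1, .par_congr e' (.rep_congr e)⟩
    · intro X h
      cases h with
      | rep h =>
        obtain ⟨X1, h1, e'⟩ := ih.2 _ h
        exact ⟨_, .rep h1, .par_congr e' (.rep_congr e.symm)⟩
      | repCom h =>
        obtain ⟨X1, h1, e'⟩ := h.congr e.symm e.symm
        exact ⟨_, .repCom h1, .par_congr e' (.rep_congr e.symm)⟩
  | res_congr e ih =>
    constructor
    · intro X h
      cases h with
      | res h => obtain ⟨X1, h1, e'⟩ := ih.1 _ h; exact ⟨_, .res h1, .res_congr e'⟩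
    · intro X h
      cases h with
      | res h => obtain ⟨X1, h1, e'⟩ := ih.2 _ h; exact ⟨_, .res h1, .res_congr e'⟩
  | case_congr p e ih =>
    constructor <;> (intro X h; cases h)
  | par_zero P =>
    constructor
    · intro X h
      cases h with
      | com h => obtain ⟨_, h, _⟩ := h.symm; cases h
      | parL _ h => exact ⟨_, h, .par_zero _⟩
      | parR _ h => cases h
    · intro X h
      exact ⟨_, .parL _ h, .symm (.par_zero _)⟩
  | par_comm P Q =>
    constructor <;>
    · intro X h
      cases h with
      | com h => obtain ⟨X', h, e⟩ := h.symm; exact ⟨_, .com h, e.symm⟩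
      | parL _ h => exact ⟨_, .parR _ h, .par_comm _ _⟩
      | parR _ h => exact ⟨_, .parL _ h, .par_comm _ _⟩
  | par_assoc P Q R =>
    constructor
    · intro X h
      cases h with
      | com h =>
        obtain ⟨X1, h1, e1⟩ := h.symm
        cases h1 with
        | parL _ h1 =>
          obtain ⟨X2, h2, e2⟩ := h1.symm
          exact ⟨_, .parL _ (.com h2), e1.symm.trans (.parL _ e2.symm)⟩
        | parR _ h1 =>
          obtain ⟨X2, h2, e2⟩ := h1.symm
          exact ⟨_, .com (.parL _ h2), e1.symm.trans (.trans (.par_comm _ _) (.parL _ e2.symm))⟩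
      | parL _ h => exact ⟨_, .parL _ (.parL _ h), .par_assoc _ _ _⟩
      | parR _ h =>
        cases h with
        | com h => exact ⟨_, .com (.parR _ h), .refl _⟩
        | parL _ h => exact ⟨_, .parL _ (.parR _ h), .par_assoc _ _ _⟩
        | parR _ h => exact ⟨_, .parR _ h, .par_assoc _ _ _⟩
    · intro X h
      cases h with
      | com h =>
        cases h with
        | parL _ h =>
          obtain ⟨X1, h1, e1⟩ := h.par_right Q
          obtain ⟨X2, h2, e2⟩ := h1.congr_right (.par_comm _ _)
          exact ⟨_, .com h2, e1.symm.trans e2⟩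
        | parR _ h => exact ⟨_, .parR _ (.com h), .refl _⟩
      | parR _ h => exact ⟨_, .parR _ (.parR _ h), .assoc' _ _ _⟩
      | parL _ h =>
        cases h with
        | com h =>
          obtain ⟨X1, h1, e1⟩ := h.par_right R
          exact ⟨_, .com h1, e1.symm⟩
        | parL _ h => exact ⟨_, .parL _ h, .assoc' _ _ _⟩
        | parR _ h => exact ⟨_, .parR _ (.parL _ h), .assoc' _ _ _⟩
  | rep_unfold P =>
    constructor
    · intro X h
      cases h with
      | rep h => exact ⟨_, .parL _ h, .refl _⟩
      | repCom h =>
        obtain ⟨X1, h1, e1⟩ := h.rep_right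
        exact ⟨_, .com h1, e1.symm⟩
    · intro X h
      cases h with
      | com h =>
        obtain ⟨X1, h1, e1⟩ := h.symm
        cases h1 with
        | rep h1 => exact ⟨_, .repCom h1, e1.symm⟩
      | parL _ h => exact ⟨_, .rep h, .refl _⟩
      | parR _ h =>
        cases h with
        | rep h => exact ⟨_, .rep h, .absorb _ _⟩
        | repCom h => exact ⟨_, .repCom h, .absorb _ _⟩
  | res_zero =>
    constructor
    · intro X h
      cases h with
      | res h => cases h
    · intro X h; cases h
  | res_swap P =>
    rw [Proc.swap_eq]
    refine ⟨TauSim.res_swap P, ?_⟩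
    have := TauSim.res_swap (P.subst (renS (swapF _)))
    rwa [swap_swap] at this
  | extrude P Q =>
    rw [Proc.wk_eq]
    constructor
    · intro X h
      cases h with
      | com h =>
        obtain ⟨X1, h1, e1⟩ := h.symm
        cases h1 with
        | res h1 =>
          obtain ⟨X2, h2, e2⟩ := h1.symm
          exact ⟨_, .res (.com h2), e1.symm.trans (.res_congr e2.symm)⟩
      | parL _ h => exact ⟨_, .res (.parL _ (h.subst (wkS 1))), .extrude' _ _⟩
      | parR _ h =>
        cases h with
        | res h => exact ⟨_, .res (.parR _ h), .extrude' _ _⟩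
    · intro X h
      cases h with
      | res h =>
        cases h with
        | com h =>
          obtain ⟨X1, h1, e1⟩ := Com.res_right _ _ _ h
          exact ⟨_, .com h1, e1.symm⟩
        | parL _ h =>
          obtain ⟨Y, hY, rfl⟩ := h.reflect (castAdd_inj _) P rfl
          exact ⟨_, .parL _ hY, .symm (.extrude' _ _)⟩
        | parR _ h => exact ⟨_, .parR _ (.res h), .symm (.extrude' _ _)⟩

theorem Tau.congr {n : ℕ} {P P' X : Proc n} (h : Tau P X) (e : StrEq P P') :
    ∃ X', Tau P' X' ∧ StrEq X X' := (TauSim.of_strEq e).1 _ h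

/-! ### Reduction and structural reduction -/

/-- All uses of the structural rule are pushed to the end of the step, which makes reductions of a
concrete process open to inversion. -/
theorem Red.toTau {n : ℕ} {P Q : Proc n} (h : Red P Q) : ∃ X, Tau P X ∧ StrEq X Q := by
  induction h with
  | comm P Q h => exact ⟨_, .com (.case (.comm _ _ h.swap)), .par_comm _ _⟩
  | par Q _ ih => obtain ⟨X, h, e⟩ := ih; exact ⟨_, .parL _ h, .parL _ e⟩
  | res _ ih => obtain ⟨X, h, e⟩ := ih; exact ⟨_, .res h, .res_congr e⟩
  | struct e1 _ e2 ih =>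
    obtain ⟨X, h, e⟩ := ih
    obtain ⟨X', h', e'⟩ := h.congr e1.symm
    exact ⟨X', h', e'.symm.trans (e.trans e2)⟩

namespace Red

theorem congr {n : ℕ} {P Q P' Q' : Proc n} (h : Red P Q) (e : StrEq P P') (e' : StrEq Q Q') :
    Red P' Q' := .struct e.symm h e'

theorem parR {n : ℕ} {Q Q' : Proc n} (P : Proc n) (h : Red Q Q') :
    Red (.par P Q) (.par P Q') := (Red.par P h).congr (.par_comm _ _) (.par_comm _ _)

end Red

theorem Int.toRed {n k : ℕ} {P X : Proc n} {q : Pat n k} {D : Proc (n + k)}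
    (h : Int P q D X) : Red (.par P (.caseOf q D)) X := by
  induction h with
  | comm C D h => exact .comm _ _ h
  | parL Q _ ih => exact (Red.par Q ih).congr (.right_comm _ _ _) (.refl _)
  | parR P _ ih => exact (Red.parR P ih).congr (.par_assoc _ _ _) (.refl _)
  | @rep n k P X q D _ ih =>
    exact (Red.par (.rep P) ih).congr (.trans (.right_comm _ _ _) (.parL _ (.symm (.rep_unfold _))))
      (.refl _)
  | res _ ih => exact (Red.res ih).congr (.symm (.extrudeL _ _)) (.refl _)

theorem Com.toRed {n : ℕ} {P Q X : Proc n} (h : Com P Q X) : Red (.par P Q) X := by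
  induction h with
  | case h => exact h.toRed.congr (.par_comm _ _) (.refl _)
  | parL Q _ ih => exact (Red.par Q ih).congr (.right_comm _ _ _) (.refl _)
  | parR P _ ih => exact (Red.parR P ih).congr (.par_assoc _ _ _) (.refl _)
  | @rep n P Q X _ ih =>
    exact (Red.par (.rep P) ih).congr (.trans (.right_comm _ _ _) (.parL _ (.symm (.rep_unfold _))))
      (.refl _)
  | res _ ih => exact (Red.res ih).congr (.symm (.extrudeL _ _)) (.refl _)

/-- Weak reduction in arbitrary scope, up to structural equivalence. -/
def Wk {n : ℕ} : Proc n → Proc n → Prop := Relation.ReflTransGen fun P Q => Red P Q ∨ StrEq P Q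

namespace Wk

theorem refl {n : ℕ} (P : Proc n) : Wk P P := Relation.ReflTransGen.refl

theorem trans {n : ℕ} {P Q R : Proc n} (h : Wk P Q) (h' : Wk Q R) : Wk P R :=
  Relation.ReflTransGen.trans h h'

theorem of_strEq {n : ℕ} {P Q : Proc n} (h : StrEq P Q) : Wk P Q := .single (.inr h)

theorem of_red {n : ℕ} {P Q : Proc n} (h : Red P Q) : Wk P Q := .single (.inl h)

theorem map {n m : ℕ} (f : Proc n → Proc m) (h1 : ∀ P Q, Red P Q → Red (f P) (f Q))
    (h2 : ∀ P Q, StrEq P Q → StrEq (f P) (f Q)) {P Q : Proc n} (h : Wk P Q) : Wk (f P) (f Q) :=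
  Relation.ReflTransGen.lift f (fun _ _ h => Or.imp (h1 _ _) (h2 _ _) h) _ _ h

theorem parL {n : ℕ} {P P' : Proc n} (Q : Proc n) (h : Wk P P') : Wk (.par P Q) (.par P' Q) :=
  h.map (fun P => .par P Q) (fun _ _ => .par Q) (fun _ _ => .parL Q)

theorem parR {n : ℕ} {Q Q' : Proc n} (P : Proc n) (h : Wk Q Q') : Wk (.par P Q) (.par P Q') :=
  h.map (fun Q => .par P Q) (fun _ _ => .parR P) (fun _ _ => .parR P)

theorem res {n : ℕ} {P P' : Proc (n + 1)} (h : Wk P P') : Wk (.res P) (.res P') :=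
  h.map .res (fun _ _ => .res) (fun _ _ => .res_congr)

theorem rep {n : ℕ} {P P' : Proc n} (h : Wk P P') : Wk (.rep P) (.par P' (.rep P)) :=
  (of_strEq (.rep_unfold P)).trans (h.parL _)

theorem toReds {P Q : Proc 0} (h : Wk P Q) : ∃ Q', Reds P Q' ∧ StrEq Q' Q := by
  induction h with
  | refl => exact ⟨P, .refl, .refl _⟩
  | tail _ h ih =>
    obtain ⟨Q', hr, e⟩ := ih
    rcases h with h | h
    · exact ⟨_, hr.tail (.struct e h (.refl _)), .refl _⟩
    · exact ⟨Q', hr, e.trans h⟩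

theorem of_reds {P Q : Proc 0} (h : Reds P Q) : Wk P Q :=
  Relation.ReflTransGen.mono (fun _ _ h => Or.inl h) _ _ h

end Wk

/-! ### Success, structurally -/

inductive HasOk : {n : ℕ} → Proc n → Prop
  | ok {n : ℕ} : HasOk (.ok : Proc n)
  | parL {n : ℕ} {P : Proc n} (Q : Proc n) : HasOk P → HasOk (.par P Q)
  | parR {n : ℕ} {Q : Proc n} (P : Proc n) : HasOk Q → HasOk (.par P Q)
  | rep {n : ℕ} {P : Proc n} : HasOk P → HasOk (.rep P)
  | res {n : ℕ} {P : Proc (n + 1)} : HasOk P → HasOk (.res P)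

theorem hasOk_par {n : ℕ} {P Q : Proc n} : HasOk (.par P Q) ↔ HasOk P ∨ HasOk Q :=
  ⟨fun h => by cases h with
    | parL _ h => exact .inl h
    | parR _ h => exact .inr h, fun h => h.elim (.parL _) (.parR _)⟩

theorem hasOk_rep {n : ℕ} {P : Proc n} : HasOk (.rep P) ↔ HasOk P :=
  ⟨fun h => by cases h; assumption, .rep⟩

theorem hasOk_res {n : ℕ} {P : Proc (n + 1)} : HasOk (.res P) ↔ HasOk P :=
  ⟨fun h => by cases h; assumption, .res⟩

theorem not_hasOk_zero {n : ℕ} : ¬ HasOk (.zero : Proc n) := fun h => by cases h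

theorem not_hasOk_case {n k : ℕ} (p : Pat n k) (C : Proc (n + k)) : ¬ HasOk (.caseOf p C) :=
  fun h => by cases h

theorem hasOk_subst {n : ℕ} (P : Proc n) : ∀ {m : ℕ} (θ : Var n → CPat m),
    HasOk (P.subst θ) ↔ HasOk P := by
  induction P with
  | zero => intro m θ; exact Iff.intro (fun h => absurd h not_hasOk_zero) (fun h => absurd h not_hasOk_zero)
  | ok => intro m θ; exact ⟨fun _ => .ok, fun _ => .ok⟩
  | par P Q h1 h2 => intro m θ; simp only [Proc.subst, hasOk_par, h1, h2]
  | rep P h => intro m θ; simp only [Proc.subst, hasOk_rep, h]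
  | res P h => intro m θ; simp only [Proc.subst, hasOk_res, h]
  | caseOf p P h => intro m θ; simp only [Proc.subst, not_hasOk_case]

theorem HasOk.congr {n : ℕ} {P Q : Proc n} (h : StrEq P Q) : HasOk P ↔ HasOk Q := by
  induction h with
  | refl P => rfl
  | symm _ ih => exact ih.symm
  | trans _ _ ih1 ih2 => exact ih1.trans ih2
  | par_congr _ _ ih1 ih2 => rw [hasOk_par, hasOk_par, ih1, ih2]
  | rep_congr _ ih => rw [hasOk_rep, hasOk_rep, ih]
  | res_congr _ ih => rw [hasOk_res, hasOk_res, ih]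
  | case_congr p _ ih => simp only [not_hasOk_case]
  | par_zero P => simp [hasOk_par, not_hasOk_zero]
  | par_comm P Q => simp [hasOk_par, or_comm]
  | par_assoc P Q R => simp [hasOk_par, or_assoc]
  | rep_unfold P => simp [hasOk_par, hasOk_rep]
  | res_zero => simp [hasOk_res, not_hasOk_zero]
  | res_swap P => simp [hasOk_res, Proc.swap_eq, hasOk_subst]
  | extrude P Q => simp [hasOk_res, hasOk_par, Proc.wk_eq, hasOk_subst]

theorem HasOk.exists_par {n : ℕ} {P : Proc n} (h : HasOk P) : ∃ Q, StrEq P (.par Q .ok) := by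
  induction h with
  | ok => exact ⟨.zero, .symm (.zero_par _)⟩
  | parL Q _ ih => obtain ⟨R, e⟩ := ih; exact ⟨_, .trans (.parL _ e) (.right_comm _ _ _)⟩
  | parR P _ ih => obtain ⟨R, e⟩ := ih; exact ⟨_, .trans (.parR _ e) (.par_assoc _ _ _)⟩
  | @rep n P _ ih =>
    obtain ⟨R, e⟩ := ih
    exact ⟨_, .trans (.rep_unfold P) (.trans (.parL _ e) (.right_comm _ _ _))⟩
  | @res n P _ ih =>
    obtain ⟨R, e⟩ := ih
    exact ⟨_, .trans (.res_congr e) (.symm (.extrudeL _ _))⟩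

theorem succeeds_iff {P : Proc 0} : Succeeds P ↔ ∃ P', Reds P P' ∧ HasOk P' := by
  constructor
  · rintro ⟨P', P'', h, e⟩
    exact ⟨P', h, (HasOk.congr e).2 (.parR _ .ok)⟩
  · rintro ⟨P', h, h'⟩
    obtain ⟨Q, e⟩ := h'.exists_par
    exact ⟨P', Q, h, e⟩

theorem succeeds_iff_wk {P : Proc 0} : Succeeds P ↔ ∃ P', Wk P P' ∧ HasOk P' := by
  rw [succeeds_iff]
  constructor
  · rintro ⟨P', h, h'⟩; exact ⟨P', .of_reds h, h'⟩
  · rintro ⟨P', h, h'⟩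
    obtain ⟨Q, hq, e⟩ := h.toReds
    exact ⟨Q, hq, (HasOk.congr e).2 h'⟩

/-! ### Free names and opening of binders -/

def Var.fn {n : ℕ} : Var n → Finset Name
  | .free a => {a}
  | .bound _ => ∅

def Pat.fn {n : ℕ} : {k : ℕ} → Pat n k → Finset Name
  | _, .lam => ∅
  | _, .nm x => x.fn
  | _, .prot x => x.fn
  | _, .comp p q => p.fn ∪ q.fn

def Proc.fn : {n : ℕ} → Proc n → Finset Name
  | _, .zero => ∅
  | _, .ok => ∅
  | _, .par P Q => P.fn ∪ Q.fn
  | _, .rep P => P.fn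
  | _, .res P => P.fn
  | _, .caseOf p P => p.fn ∪ P.fn

def Proc.size : {n : ℕ} → Proc n → ℕ
  | _, .zero => 0
  | _, .ok => 0
  | _, .par P Q => P.size + Q.size + 1
  | _, .rep P => P.size + 1
  | _, .res P => P.size + 1
  | _, .caseOf _ P => P.size + 1

theorem Proc.size_subst {n : ℕ} (P : Proc n) : ∀ {m : ℕ} (θ : Var n → CPat m),
    (P.subst θ).size = P.size := by
  induction P <;> intro m θ <;> simp [Proc.subst, Proc.size, *]

theorem Pat.subst_congr {n m k : ℕ} {θ θ' : Var n → CPat m} (p : Pat n k)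
    (h1 : ∀ a ∈ p.fn, θ (.free a) = θ' (.free a)) (h2 : ∀ i, θ (.bound i) = θ' (.bound i)) :
    p.subst θ = p.subst θ' := by
  induction p with
  | lam => rfl
  | nm x => cases x <;> simp_all [Pat.subst, Pat.fn, Var.fn]
  | prot x => cases x <;> simp_all [Pat.subst, Pat.fn, Var.fn]
  | comp p q ih1 ih2 =>
    simp only [Pat.fn, Finset.mem_union] at h1
    simp only [Pat.subst]
    rw [ih1 fun a ha => h1 a (.inl ha), ih2 fun a ha => h1 a (.inr ha)]

theorem lift_congr {n m : ℕ} {θ θ' : Var n → CPat m} (k : ℕ) (F : Finset Name)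
    (h1 : ∀ a ∈ F, θ (.free a) = θ' (.free a)) (h2 : ∀ i, θ (.bound i) = θ' (.bound i)) :
    (∀ a ∈ F, lift θ k (.free a) = lift θ' k (.free a)) ∧
      (∀ i, lift θ k (.bound i) = lift θ' k (.bound i)) := by
  refine ⟨fun a ha => by simp [lift, h1 a ha], fun i => ?_⟩
  induction i using Fin.addCases <;> simp [lift, h2]

theorem Proc.subst_congr {n : ℕ} (P : Proc n) : ∀ {m : ℕ} {θ θ' : Var n → CPat m}
    (_ : ∀ a ∈ P.fn, θ (.free a) = θ' (.free a)) (_ : ∀ i, θ (.bound i) = θ' (.bound i)),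
    P.subst θ = P.subst θ' := by
  induction P with
  | zero => intros; rfl
  | ok => intros; rfl
  | par P Q ih1 ih2 =>
    intro m θ θ' h1 h2
    simp only [Proc.fn, Finset.mem_union] at h1
    simp only [Proc.subst]
    rw [ih1 (fun a ha => h1 a (.inl ha)) h2, ih2 (fun a ha => h1 a (.inr ha)) h2]
  | rep P ih =>
    intro m θ θ' h1 h2
    simp only [Proc.subst]
    rw [ih h1 h2]
  | res P ih =>
    intro m θ θ' h1 h2
    simp only [Proc.subst]
    obtain ⟨h1, h2⟩ := lift_congr 1 P.fn h1 h2
    rw [ih h1 h2]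
  | @caseOf n k p P ih =>
    intro m θ θ' h1 h2
    simp only [Proc.fn, Finset.mem_union] at h1
    simp only [Proc.subst]
    obtain ⟨h3, h4⟩ := lift_congr k P.fn (fun a ha => h1 a (.inr ha)) h2
    rw [ih h3 h4, Pat.subst_congr p (fun a ha => h1 a (.inl ha)) h2]

open Classical in
/-- The substitution behind `Proc.bindNames`. -/
noncomputable def bindV {n k : ℕ} (x : Fin k ↪ Name) : Var n → Var (n + k)
  | .free a => (match Function.partialInv x a with
        | some j => .bound (Fin.natAdd n j)
        | none => .free a)
  | .bound i => .bound (Fin.castAdd k i)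

def vren {n m : ℕ} (g : Var n → Var m) : Var n → CPat m := fun x => .nm (g x)

theorem Proc.bindNames_eq {n k : ℕ} (x : Fin k ↪ Name) (P : Proc n) :
    P.bindNames x = P.subst (vren (bindV x)) := by
  unfold Proc.bindNames vren bindV
  congr 1

theorem bindV_mem {n k : ℕ} (x : Fin k ↪ Name) (j : Fin k) :
    bindV (n := n) x (.free (x j)) = .bound (Fin.natAdd n j) := by
  simp [bindV, Function.partialInv_left x.injective]

theorem bindV_notMem {n k : ℕ} (x : Fin k ↪ Name) (a : Name) (h : ∀ j, x j ≠ a) :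
    bindV (n := n) x (.free a) = .free a := by
  have : Function.partialInv x a = none := by
    rcases hx : Function.partialInv x a with _ | j
    · rfl
    · exact absurd ((x.injective.isPartialInv _ _).1 hx) (h j)
  simp [bindV, this]

/-- Freshness makes opening and rebinding an exact round trip, so every nameless binder also arises
from a named one. Named restrictions and named context binders thus reach all processes. -/
theorem Proc.bindNames_inst {n k : ℕ} (x : Fin k ↪ Name) (P : Proc (n + k))
    (h : ∀ j, x j ∉ P.fn) : (P.inst fun j => .nm (.free (x j))).bindNames x = P := by
  rw [Proc.bindNames_eq, Proc.inst_eq, Proc.subst_subst]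
  conv_rhs => rw [← P.subst_nm]
  apply Proc.subst_congr
  · intro a ha
    simp only [instS, CPat.subst, vren]
    rw [bindV_notMem]
    rintro j rfl
    exact h j ha
  · intro i
    induction i using Fin.addCases with
    | left i => simp [instS, CPat.subst, vren, bindV]
    | right i => simp [instS, CPat.subst, vren, bindV_mem]

theorem Proc.bindNames_fresh {n k : ℕ} (x : Fin k ↪ Name) (P : Proc n)
    (h : ∀ j, x j ∉ P.fn) : P.bindNames x = P.subst (wkS k) := by
  rw [Proc.bindNames_eq]
  apply Proc.subst_congr
  · intro a ha
    simp only [vren]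
    rw [bindV_notMem]
    · rfl
    · rintro j rfl
      exact h j ha
  · intro i; rfl

/-- The embedding that picks one name. -/
def oneName (a : Name) : Fin 1 ↪ Name := ⟨fun _ => a, Function.injective_of_subsingleton _⟩

theorem nu_eq {n : ℕ} (a : Name) (P : Proc n) : nu a P = .res (P.bindNames (oneName a)) := rfl

theorem nu_open {n : ℕ} (a : Name) (P : Proc (n + 1)) (h : a ∉ P.fn) :
    nu a (P.inst (k := 1) fun _ => .nm (.free a)) = .res P := by
  rw [nu_eq]
  congr 1
  exact Proc.bindNames_inst (oneName a) P fun _ => h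

theorem StrEq.nu_congr {n : ℕ} {P Q : Proc n} (a : Name) (h : StrEq P Q) :
    StrEq (nu a P) (nu a Q) := by
  rw [nu_eq, nu_eq, Proc.bindNames_eq, Proc.bindNames_eq]
  exact .res_congr (h.subst _)

theorem StrEq.nus_congr {n : ℕ} {P Q : Proc n} (as : List Name) (h : StrEq P Q) :
    StrEq (nus as P) (nus as Q) := by
  induction as with
  | nil => exact h
  | cons a as ih => exact .nu_congr a ih

theorem StrEq.nu_par {n : ℕ} (a : Name) (P Q : Proc n) (h : a ∉ Q.fn) :
    StrEq (.par (nu a P) Q) (nu a (.par P Q)) := by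
  rw [nu_eq, nu_eq]
  refine .trans (.extrudeL _ _) ?_
  rw [← Proc.bindNames_fresh (oneName a) Q fun _ => h]
  exact .refl _

theorem StrEq.nus_par {n : ℕ} (as : List Name) (P Q : Proc n) (h : ∀ a ∈ as, a ∉ Q.fn) :
    StrEq (.par (nus as P) Q) (nus as (.par P Q)) := by
  induction as with
  | nil => exact .refl _
  | cons a as ih =>
    refine .trans (.nu_par a _ Q (h a (by simp))) (.nu_congr a (ih fun b hb => h b (by simp [hb])))

/-! ### Barbs, structurally -/

/-- Protected variables. Unlike `protNames`, this also records references to binders, which is what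
decides whether a restricted name is protected; `av` does the same for all variables. -/
def Pat.pv {n : ℕ} : {k : ℕ} → Pat n k → Set (Var n)
  | _, .lam => ∅
  | _, .nm _ => ∅
  | _, .prot x => {x}
  | _, .comp p q => p.pv ∪ q.pv

def Pat.av {n : ℕ} : {k : ℕ} → Pat n k → Set (Var n)
  | _, .lam => ∅
  | _, .nm x => {x}
  | _, .prot x => {x}
  | _, .comp p q => p.av ∪ q.av

/-- `SB P A B`: `P` exposes a pattern with free names `B`, protected names `A` and no restricted
protected name. -/
inductive SB : {n : ℕ} → Proc n → Set Name → Set Name → Prop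
  | case {n k : ℕ} {p : Pat n k} (C : Proc (n + k)) (h : ∀ i, Var.bound i ∉ p.pv) :
      SB (.caseOf p C) {a | .free a ∈ p.pv} {a | .free a ∈ p.av}
  | parL {n : ℕ} {P : Proc n} {A B : Set Name} (Q : Proc n) : SB P A B → SB (.par P Q) A B
  | parR {n : ℕ} {Q : Proc n} {A B : Set Name} (P : Proc n) : SB Q A B → SB (.par P Q) A B
  | rep {n : ℕ} {P : Proc n} {A B : Set Name} : SB P A B → SB (.rep P) A B
  | res {n : ℕ} {P : Proc (n + 1)} {A B : Set Name} : SB P A B → SB (.res P) A B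

theorem SB_par {n : ℕ} {P Q : Proc n} {A B : Set Name} :
    SB (.par P Q) A B ↔ SB P A B ∨ SB Q A B :=
  ⟨fun h => by cases h with
    | parL _ h => exact .inl h
    | parR _ h => exact .inr h, fun h => h.elim (.parL _) (.parR _)⟩

theorem SB_rep {n : ℕ} {P : Proc n} {A B : Set Name} : SB (.rep P) A B ↔ SB P A B :=
  ⟨fun h => by cases h; assumption, .rep⟩

theorem SB_res {n : ℕ} {P : Proc (n + 1)} {A B : Set Name} : SB (.res P) A B ↔ SB P A B :=
  ⟨fun h => by cases h; assumption, .res⟩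

theorem not_SB_zero {n : ℕ} {A B : Set Name} : ¬ SB (.zero : Proc n) A B := fun h => by cases h

theorem SB_case {n k : ℕ} {p : Pat n k} {C : Proc (n + k)} {A B : Set Name} :
    SB (.caseOf p C) A B ↔ (∀ i, Var.bound i ∉ p.pv) ∧ A = {a | .free a ∈ p.pv} ∧
      B = {a | .free a ∈ p.av} :=
  ⟨fun h => by cases h; exact ⟨by assumption, rfl, rfl⟩, fun ⟨h, h1, h2⟩ => h1 ▸ h2 ▸ .case C h⟩

theorem pv_vren {n m k : ℕ} (g : Var n → Var m) (p : Pat n k) :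
    (p.subst (vren g)).pv = g '' p.pv := by
  induction p with
  | lam => simp [Pat.subst, Pat.pv]
  | nm x => simp [Pat.subst, Pat.pv, vren, CPat.toPat]
  | prot x => simp [Pat.subst, Pat.pv, vren, CPat.toProt]
  | comp p q h1 h2 => simp [Pat.subst, Pat.pv, h1, h2, Set.image_union]

theorem av_vren {n m k : ℕ} (g : Var n → Var m) (p : Pat n k) :
    (p.subst (vren g)).av = g '' p.av := by
  induction p with
  | lam => simp [Pat.subst, Pat.av]
  | nm x => simp [Pat.subst, Pat.av, vren, CPat.toPat]
  | prot x => simp [Pat.subst, Pat.av, vren, CPat.toProt]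
  | comp p q h1 h2 => simp [Pat.subst, Pat.av, h1, h2, Set.image_union]

theorem renS_eq_vren {n m : ℕ} (f : Fin n → Fin m) : renS f = vren (Var.map f) := rfl

theorem free_mem_map {n m : ℕ} (f : Fin n → Fin m) (S : Set (Var n)) (a : Name) :
    Var.free a ∈ Var.map f '' S ↔ Var.free a ∈ S := by
  constructor
  · rintro ⟨x, hx, e⟩
    cases x <;> simp_all [Var.map]
  · intro h; exact ⟨_, h, rfl⟩

theorem bound_mem_map {n m : ℕ} (f : Fin n → Fin m) (S : Set (Var n)) :
    (∀ i, Var.bound i ∉ Var.map f '' S) ↔ ∀ i, Var.bound i ∉ S := by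
  constructor
  · intro h i hi
    exact h (f i) ⟨_, hi, rfl⟩
  · rintro h i ⟨x, hx, e⟩
    cases x with
    | free a => simp [Var.map] at e
    | bound j => exact h j hx

theorem SB_ren {n : ℕ} (P : Proc n) : ∀ {m : ℕ} (f : Fin n → Fin m) {A B : Set Name},
    SB (P.subst (renS f)) A B ↔ SB P A B := by
  induction P with
  | zero => intro m f A B; exact ⟨fun h => absurd h not_SB_zero, fun h => absurd h not_SB_zero⟩
  | ok => intro m f A B; constructor <;> (intro h; cases h)
  | par P Q h1 h2 => intro m f A B; simp only [Proc.subst, SB_par, h1, h2]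
  | rep P h => intro m f A B; simp only [Proc.subst, SB_rep, h]
  | res P h => intro m f A B; simp only [Proc.subst, SB_res, lift_renS, h]
  | caseOf p P h =>
    intro m f A B
    simp only [Proc.subst, SB_case, renS_eq_vren, pv_vren, av_vren, free_mem_map, bound_mem_map]

theorem SB.congr {n : ℕ} {P Q : Proc n} (h : StrEq P Q) : ∀ {A B : Set Name},
    SB P A B ↔ SB Q A B := by
  induction h with
  | refl P => intros; rfl
  | symm _ ih => intros; exact ih.symm
  | trans _ _ ih1 ih2 => intros; exact ih1.trans ih2
  | par_congr _ _ ih1 ih2 => intros; rw [SB_par, SB_par, ih1, ih2]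
  | rep_congr _ ih => intros; rw [SB_rep, SB_rep, ih]
  | res_congr _ ih => intros; rw [SB_res, SB_res, ih]
  | case_congr p _ ih => intros; simp only [SB_case]
  | par_zero P => intros; simp [SB_par, not_SB_zero]
  | par_comm P Q => intros; simp [SB_par, or_comm]
  | par_assoc P Q R => intros; simp [SB_par, or_assoc]
  | rep_unfold P => intros; simp [SB_par, SB_rep]
  | res_zero => intros; simp [SB_res, not_SB_zero]
  | res_swap P => intros; simp [SB_res, Proc.swap_eq, SB_ren]
  | extrude P Q => intros; simp [SB_res, SB_par, Proc.wk_eq, wkS, SB_ren]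

def liftV {n m : ℕ} (g : Var n → Var m) (k : ℕ) : Var (n + k) → Var (m + k)
  | .free a => (g (.free a)).wk k
  | .bound i => Fin.addCases (fun i => (g (.bound i)).wk k) (fun j => .bound (Fin.natAdd m j)) i

theorem lift_vren {n m : ℕ} (g : Var n → Var m) (k : ℕ) :
    lift (vren g) k = vren (liftV g k) := by
  funext x
  cases x with
  | free a => rfl
  | bound i =>
    induction i using Fin.addCases <;> simp [lift, vren, liftV, CPat.wk]

/-- Variable renamings that bind the name `a` and leave other names alone. -/
def Binds {n m : ℕ} (a : Name) (g : Var n → Var m) : Prop :=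
  (∀ i, ∃ j, g (.bound i) = .bound j) ∧ (∃ j, g (.free a) = .bound j) ∧
    ∀ b, b ≠ a → g (.free b) = .free b

theorem Binds.lift {n m : ℕ} {a : Name} {g : Var n → Var m} (h : Binds a g) (k : ℕ) :
    Binds a (liftV g k) := by
  obtain ⟨h1, ⟨j, h2⟩, h3⟩ := h
  refine ⟨fun i => ?_, ⟨_, by simp only [liftV, h2]; rfl⟩, fun b hb => by simp only [liftV, h3 b hb]; rfl⟩
  induction i using Fin.addCases with
  | left i => obtain ⟨j, hj⟩ := h1 i; exact ⟨_, by simp only [liftV, Fin.addCases_left, hj]; rfl⟩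
  | right i => exact ⟨_, by simp only [liftV, Fin.addCases_right]; rfl⟩

theorem Binds.mem_free {n m : ℕ} {a : Name} {g : Var n → Var m} (h : Binds a g) (S : Set (Var n))
    (b : Name) : Var.free b ∈ g '' S ↔ Var.free b ∈ S ∧ b ≠ a := by
  obtain ⟨h1, ⟨j, h2⟩, h3⟩ := h
  constructor
  · rintro ⟨x, hx, e⟩
    cases x with
    | free c =>
      by_cases hc : c = a
      · subst hc; rw [h2] at e; cases e
      · rw [h3 c hc] at e; cases e; exact ⟨hx, hc⟩
    | bound i => obtain ⟨j, hj⟩ := h1 i; rw [hj] at e; cases e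
  · rintro ⟨hb, hne⟩; exact ⟨_, hb, h3 b hne⟩

theorem SB.binds {n : ℕ} {P : Proc n} {A B : Set Name} (h : SB P A B) :
    ∀ {m : ℕ} {g : Var n → Var m} {a : Name}, Binds a g → a ∉ A →
      SB (P.subst (vren g)) A (B \ {a}) := by
  induction h with
  | @case n k p C h =>
    intro m g a hg ha
    rw [Proc.subst, SB_case, pv_vren, av_vren]
    refine ⟨?_, ?_, ?_⟩
    · rintro i ⟨x, hx, e⟩
      cases x with
      | free c =>
        by_cases hc : c = a
        · subst hc; exact ha hx
        · rw [hg.2.2 c hc] at e; cases e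
      | bound i => exact h i hx
    · ext b
      simp only [Set.mem_ofPred_eq, hg.mem_free]
      constructor
      · intro hb; exact ⟨hb, fun e => ha (e ▸ hb)⟩
      · intro hb; exact hb.1
    · ext b
      simp only [Set.mem_ofPred_eq, hg.mem_free]
      rfl
  | parL Q _ ih => intro m g a hg ha; exact .parL _ (ih hg ha)
  | parR Q _ ih => intro m g a hg ha; exact .parR _ (ih hg ha)
  | rep _ ih => intro m g a hg ha; exact .rep (ih hg ha)
  | res _ ih =>
    intro m g a hg ha
    rw [Proc.subst, lift_vren]
    exact .res (ih (hg.lift 1) ha)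

theorem SB.nu {n : ℕ} {P : Proc n} {A B : Set Name} (h : SB P A B) {a : Name} (ha : a ∉ A) :
    SB (CPC.nu a P) A (B \ {a}) := by
  rw [nu_eq, Proc.bindNames_eq]
  refine .res (h.binds ⟨fun i => ⟨_, rfl⟩, ⟨_, bindV_mem (oneName a) 0⟩, fun b hb => ?_⟩ ha)
  exact bindV_notMem _ _ fun _ e => hb e.symm

theorem protNames_eq {k : ℕ} (p : Pat 0 k) : p.protNames = {a | .free a ∈ p.pv} := by
  induction p with
  | lam => simp [Pat.protNames, Pat.pv]
  | nm x => simp [Pat.protNames, Pat.pv]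
  | prot x => ext a; simp [Pat.protNames, Pat.pv, eq_comm]
  | comp p q h1 h2 => simp only [Pat.protNames, Pat.pv, h1, h2]; rfl

theorem freeNames_eq {k : ℕ} (p : Pat 0 k) : p.freeNames = {a | .free a ∈ p.av} := by
  induction p with
  | lam => simp [Pat.freeNames, Pat.av]
  | nm x => ext a; simp [Pat.freeNames, Pat.av, eq_comm]
  | prot x => ext a; simp [Pat.freeNames, Pat.av, eq_comm]
  | comp p q h1 h2 => simp only [Pat.freeNames, Pat.av, h1, h2]; rfl

theorem SB.of_barb {P : Proc 0} {B : Set Name} (h : Barb P B) : ∃ A, SB P A B := by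
  obtain ⟨as, k, p, P', R, e, hp, rfl⟩ := h
  refine ⟨p.protNames, (SB.congr e).2 ?_⟩
  have h0 : SB (.par (.caseOf p P') R) p.protNames p.freeNames := by
    refine .parL _ (SB_case.2 ⟨fun i => i.elim0, protNames_eq p, freeNames_eq p⟩)
  clear e
  have : ∀ as : List Name, (∀ a ∈ p.protNames, a ∉ as) →
      SB (nus as (.par (.caseOf p P') R)) p.protNames {a | a ∈ p.freeNames ∧ a ∉ as} := by
    intro as
    induction as with
    | nil => intro _; simpa [nus] using h0
    | cons a as ih =>
      intro hp
      have := (ih fun b hb hb' => hp b hb (by simp [hb'])).nu (a := a)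
        (fun ha => hp a ha (by simp))
      have e : {b | b ∈ p.freeNames ∧ b ∉ a :: as} =
          {b | b ∈ p.freeNames ∧ b ∉ as} \ {a} := by
        ext b
        simp [not_or]
        tauto
      rw [e]
      exact this
  exact this as hp

/-- Variable renamings that open some binders with the name `a`. -/
def Opens {n m : ℕ} (a : Name) (g : Var n → Var m) : Prop :=
  (∀ i, (∃ j, g (.bound i) = .bound j) ∨ g (.bound i) = .free a) ∧
    ∀ b, g (.free b) = .free b

theorem Opens.lift {n m : ℕ} {a : Name} {g : Var n → Var m} (h : Opens a g) (k : ℕ) :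
    Opens a (liftV g k) := by
  obtain ⟨h1, h3⟩ := h
  refine ⟨fun i => ?_, fun b => by simp only [liftV, h3 b]; rfl⟩
  induction i using Fin.addCases with
  | left i =>
    rcases h1 i with ⟨j, hj⟩ | hj
    · exact .inl ⟨_, by simp only [liftV, Fin.addCases_left, hj]; rfl⟩
    · exact .inr (by simp only [liftV, Fin.addCases_left, hj]; rfl)
  | right i => exact .inl ⟨_, by simp only [liftV, Fin.addCases_right]; rfl⟩

theorem Opens.mem_free {n m : ℕ} {a : Name} {g : Var n → Var m} (h : Opens a g) (S : Set (Var n))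
    (b : Name) (hb : b ≠ a ∨ ∀ i, Var.bound i ∉ S) : Var.free b ∈ g '' S ↔ Var.free b ∈ S := by
  obtain ⟨h1, h3⟩ := h
  constructor
  · rintro ⟨x, hx, e⟩
    cases x with
    | free c => rw [h3 c] at e; cases e; exact hx
    | bound i =>
      rcases h1 i with ⟨j, hj⟩ | hj
      · rw [hj] at e; cases e
      · rw [hj] at e; cases e
        rcases hb with hb | hb
        · exact absurd rfl hb
        · exact absurd hx (hb i)
  · intro hb; exact ⟨_, hb, h3 b⟩

/-- No protected variable refers to a binder, so opening leaves the protected names unchanged. An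
opened binder may occur unprotected, and then its name appears among the free names; hence the
comparison away from `a`. -/
theorem SB.opens {n : ℕ} {P : Proc n} {A B : Set Name} (h : SB P A B) :
    ∀ {m : ℕ} {g : Var n → Var m} {a : Name}, Opens a g →
      ∃ B', SB (P.subst (vren g)) A B' ∧ B' \ {a} = B \ {a} := by
  induction h with
  | @case n k p C h =>
    intro m g a hg
    refine ⟨_, SB_case.2 ⟨?_, ?_, rfl⟩, ?_⟩
    · rw [pv_vren]
      rintro i ⟨x, hx, e⟩
      cases x with
      | free c => rw [hg.2 c] at e; cases e
      | bound i => exact h i hx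
    · rw [pv_vren]
      ext b
      simp only [Set.mem_ofPred_eq, hg.mem_free _ _ (.inr h)]
    · rw [av_vren]
      ext b
      by_cases hb : b = a
      · simp [hb]
      · simp only [Set.mem_sdiff, Set.mem_ofPred_eq, hg.mem_free _ _ (.inl hb)]
  | parL Q _ ih => intro m g a hg; obtain ⟨B', h, e⟩ := ih hg; exact ⟨B', .parL _ h, e⟩
  | parR Q _ ih => intro m g a hg; obtain ⟨B', h, e⟩ := ih hg; exact ⟨B', .parR _ h, e⟩
  | rep _ ih => intro m g a hg; obtain ⟨B', h, e⟩ := ih hg; exact ⟨B', .rep h, e⟩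
  | res _ ih =>
    intro m g a hg
    obtain ⟨B', h, e⟩ := ih (hg.lift 1)
    rw [Proc.subst, lift_vren]
    exact ⟨B', .res h, e⟩

theorem fn_of_pv {n k : ℕ} (p : Pat n k) (a : Name) (h : .free a ∈ p.pv) : a ∈ p.fn := by
  induction p with
  | lam => simp [Pat.pv] at h
  | nm x => simp [Pat.pv] at h
  | prot x => simp only [Pat.pv, Set.mem_singleton_iff] at h; subst h; simp [Pat.fn, Var.fn]
  | comp p q h1 h2 =>
    simp only [Pat.pv, Set.mem_union] at h
    simp only [Pat.fn, Finset.mem_union]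
    exact h.imp h1 h2

theorem fn_of_av {n k : ℕ} (p : Pat n k) (a : Name) (h : .free a ∈ p.av) : a ∈ p.fn := by
  induction p with
  | lam => simp [Pat.av] at h
  | nm x => simp only [Pat.av, Set.mem_singleton_iff] at h; subst h; simp [Pat.fn, Var.fn]
  | prot x => simp only [Pat.av, Set.mem_singleton_iff] at h; subst h; simp [Pat.fn, Var.fn]
  | comp p q h1 h2 =>
    simp only [Pat.av, Set.mem_union] at h
    simp only [Pat.fn, Finset.mem_union]
    exact h.imp h1 h2

theorem SB.fn {n : ℕ} {P : Proc n} {A B : Set Name} (h : SB P A B) :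
    (∀ a ∈ A, a ∈ P.fn) ∧ ∀ a ∈ B, a ∈ P.fn := by
  induction h with
  | @case n k p C h =>
    exact ⟨fun a ha => by simp [Proc.fn, fn_of_pv p a ha],
      fun a ha => by simp [Proc.fn, fn_of_av p a ha]⟩
  | parL Q _ ih =>
    exact ⟨fun a ha => by simp [Proc.fn, ih.1 a ha], fun a ha => by simp [Proc.fn, ih.2 a ha]⟩
  | parR Q _ ih =>
    exact ⟨fun a ha => by simp [Proc.fn, ih.1 a ha], fun a ha => by simp [Proc.fn, ih.2 a ha]⟩
  | rep _ ih => exact ih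
  | res _ ih => exact ih

theorem exists_fresh (F : Finset Name) (k : ℕ) : ∃ x : Fin k ↪ Name, ∀ j, x j ∉ F := by
  obtain ⟨m, hm⟩ : ∃ m : ℕ, ∀ a ∈ F, a ≤ m := ⟨F.sup id, fun a ha => Finset.le_sup (f := id) ha⟩
  refine ⟨⟨fun j => m + 1 + j, fun i j h => by ext; simpa using h⟩, fun j hj => ?_⟩
  have h : m + 1 + (j : ℕ) ≤ m := hm _ hj
  omega

/-- Opens the last binder with the name `a`. -/
def openV {n : ℕ} (a : Name) : Var (n + 1) → Var n
  | .free b => .free b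
  | .bound i => Fin.addCases (fun i => .bound i) (fun _ => .free a) i

theorem instS_names {n : ℕ} (a : Name) :
    instS (n := n) (k := 1) (fun _ => .nm (.free a)) = vren (openV a) := by
  funext x
  cases x with
  | free b => rfl
  | bound i =>
    induction i using Fin.addCases <;> simp [instS, vren, openV]

theorem opens_openV {n : ℕ} (a : Name) : Opens a (openV (n := n) a) := by
  refine ⟨fun i => ?_, fun b => rfl⟩
  induction i using Fin.addCases with
  | left i => exact .inl ⟨i, by simp [openV]⟩
  | right i => exact .inr (by simp [openV])

/-- The restrictions above the exposed thread are opened with names outside `F` and collected in a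
list. The set `F` holds the names of neighbouring processes, so that these can be drawn into the
scope. The bound `s` replaces structural induction, because an opened body is not a subterm. -/
theorem SB.exists_nus (s : ℕ) : ∀ (P : Proc 0) {A B : Set Name} (_ : SB P A B) (_ : P.size ≤ s)
    (F : Finset Name), ∃ (as : List Name) (k : ℕ) (p : Pat 0 k) (P' : Proc (0 + k)) (R : Proc 0),
      StrEq P (nus as (.par (.caseOf p P') R)) ∧ p.protNames = A ∧ (∀ a ∈ as, a ∉ A) ∧
      B = {a | a ∈ p.freeNames ∧ a ∉ as} ∧ ∀ a ∈ as, a ∉ F := by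
  induction s with
  | zero =>
    intro P A B h hs F
    cases h with
    | case C h =>
      refine ⟨[], _, _, C, .zero, .symm (.par_zero _), protNames_eq _, by simp, ?_, by simp⟩
      simp [freeNames_eq]
    | _ => simp [Proc.size] at hs
  | succ s ih =>
    intro P A B h hs F
    cases h with
    | case C h =>
      refine ⟨[], _, _, C, .zero, .symm (.par_zero _), protNames_eq _, by simp, ?_, by simp⟩
      simp [freeNames_eq]
    | @parL _ P _ _ Q h =>
      simp only [Proc.size] at hs
      obtain ⟨as, k, p, P', R, e, h1, h2, h3, h4⟩ := ih P h (by omega) (F ∪ Q.fn)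
      refine ⟨as, k, p, P', .par R Q, ?_, h1, h2, h3, fun a ha hF => h4 a ha (by simp [hF])⟩
      refine .trans (.parL _ e) (.trans (.nus_par as _ _ fun a ha hq => h4 a ha (by simp [hq])) ?_)
      exact .nus_congr as (.assoc' _ _ _)
    | @parR _ P _ _ Q h =>
      simp only [Proc.size] at hs
      obtain ⟨as, k, p, P', R, e, h1, h2, h3, h4⟩ := ih P h (by omega) (F ∪ Q.fn)
      refine ⟨as, k, p, P', .par R Q, ?_, h1, h2, h3, fun a ha hF => h4 a ha (by simp [hF])⟩
      refine .trans (.par_comm _ _) (.trans (.parL _ e)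
        (.trans (.nus_par as _ _ fun a ha hq => h4 a ha (by simp [hq])) ?_))
      exact .nus_congr as (.assoc' _ _ _)
    | @rep _ Q _ _ h =>
      simp only [Proc.size] at hs
      obtain ⟨as, k, p, P', R, e, h1, h2, h3, h4⟩ := ih _ h (by omega) (F ∪ Q.fn)
      refine ⟨as, k, p, P', .par R (.rep Q), ?_, h1, h2, h3, fun a ha hF => h4 a ha (by simp [hF])⟩
      refine .trans (.rep_unfold _) (.trans (.parL _ e)
        (.trans (.nus_par as _ _ fun a ha hq => h4 a ha (by simp [show a ∈ Q.fn from hq])) ?_))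
      exact .nus_congr as (.assoc' _ _ _)
    | @res _ Q _ _ h =>
      simp only [Proc.size] at hs
      obtain ⟨x, hx⟩ := exists_fresh (F ∪ Q.fn) 1
      have ha := hx 0
      generalize x 0 = a at ha
      simp only [Finset.mem_union, not_or] at ha
      obtain ⟨B', hB, eB⟩ := h.opens (opens_openV (n := 0) a)
      rw [← instS_names, ← Proc.inst_eq] at hB
      have hfA := h.fn.1
      have hfB := h.fn.2
      obtain ⟨as, k, p, P', R, e, h1, h2, h3, h4⟩ := ih _ hB
        (by rw [Proc.inst_eq, Proc.size_subst]; omega) F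
      refine ⟨a :: as, k, p, P', R, ?_, h1, ?_, ?_, ?_⟩
      · rw [← nu_open a Q ha.2]
        exact .nu_congr a e
      · intro b hb
        rcases List.mem_cons.1 hb with rfl | hb
        · exact fun h => ha.2 (hfA _ h)
        · exact h2 b hb
      · have : B = B' \ {a} := by
          rw [eB]; ext b
          simp only [Set.mem_sdiff, Set.mem_singleton_iff]
          exact ⟨fun hb => ⟨hb, fun e => ha.2 (e ▸ hfB _ hb)⟩, fun hb => hb.1⟩
        rw [this, h3]
        ext b
        simp [not_or]
        tauto
      · intro b hb
        rcases List.mem_cons.1 hb with rfl | hb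
        · exact ha.1
        · exact h4 b hb

theorem SB.barb {P : Proc 0} {A B : Set Name} (h : SB P A B) : Barb P B := by
  obtain ⟨as, k, p, P', R, e, h1, h2, h3, -⟩ := h.exists_nus P.size P le_rfl ∅
  exact ⟨as, k, p, P', R, e, fun a ha ha' => h2 a ha' (h1 ▸ ha), h3⟩

/-! ### Closed processes as contexts without holes -/

/-- Contexts bind names while processes use indices, so each binder is opened with fresh names
before recursing; the recursion is on size for this reason. -/
theorem exists_ctx (j s : ℕ) : ∀ P : Proc 0, P.size ≤ s →
    ∃ C : Ctx j, (∀ Ps, C.fill Ps = P) ∧ ∀ i, C.count i = 0 := by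
  induction s with
  | zero =>
    intro P hs
    cases P with
    | zero => exact ⟨.zero, fun _ => rfl, fun _ => rfl⟩
    | ok => exact ⟨.ok, fun _ => rfl, fun _ => rfl⟩
    | _ => simp [Proc.size] at hs
  | succ s ih =>
    intro P hs
    cases P with
    | zero => exact ⟨.zero, fun _ => rfl, fun _ => rfl⟩
    | ok => exact ⟨.ok, fun _ => rfl, fun _ => rfl⟩
    | par P Q =>
      simp only [Proc.size] at hs
      obtain ⟨C, h1, h2⟩ := ih P (by omega)
      obtain ⟨D, h3, h4⟩ := ih Q (by omega)
      exact ⟨.par C D, fun Ps => by simp [Ctx.fill, h1, h3], fun i => by simp [Ctx.count, h2, h4]⟩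
    | rep P =>
      simp only [Proc.size] at hs
      obtain ⟨C, h1, h2⟩ := ih P (by omega)
      exact ⟨.rep C, fun Ps => by simp [Ctx.fill, h1], fun i => by simp [Ctx.count, h2]⟩
    | res P =>
      simp only [Proc.size] at hs
      obtain ⟨x, hx⟩ := exists_fresh P.fn 1
      obtain ⟨C, h1, h2⟩ := ih (P.inst (k := 1) fun _ => .nm (.free (x 0)))
        (by rw [Proc.inst_eq, Proc.size_subst]; omega)
      exact ⟨.nu (x 0) C, fun Ps => by simp only [Ctx.fill, h1]; exact nu_open _ _ (hx 0),
        fun i => by simp [Ctx.count, h2]⟩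
    | @caseOf _ k p P =>
      simp only [Proc.size] at hs
      obtain ⟨x, hx⟩ := exists_fresh P.fn k
      obtain ⟨C, h1, h2⟩ := ih (P.inst fun j => .nm (.free (x j)))
        (by rw [Proc.inst_eq, Proc.size_subst]; omega)
      exact ⟨.caseOf p x C, fun Ps => by simp only [Ctx.fill, h1, Proc.bindNames_inst x P hx],
        fun i => by simp [Ctx.count, h2]⟩

/-! ### Offers without binding names -/

/-- `OutS T p T'`: `T` exposes a thread `p → C`, and `T'` is `T` with this thread replaced by `C`. -/
inductive OutS : {n : ℕ} → Proc n → Pat n 0 → Proc n → Prop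
  | case {n : ℕ} (p : Pat n 0) (C : Proc n) : OutS (.caseOf p C) p C
  | parL {n : ℕ} {P P' : Proc n} {p : Pat n 0} (Q : Proc n) :
      OutS P p P' → OutS (.par P Q) p (.par P' Q)
  | parR {n : ℕ} {Q Q' : Proc n} {p : Pat n 0} (P : Proc n) :
      OutS Q p Q' → OutS (.par P Q) p (.par P Q')
  | rep {n : ℕ} {P P' : Proc n} {p : Pat n 0} : OutS P p P' → OutS (.rep P) p (.par P' (.rep P))
  | res {n : ℕ} {P P' : Proc (n + 1)} {p : Pat n 0} :
      OutS P (p.subst (wkS 1)) P' → OutS (.res P) p (.res P')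

/-- A thread that binds nothing learns nothing from the partner, so its continuation can be split
off from the result and replaced by any other. The condition on `k` is a hypothesis because the
induction needs a variable index. -/
theorem Int.split {n k : ℕ} {P X : Proc n} {q : Pat n k} {D : Proc (n + k)} (h : Int P q D X) :
    k = 0 → ∃ Y : Proc n, (∀ σ, StrEq X (.par Y (D.inst σ))) ∧
      ∀ D', ∃ X', Int P q D' X' ∧ ∀ σ, StrEq X' (.par Y (D'.inst σ)) := by
  induction h with
  | @comm n j k p q σ ρ C D h =>
    rintro rfl
    refine ⟨C.inst σ, fun σ' => ?_, fun D' => ⟨_, .comm C D' h, fun σ' => ?_⟩⟩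
    · rw [Subsingleton.elim ρ σ']; exact .refl _
    · rw [Subsingleton.elim ρ σ']; exact .refl _
  | parL Q _ ih =>
    intro hk
    obtain ⟨Y, e, h⟩ := ih hk
    refine ⟨.par Y Q, fun σ => .trans (.parL _ (e σ)) (.right_comm _ _ _), fun D' => ?_⟩
    obtain ⟨X', h', e'⟩ := h D'
    exact ⟨_, .parL _ h', fun σ => .trans (.parL _ (e' σ)) (.right_comm _ _ _)⟩
  | parR Q _ ih =>
    intro hk
    obtain ⟨Y, e, h⟩ := ih hk
    refine ⟨.par Q Y, fun σ => .trans (.parR _ (e σ)) (.par_assoc _ _ _), fun D' => ?_⟩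
    obtain ⟨X', h', e'⟩ := h D'
    exact ⟨_, .parR _ h', fun σ => .trans (.parR _ (e' σ)) (.par_assoc _ _ _)⟩
  | @rep n k P X q D _ ih =>
    intro hk
    obtain ⟨Y, e, h⟩ := ih hk
    refine ⟨.par Y (.rep P), fun σ => .trans (.parL _ (e σ)) (.right_comm _ _ _), fun D' => ?_⟩
    obtain ⟨X', h', e'⟩ := h D'
    exact ⟨_, .rep h', fun σ => .trans (.parL _ (e' σ)) (.right_comm _ _ _)⟩
  | res _ ih =>
    intro hk
    obtain ⟨Y, e, h⟩ := ih hk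
    refine ⟨.res Y, fun σ => ?_, fun D' => ?_⟩
    · refine .trans (.res_congr (e fun i => (σ i).subst (wkS 1))) ?_
      rw [← Proc.inst_subst]
      exact .symm (.extrudeL _ _)
    · obtain ⟨X', h', e'⟩ := h (D'.subst (lift (wkS 1) _))
      refine ⟨_, .res h', fun σ => .trans (.res_congr (e' fun i => (σ i).subst (wkS 1))) ?_⟩
      rw [← Proc.inst_subst]
      exact .symm (.extrudeL _ _)

theorem Int.cont {n : ℕ} {P X : Proc n} {q : Pat n 0} {D : Proc n}
    (h : Int (k := 0) P q D X) (D' : Proc n) :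
    ∃ X' Y, Int (k := 0) P q D' X' ∧ StrEq X (.par Y D) ∧ StrEq X' (.par Y D') := by
  obtain ⟨Y, e, h⟩ := h.split rfl
  obtain ⟨X', h', e'⟩ := h D'
  refine ⟨X', Y, h', ?_, ?_⟩
  · have := e Fin.elim0; rwa [Proc.inst_zero] at this
  · have := e' Fin.elim0; rwa [Proc.inst_zero] at this

theorem Int.zero_cont {n : ℕ} {P X : Proc n} {q : Pat n 0} {D : Proc n}
    (h : Int (k := 0) P q D X) :
    ∃ X', Int (k := 0) P q .zero X' ∧ StrEq X (.par X' D) := by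
  obtain ⟨X', Y, h', e, e'⟩ := h.cont .zero
  exact ⟨X', h', e.trans (.parL _ (.symm (e'.trans (.par_zero _))))⟩

theorem Int.of_zero_cont {n : ℕ} {P X : Proc n} {q : Pat n 0}
    (h : Int (k := 0) P q .zero X) (D : Proc n) :
    ∃ X', Int (k := 0) P q D X' ∧ StrEq X' (.par X D) := by
  obtain ⟨X', Y, h', e, e'⟩ := h.cont D
  exact ⟨X', h', e'.trans (.parL _ (.symm (e.trans (.par_zero _))))⟩

/-- The partner's residual `X` is computed with an empty continuation; the actual continuation is
already contained in `T'`. -/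
theorem OutS.com {n : ℕ} {T T' : Proc n} {p : Pat n 0} (h : OutS T p T') :
    ∀ {Q X : Proc n}, Int (k := 0) Q p .zero X → ∃ Y, Com T Q Y ∧ StrEq Y (.par T' X) := by
  induction h with
  | case p C =>
    intro Q X hQ
    obtain ⟨X', h, e⟩ := hQ.of_zero_cont C
    exact ⟨X', .case h, e.trans (.par_comm _ _)⟩
  | parL R _ ih =>
    intro Q X hQ
    obtain ⟨Y, h, e⟩ := ih hQ
    exact ⟨_, .parL _ h, .trans (.parL _ e) (.right_comm _ _ _)⟩
  | parR R _ ih =>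
    intro Q X hQ
    obtain ⟨Y, h, e⟩ := ih hQ
    exact ⟨_, .parR _ h, .trans (.parR _ e) (.par_assoc _ _ _)⟩
  | rep _ ih =>
    intro Q X hQ
    obtain ⟨Y, h, e⟩ := ih hQ
    exact ⟨_, .rep h, .trans (.parL _ e) (.right_comm _ _ _)⟩
  | res _ ih =>
    intro Q X hQ
    obtain ⟨Y, h, e⟩ := ih (hQ.subst (wkS 1))
    exact ⟨_, .res h, .trans (.res_congr e) (.symm (.extrudeL _ _))⟩

/-! ### Weak barbed congruence from a relation on agents -/

/-- The congruence generated by a relation. -/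
inductive Rel (Ag : ∀ {n : ℕ}, Proc n → Proc n → Prop) : {n : ℕ} → Proc n → Proc n → Prop
  | agent {n : ℕ} {P Q : Proc n} : Ag P Q → Rel Ag P Q
  | zero {n : ℕ} : Rel Ag (.zero : Proc n) .zero
  | ok {n : ℕ} : Rel Ag (.ok : Proc n) .ok
  | par {n : ℕ} {P P' Q Q' : Proc n} : Rel Ag P P' → Rel Ag Q Q' → Rel Ag (.par P Q) (.par P' Q')
  | rep {n : ℕ} {P P' : Proc n} : Rel Ag P P' → Rel Ag (.rep P) (.rep P')
  | res {n : ℕ} {P P' : Proc (n + 1)} : Rel Ag P P' → Rel Ag (.res P) (.res P')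
  | case {n k : ℕ} (p : Pat n k) {P P' : Proc (n + k)} :
      Rel Ag P P' → Rel Ag (.caseOf p P) (.caseOf p P')

/-- A relation on processes whose interactions with an environment do not receive data, and are
matched weakly. -/
structure IsAgents (Ag : ∀ {n : ℕ}, Proc n → Proc n → Prop) : Prop where
  symm : ∀ {n : ℕ} {P Q : Proc n}, Ag P Q → Ag Q P
  subst : ∀ {n m : ℕ} {P Q : Proc n} (θ : Var n → CPat m), Ag P Q → Ag (P.subst θ) (Q.subst θ)
  not_ok : ∀ {n : ℕ} {P Q : Proc n}, Ag P Q → ¬ HasOk P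
  barb : ∀ {n : ℕ} {P Q : Proc n} {A B : Set Name}, Ag P Q → SB P A B →
    ∃ Q', Wk Q Q' ∧ SB Q' A B
  tau : ∀ {n : ℕ} {P Q X : Proc n}, Ag P Q → Tau P X →
    ∃ P' Q', StrEq X P' ∧ Wk Q Q' ∧ Ag P' Q'
  com : ∀ {n : ℕ} {P Q E X : Proc n}, Ag P Q → Com P E X →
    ∃ (p : Pat n 0) (P' E' Q₀ Q' : Proc n), Int (k := 0) E p .zero E' ∧ StrEq X (.par P' E') ∧
      Wk Q Q₀ ∧ OutS Q₀ p Q' ∧ Ag P' Q'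

section

variable {Ag : ∀ {n : ℕ}, Proc n → Proc n → Prop}

theorem Rel.refl {n : ℕ} (P : Proc n) : Rel Ag P P := by
  induction P with
  | zero => exact .zero
  | ok => exact .ok
  | par P Q h1 h2 => exact .par h1 h2
  | rep P h => exact .rep h
  | res P h => exact .res h
  | caseOf p P h => exact .case p h

theorem Rel.symm (hA : IsAgents Ag) {n : ℕ} {P Q : Proc n} (h : Rel Ag P Q) : Rel Ag Q P := by
  induction h with
  | agent h => exact .agent (hA.symm h)
  | zero => exact .zero
  | ok => exact .ok
  | par _ _ h1 h2 => exact .par h1 h2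
  | rep _ h => exact .rep h
  | res _ h => exact .res h
  | case p _ h => exact .case p h

theorem Rel.subst (hA : IsAgents Ag) {n : ℕ} {P Q : Proc n} (h : Rel Ag P Q) :
    ∀ {m : ℕ} (θ : Var n → CPat m), Rel Ag (P.subst θ) (Q.subst θ) := by
  induction h with
  | agent h => intro m θ; exact .agent (hA.subst θ h)
  | zero => intro m θ; exact .zero
  | ok => intro m θ; exact .ok
  | par _ _ h1 h2 => intro m θ; exact .par (h1 θ) (h2 θ)
  | rep _ h => intro m θ; exact .rep (h θ)
  | res _ h => intro m θ; exact .res (h _)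
  | case p _ h => intro m θ; exact .case _ (h _)

/-- The generated congruence up to structural equivalence. -/
def RelE (Ag : ∀ {n : ℕ}, Proc n → Proc n → Prop) {n : ℕ} (P Q : Proc n) : Prop :=
  ∃ P' Q', StrEq P P' ∧ Rel Ag P' Q' ∧ StrEq Q' Q

namespace RelE

theorem of_rel {n : ℕ} {P Q : Proc n} (h : Rel Ag P Q) : RelE Ag P Q :=
  ⟨P, Q, .refl _, h, .refl _⟩

theorem congr {n : ℕ} {P Q P' Q' : Proc n} (h : RelE Ag P Q) (e : StrEq P' P) (e' : StrEq Q Q') :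
    RelE Ag P' Q' := by
  obtain ⟨P1, Q1, e1, h, e2⟩ := h
  exact ⟨P1, Q1, e.trans e1, h, e2.trans e'⟩

theorem symm (hA : IsAgents Ag) {n : ℕ} {P Q : Proc n} (h : RelE Ag P Q) : RelE Ag Q P := by
  obtain ⟨P1, Q1, e1, h, e2⟩ := h
  exact ⟨Q1, P1, e2.symm, h.symm hA, e1.symm⟩

theorem subst (hA : IsAgents Ag) {n m : ℕ} {P Q : Proc n} (h : RelE Ag P Q)
    (θ : Var n → CPat m) : RelE Ag (P.subst θ) (Q.subst θ) := by
  obtain ⟨P1, Q1, e1, h, e2⟩ := h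
  exact ⟨_, _, e1.subst θ, h.subst hA θ, e2.subst θ⟩

theorem par {n : ℕ} {P P' Q Q' : Proc n} (h : RelE Ag P P') (h' : RelE Ag Q Q') :
    RelE Ag (.par P Q) (.par P' Q') := by
  obtain ⟨P1, Q1, e1, h, e2⟩ := h
  obtain ⟨P2, Q2, e3, h', e4⟩ := h'
  exact ⟨_, _, .par_congr e1 e3, .par h h', .par_congr e2 e4⟩

theorem rep {n : ℕ} {P P' : Proc n} (h : RelE Ag P P') : RelE Ag (.rep P) (.rep P') := by
  obtain ⟨P1, Q1, e1, h, e2⟩ := h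
  exact ⟨_, _, .rep_congr e1, .rep h, .rep_congr e2⟩

theorem res {n : ℕ} {P P' : Proc (n + 1)} (h : RelE Ag P P') : RelE Ag (.res P) (.res P') := by
  obtain ⟨P1, Q1, e1, h, e2⟩ := h
  exact ⟨_, _, .res_congr e1, .res h, .res_congr e2⟩

theorem case {n k : ℕ} (p : Pat n k) {P P' : Proc (n + k)} (h : RelE Ag P P') :
    RelE Ag (.caseOf p P) (.caseOf p P') := by
  obtain ⟨P1, Q1, e1, h, e2⟩ := h
  exact ⟨_, _, .case_congr p e1, .case p h, .case_congr p e2⟩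

theorem fill (hA : IsAgents Ag) {P Q : Proc 0} (h : RelE Ag P Q) (C : Ctx 1) :
    RelE Ag (C.fill fun _ => P) (C.fill fun _ => Q) := by
  induction C with
  | hole i => exact h
  | zero => exact of_rel .zero
  | ok => exact of_rel .ok
  | par C D h1 h2 => exact h1.par h2
  | rep C h => exact h.rep
  | nu a C h =>
    simp only [Ctx.fill, nu_eq, Proc.bindNames_eq]
    exact (h.subst hA _).res
  | caseOf p x C h =>
    simp only [Ctx.fill, Proc.bindNames_eq]
    exact (h.subst hA _).case p

end RelE

/-- The environment thread `q → D` may bind names, and related continuations stay related under the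
instantiation. If the exposed thread belongs to an agent, roles are exchanged and the matching
clause for agents is used. -/
theorem Rel.int_match (hA : IsAgents Ag) {n k : ℕ} {P X : Proc n} {q : Pat n k} {D : Proc (n + k)}
    (h : Int P q D X) : ∀ {Q : Proc n} {D' : Proc (n + k)}, Rel Ag P Q → Rel Ag D D' →
      ∃ Q' Y, Wk Q Q' ∧ Int Q' q D' Y ∧ RelE Ag X Y := by
  have agent : ∀ {n k : ℕ} {P X : Proc n} {q : Pat n k} {D : Proc (n + k)},
      Int P q D X → ∀ {Q : Proc n} {D' : Proc (n + k)}, Ag P Q → Rel Ag D D' →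
      ∃ Q' Y, Wk Q Q' ∧ Int Q' q D' Y ∧ RelE Ag X Y := by
    intro n k P X q D h Q D' hP hD
    obtain ⟨X', hX, e⟩ := (Com.case h).symm
    obtain ⟨p, P', E', Q0, Q', hE, e', hw, ho, hag⟩ := hA.com hP hX
    -- The environment is the single thread `q → D`, so its move can only be a direct unification
    -- with the offer `p`.
    cases hE with
    | @comm _ _ _ _ _ σ ρ _ _ hu =>
      obtain ⟨Y, hY, eY⟩ := ho.com (.comm D' .zero hu)
      obtain ⟨Y', hY', eY'⟩ := hY.symm
      cases hY' with
      | case hY' =>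
        refine ⟨Q0, Y', hw, hY', ?_⟩
        refine RelE.congr (.of_rel (.par (.agent hag) (.par (hD.subst hA (instS σ)) .zero)))
          (e.symm.trans e') (eY.symm.trans eY'.symm)
  induction h with
  | comm C D h =>
    intro Q D' hP hD
    cases hP with
    | agent hag => exact agent (.comm C D h) hag hD
    | case _ hC =>
      exact ⟨_, _, .refl _, .comm _ _ h, .of_rel (.par (hC.subst hA _) (hD.subst hA _))⟩
  | parL R h ih =>
    intro Q D' hP hD
    cases hP with
    | agent hag => exact agent (.parL R h) hag hD
    | par h1 h2 =>
      obtain ⟨Q', Y, hw, hi, hr⟩ := ih h1 hD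
      exact ⟨_, _, hw.parL _, .parL _ hi, hr.par (.of_rel h2)⟩
  | parR R h ih =>
    intro Q D' hP hD
    cases hP with
    | agent hag => exact agent (.parR R h) hag hD
    | par h1 h2 =>
      obtain ⟨Q', Y, hw, hi, hr⟩ := ih h2 hD
      exact ⟨_, _, hw.parR _, .parR _ hi, RelE.par (.of_rel h1) hr⟩
  | rep h ih =>
    intro Q D' hP hD
    cases hP with
    | agent hag => exact agent (.rep h) hag hD
    | rep h1 =>
      obtain ⟨Q', Y, hw, hi, hr⟩ := ih h1 hD
      exact ⟨_, _, hw.rep, .parL _ hi, hr.par (.of_rel (.rep h1))⟩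
  | res h ih =>
    intro Q D' hP hD
    cases hP with
    | agent hag => exact agent (.res h) hag hD
    | res h1 =>
      obtain ⟨Q', Y, hw, hi, hr⟩ := ih h1 (hD.subst hA _)
      exact ⟨_, _, hw.res, .res hi, hr.res⟩

/-- Matching is weak, so the partner may have to take internal steps first; the conclusion is
therefore about the whole parallel composition. -/
theorem Rel.com_match (hA : IsAgents Ag) {n : ℕ} {P E X : Proc n}
    (h : Com P E X) : ∀ {Q F : Proc n}, Rel Ag P Q → Rel Ag E F →
      ∃ Y, Wk (.par Q F) Y ∧ RelE Ag X Y := by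
  have agent : ∀ {n : ℕ} {P E X : Proc n}, Com P E X → ∀ {Q F : Proc n}, Ag P Q → Rel Ag E F →
      ∃ Y, Wk (.par Q F) Y ∧ RelE Ag X Y := by
    intro n P E X h Q F hP hE
    obtain ⟨p, P', E', Q0, Q', hi, e', hw, ho, hag⟩ := hA.com hP h
    obtain ⟨F0, Z, hF, hi', hr⟩ := Rel.int_match hA hi hE .zero
    obtain ⟨Y, hY, eY⟩ := ho.com hi'
    refine ⟨Y, ((hw.parL _).trans (hF.parR _)).trans (.of_red hY.toRed), ?_⟩
    exact (RelE.par (.of_rel (.agent hag)) hr).congr e' eY.symm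
  induction h with
  | case h =>
    intro Q F hP hE
    cases hP with
    | agent hag => exact agent (.case h) hag hE
    | case _ hC =>
      obtain ⟨F', Y, hw, hi, hr⟩ := Rel.int_match hA h hE hC
      exact ⟨Y, (hw.parR _).trans (.of_red (Com.case hi).toRed), hr⟩
  | parL R h ih =>
    intro Q F hP hE
    cases hP with
    | agent hag => exact agent (.parL R h) hag hE
    | par h1 h2 =>
      obtain ⟨Y, hw, hr⟩ := ih h1 hE
      exact ⟨_, (Wk.of_strEq (.right_comm _ _ _)).trans (hw.parL _), hr.par (.of_rel h2)⟩
  | parR R h ih =>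
    intro Q F hP hE
    cases hP with
    | agent hag => exact agent (.parR R h) hag hE
    | par h1 h2 =>
      obtain ⟨Y, hw, hr⟩ := ih h2 hE
      exact ⟨_, (Wk.of_strEq (.assoc' _ _ _)).trans (hw.parR _), RelE.par (.of_rel h1) hr⟩
  | rep h ih =>
    intro Q F hP hE
    cases hP with
    | agent hag => exact agent (.rep h) hag hE
    | rep h1 =>
      obtain ⟨Y, hw, hr⟩ := ih h1 hE
      exact ⟨_, (Wk.of_strEq (.trans (.parL _ (.rep_unfold _)) (.right_comm _ _ _))).trans
        (hw.parL _), hr.par (.of_rel (.rep h1))⟩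
  | res h ih =>
    intro Q F hP hE
    cases hP with
    | agent hag => exact agent (.res h) hag hE
    | res h1 =>
      obtain ⟨Y, hw, hr⟩ := ih h1 (hE.subst hA _)
      exact ⟨_, (Wk.of_strEq (.extrudeL _ _)).trans hw.res, hr.res⟩

theorem Rel.tau_match (hA : IsAgents Ag) {n : ℕ} {P X : Proc n} (h : Tau P X) :
    ∀ {Q : Proc n}, Rel Ag P Q → ∃ Y, Wk Q Y ∧ RelE Ag X Y := by
  have agent : ∀ {n : ℕ} {P X : Proc n}, Tau P X → ∀ {Q : Proc n}, Ag P Q →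
      ∃ Y, Wk Q Y ∧ RelE Ag X Y := by
    intro n P X h Q hP
    obtain ⟨P', Q', e, hw, hag⟩ := hA.tau hP h
    exact ⟨Q', hw, (RelE.of_rel (.agent hag)).congr e (.refl _)⟩
  induction h with
  | com h =>
    intro Q hP
    cases hP with
    | agent hag => exact agent (.com h) hag
    | par h1 h2 => exact Rel.com_match hA h h1 h2
  | parL R h ih =>
    intro Q hP
    cases hP with
    | agent hag => exact agent (.parL R h) hag
    | par h1 h2 =>
      obtain ⟨Y, hw, hr⟩ := ih h1
      exact ⟨_, hw.parL _, hr.par (.of_rel h2)⟩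
  | parR R h ih =>
    intro Q hP
    cases hP with
    | agent hag => exact agent (.parR R h) hag
    | par h1 h2 =>
      obtain ⟨Y, hw, hr⟩ := ih h2
      exact ⟨_, hw.parR _, RelE.par (.of_rel h1) hr⟩
  | rep h ih =>
    intro Q hP
    cases hP with
    | agent hag => exact agent (.rep h) hag
    | rep h1 =>
      obtain ⟨Y, hw, hr⟩ := ih h1
      exact ⟨_, hw.rep, hr.par (.of_rel (.rep h1))⟩
  | repCom h =>
    intro Q hP
    cases hP with
    | agent hag => exact agent (.repCom h) hag
    | @rep _ _ P' h1 =>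
      obtain ⟨Y, hw, hr⟩ := Rel.com_match hA h h1 h1
      -- Two copies are unfolded beforehand, one for each side of the communication.
      refine ⟨.par Y (.rep P'), (Wk.of_strEq ?_).trans (hw.parL _), hr.par (.of_rel (.rep h1))⟩
      exact .trans (.rep_unfold _) (.trans (.parR _ (.rep_unfold _)) (.par_assoc _ _ _))
  | res h ih =>
    intro Q hP
    cases hP with
    | agent hag => exact agent (.res h) hag
    | res h1 =>
      obtain ⟨Y, hw, hr⟩ := ih h1
      exact ⟨_, hw.res, hr.res⟩

theorem Rel.hasOk (hA : IsAgents Ag) {n : ℕ} {P Q : Proc n} (h : Rel Ag P Q) (hP : HasOk P) :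
    HasOk Q := by
  induction h with
  | agent h => exact absurd hP (hA.not_ok h)
  | zero => exact hP
  | ok => exact hP
  | par _ _ h1 h2 => exact hasOk_par.2 ((hasOk_par.1 hP).imp h1 h2)
  | rep _ h => exact .rep (h (hasOk_rep.1 hP))
  | res _ h => exact .res (h (hasOk_res.1 hP))
  | case p _ h => exact absurd hP (not_hasOk_case _ _)

theorem Rel.sb (hA : IsAgents Ag) {n : ℕ} {P Q : Proc n} {A B : Set Name} (h : Rel Ag P Q)
    (hP : SB P A B) : ∃ Q', Wk Q Q' ∧ SB Q' A B := by
  induction h with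
  | agent h => exact hA.barb h hP
  | zero => exact ⟨_, .refl _, hP⟩
  | ok => exact ⟨_, .refl _, hP⟩
  | par _ _ h1 h2 =>
    rcases SB_par.1 hP with hP | hP
    · obtain ⟨Q', hw, hs⟩ := h1 hP; exact ⟨_, hw.parL _, .parL _ hs⟩
    · obtain ⟨Q', hw, hs⟩ := h2 hP; exact ⟨_, hw.parR _, .parR _ hs⟩
  | rep _ h => obtain ⟨Q', hw, hs⟩ := h (SB_rep.1 hP); exact ⟨_, hw.rep, .parL _ hs⟩
  | res _ h => obtain ⟨Q', hw, hs⟩ := h (SB_res.1 hP); exact ⟨_, hw.res, .res hs⟩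
  | case p _ h => exact ⟨_, .refl _, SB_case.2 (SB_case.1 hP)⟩

theorem RelE.red (hA : IsAgents Ag) {P Q P' : Proc 0} (h : RelE Ag P Q) (hr : Red P P') :
    ∃ Q', Reds Q Q' ∧ RelE Ag P' Q' := by
  obtain ⟨P1, Q1, e1, h, e2⟩ := h
  obtain ⟨X, hX, eX⟩ := (hr.congr e1 (.refl _)).toTau
  obtain ⟨Y, hY, hr⟩ := Rel.tau_match hA hX h
  obtain ⟨Q', hq, eq⟩ := ((Wk.of_strEq e2.symm).trans hY).toReds
  exact ⟨Q', hq, hr.congr eX.symm eq.symm⟩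

/-- Closure under contexts is built into the generated congruence. What remains is that one
reduction is matched, and a reduction either happens in the common syntax, or inside an agent, or
between an agent and its surroundings; the clauses of `IsAgents` handle the last two. -/
theorem isBarbedCongruence (hA : IsAgents Ag) : IsBarbedCongruence (RelE Ag (n := 0)) where
  symm _ _ h := h.symm hA
  red _ _ h _ hr := h.red hA hr
  ctx _ _ h C _ := h.fill hA C
  barb P Q h m hb := by
    obtain ⟨A, hs⟩ := SB.of_barb hb
    obtain ⟨P1, Q1, e1, h, e2⟩ := h
    obtain ⟨Q', hw, hs⟩ := Rel.sb hA h ((SB.congr e1).1 hs)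
    obtain ⟨Q2, hq, eq⟩ := ((Wk.of_strEq e2.symm).trans hw).toReds
    exact ⟨Q2, hq, ((SB.congr eq).2 hs).barb⟩
  succ P Q h hs := by
    rw [succeeds_iff] at hs ⊢
    obtain ⟨P', hr, ho⟩ := hs
    have : ∃ Q', Reds Q Q' ∧ RelE Ag P' Q' := by
      clear ho
      induction hr with
      | refl => exact ⟨Q, .refl, h⟩
      | tail _ hr ih =>
        obtain ⟨Q', hq, h⟩ := ih
        obtain ⟨Q2, hq2, h⟩ := h.red hA hr
        exact ⟨Q2, Relation.ReflTransGen.trans hq hq2, h⟩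
    obtain ⟨Q', hq, P1, Q1, e1, h, e2⟩ := this
    exact ⟨Q', hq, (HasOk.congr e2).1 (h.hasOk hA ((HasOk.congr e1).1 ho))⟩

theorem IsAgents.bEq (hA : IsAgents Ag) {P Q : Proc 0} (h : Ag P Q) : BEq P Q :=
  ⟨_, isBarbedCongruence hA, .of_rel (.agent h)⟩

end

/-- The empty relation is a relation on agents, and its generated congruence is reflexive. -/
theorem BEq.refl (P : Proc 0) : BEq P P :=
  ⟨_, isBarbedCongruence (Ag := fun _ _ => False)
    ⟨id, fun _ => id, False.elim, False.elim, False.elim, False.elim⟩, .of_rel (.refl P)⟩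

/-! ### Rewriting of constructions -/

/-- `SK`-reduction of communicable patterns, where `s` and `k` stand for the two combinators. -/
inductive CStep {n : ℕ} (s k : CPat n) : CPat n → CPat n → Prop
  | ruleS (x y z : CPat n) : CStep s k (.comp (.comp (.comp s x) y) z) (.comp (.comp x z) (.comp y z))
  | ruleK (x y : CPat n) : CStep s k (.comp (.comp k x) y) x
  | appL {x x' : CPat n} (y : CPat n) : CStep s k x x' → CStep s k (.comp x y) (.comp x' y)
  | appR (x : CPat n) {y y' : CPat n} : CStep s k y y' → CStep s k (.comp x y) (.comp x y')

theorem CStep.subst {n m : ℕ} {s k d e : CPat n} (h : CStep s k d e) (θ : Var n → CPat m) :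
    CStep (s.subst θ) (k.subst θ) (d.subst θ) (e.subst θ) := by
  induction h with
  | ruleS x y z => exact .ruleS _ _ _
  | ruleK x y => exact .ruleK _ _
  | appL y _ ih => exact .appL _ ih
  | appR x _ ih => exact .appR _ ih

theorem CPat.subst_renS_inj {n m : ℕ} {f : Fin n → Fin m} (hf : Function.Injective f) :
    Function.Injective (CPat.subst (renS f)) := by
  intro d
  induction d with
  | nm x =>
    intro e h
    cases e with
    | nm y =>
      simp only [CPat.subst, renS, CPat.nm.injEq] at h
      rw [Var.map_inj hf h]
    | comp _ _ => simp [CPat.subst, renS] at h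
  | comp d1 d2 h1 h2 =>
    intro e h
    cases e with
    | nm y => simp [CPat.subst, renS] at h
    | comp _ _ =>
      simp only [CPat.subst, CPat.comp.injEq] at h
      rw [h1 h.1, h2 h.2]

theorem CPat.wk_inj {n : ℕ} : Function.Injective (CPat.wk 1 : CPat n → CPat (n + 1)) := by
  intro d e h
  rw [CPat.wk_eq_subst, CPat.wk_eq_subst] at h
  exact CPat.subst_renS_inj (castAdd_inj n) h

theorem CPat.wk_eq_comp {n : ℕ} {d : CPat n} {x y : CPat (n + 1)} (h : d.wk 1 = .comp x y) :
    ∃ x' y', d = .comp x' y' ∧ x = x'.wk 1 ∧ y = y'.wk 1 := by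
  cases d with
  | nm _ => simp [CPat.wk] at h
  | comp d e =>
    simp only [CPat.wk, CPat.comp.injEq] at h
    exact ⟨d, e, rfl, h.1.symm, h.2.symm⟩

/-- Rewriting copies and discards but creates no names, so the values computed under the private
name never contain it. -/
theorem CStep.reflect {n : ℕ} {s k d : CPat n} {d' e' : CPat (n + 1)}
    (h : CStep (s.wk 1) (k.wk 1) d' e') (hd : d' = d.wk 1) :
    ∃ e, e' = e.wk 1 ∧ CStep s k d e := by
  induction h generalizing d with
  | ruleS x y z =>
    obtain ⟨d1, z, rfl, e1, rfl⟩ := CPat.wk_eq_comp hd.symm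
    obtain ⟨d2, y, rfl, e2, rfl⟩ := CPat.wk_eq_comp e1.symm
    obtain ⟨d3, x, rfl, e3, rfl⟩ := CPat.wk_eq_comp e2.symm
    obtain rfl := CPat.wk_inj e3
    exact ⟨.comp (.comp x z) (.comp y z), rfl, .ruleS _ _ _⟩
  | ruleK x y =>
    obtain ⟨d1, y, rfl, e1, rfl⟩ := CPat.wk_eq_comp hd.symm
    obtain ⟨d2, x, rfl, e2, rfl⟩ := CPat.wk_eq_comp e1.symm
    obtain rfl := CPat.wk_inj e2
    exact ⟨x, rfl, .ruleK _ _⟩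
  | appL y _ ih =>
    obtain ⟨d, y, rfl, e1, rfl⟩ := CPat.wk_eq_comp hd.symm
    obtain ⟨e, rfl, h⟩ := ih e1
    exact ⟨.comp e y, rfl, .appL _ h⟩
  | appR y _ ih =>
    obtain ⟨y, d, rfl, rfl, e1⟩ := CPat.wk_eq_comp hd.symm
    obtain ⟨e, rfl, h⟩ := ih e1
    exact ⟨.comp y e, rfl, .appR _ h⟩

def CPat.sz {n : ℕ} : CPat n → ℕ
  | .nm _ => 1
  | .comp d e => d.sz + e.sz + 1

theorem CPat.sz_pos {n : ℕ} (d : CPat n) : 0 < d.sz := by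
  cases d <;> simp [CPat.sz]

/-! ### Evaluation contexts on a stack

The empty stack is `s`; a frame records the sibling of the current position, tagged with `s` for a
left and with `s • s` for a right position. -/

def fl {n : ℕ} (s y z : CPat n) : CPat n := .comp (.comp s y) z

def fr {n : ℕ} (s y z : CPat n) : CPat n := .comp (.comp (.comp s s) y) z

theorem fl_ne {n : ℕ} {s y z : CPat n} : fl s y z ≠ s := fun h => by
  have := congrArg CPat.sz h
  simp only [fl, CPat.sz] at this
  omega

theorem fr_ne {n : ℕ} {s y z : CPat n} : fr s y z ≠ s := fun h => by
  have := congrArg CPat.sz h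
  simp only [fr, CPat.sz] at this
  omega

theorem fl_inj {n : ℕ} {s y z y' z' : CPat n} : fl s y z = fl s y' z' ↔ y = y' ∧ z = z' := by
  simp [fl]

theorem fr_inj {n : ℕ} {s y z y' z' : CPat n} : fr s y z = fr s y' z' ↔ y = y' ∧ z = z' := by
  simp [fr]

/-- The tags `s` and `s • s` have different sizes for every pattern `s`, so stacks stay readable
even if a context substitutes a compound for the reserved name. -/
theorem fl_ne_fr {n : ℕ} {s y z y' z' : CPat n} : fl s y z ≠ fr s y' z' := fun h => by
  simp only [fl, fr, CPat.comp.injEq] at h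
  have := congrArg CPat.sz h.1.1
  simp only [CPat.sz] at this
  omega

/-- `Plug s z u d`: putting `u` into the context represented by the stack `z` gives `d`. -/
inductive Plug {n : ℕ} (s : CPat n) : CPat n → CPat n → CPat n → Prop
  | nil (u : CPat n) : Plug s s u u
  | left {z x y d : CPat n} : Plug s z (.comp x y) d → Plug s (fl s y z) x d
  | right {z x y d : CPat n} : Plug s z (.comp y x) d → Plug s (fr s y z) x d

namespace Plug

variable {n : ℕ} {s k : CPat n}

theorem nil_inv {z u d : CPat n} (h : Plug s z u d) (hz : z = s) : u = d := by
  cases h with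
  | nil => rfl
  | left h => exact absurd hz fl_ne
  | right h => exact absurd hz fr_ne

theorem left_inv {z' z y u d : CPat n} (h : Plug s z' u d) (hz : z' = fl s y z) :
    Plug s z (.comp u y) d := by
  cases h with
  | nil => exact absurd hz.symm fl_ne
  | left h => obtain ⟨rfl, rfl⟩ := fl_inj.1 hz; exact h
  | right h => exact absurd hz.symm fl_ne_fr

theorem right_inv {z' z y u d : CPat n} (h : Plug s z' u d) (hz : z' = fr s y z) :
    Plug s z (.comp y u) d := by
  cases h with
  | nil => exact absurd hz.symm fr_ne
  | left h => exact absurd hz fl_ne_fr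
  | right h => obtain ⟨rfl, rfl⟩ := fr_inj.1 hz; exact h

theorem step {z u u' d : CPat n} (h : Plug s z u d) (hu : CStep s k u u') :
    ∃ d', Plug s z u' d' ∧ CStep s k d d' := by
  induction h generalizing u' with
  | nil u => exact ⟨u', .nil _, hu⟩
  | left _ ih => obtain ⟨d', h, hs⟩ := ih (.appL _ hu); exact ⟨d', .left h, hs⟩
  | right _ ih => obtain ⟨d', h, hs⟩ := ih (.appR _ hu); exact ⟨d', .right h, hs⟩

theorem subst {z u d : CPat n} (h : Plug s z u d) {m : ℕ} (θ : Var n → CPat m) :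
    Plug (s.subst θ) (z.subst θ) (u.subst θ) (d.subst θ) := by
  induction h with
  | nil u => exact .nil _
  | left _ ih => exact .left ih
  | right _ ih => exact .right ih

end Plug

/-! ### The abstract machine -/

/-- Private channels. -/
inductive Ch : Type
  | ev | tk | rk | rs | rep | go

/-- Threads of the machine: messages on private channels, the two offers on the public channel, the
receiver that restarts the machine and the receiver that commits to a reduct. -/
inductive Th (n : ℕ) : Type
  | msg (ch : Ch) (D : CPat n) : Th n
  | offer (d : CPat n) : Th n
  | withdraw (d x : CPat n) : Th n
  | restart : Th n
  | commit (d : CPat n) : Th n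

def Th.subst {n m : ℕ} (θ : Var n → CPat m) : Th n → Th m
  | .msg ch D => .msg ch (D.subst θ)
  | .offer d => .offer (d.subst θ)
  | .withdraw d x => .withdraw (d.subst θ) (x.subst θ)
  | .restart => .restart
  | .commit d => .commit (d.subst θ)

/-- Payload of a search message: the value `d` under search, the stack `z` and the pattern `u` now
at that position. Keeping `d` lets a commitment recognise reducts of its own value. -/
def pl {n : ℕ} (d z u : CPat n) : CPat n := .comp (.comp d z) u

/-- Start of the search for redexes below the position `u`. -/
def triple {n : ℕ} (d z u : CPat n) : List (Th n) :=
  [.msg .tk (pl d z u), .msg .rk (pl d z u), .msg .rs (pl d z u)]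

/-- The reactions of the servers. -/
inductive Fire {n : ℕ} (s k : CPat n) : Ch → CPat n → List (Th n) → Prop
  | ev (d : CPat n) : Fire s k .ev d (.offer d :: .commit d :: triple d s d)
  | tk (d z x y : CPat n) : Fire s k .tk (pl d z (.comp x y))
      (triple d (fl s y z) x ++ triple d (fr s x z) y)
  | rk (d z x y : CPat n) : Fire s k .rk (pl d z (.comp (.comp k x) y)) [.msg .rep (pl d z x)]
  | rs (d z x y w : CPat n) : Fire s k .rs (pl d z (.comp (.comp (.comp s x) y) w))
      [.msg .rep (pl d z (.comp (.comp x w) (.comp y w)))]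
  | left (d z x y : CPat n) : Fire s k .rep (pl d (fl s y z) x) [.msg .rep (pl d z (.comp x y))]
  | right (d z x y : CPat n) : Fire s k .rep (pl d (fr s y z) x) [.msg .rep (pl d z (.comp y x))]

/-- The steps of the machine. -/
inductive SStep {n : ℕ} (s k : CPat n) : List (Th n) → List (Th n) → Prop
  | fire {ch : Ch} {D : CPat n} {O L L₀ : List (Th n)} : L.Perm (.msg ch D :: L₀) →
      Fire s k ch D O → SStep s k L (O ++ L₀)
  | commit {d x : CPat n} {L L₀ : List (Th n)} :
      L.Perm (.msg .rep (pl d s x) :: .commit d :: L₀) → SStep s k L (.withdraw d x :: L₀)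
  | restart {x : CPat n} {L L₀ : List (Th n)} :
      L.Perm (.msg .go x :: .restart :: L₀) → SStep s k L (.msg .ev x :: L₀)
  | withdraw {d x : CPat n} {L L₀ : List (Th n)} :
      L.Perm (.offer d :: .withdraw d x :: L₀) → SStep s k L (.restart :: .msg .go x :: L₀)

/-- Search messages that speak the truth. -/
inductive GM {n : ℕ} (s k : CPat n) : Th n → Prop
  | tk {d z u : CPat n} : Plug s z u d → GM s k (.msg .tk (pl d z u))
  | rk {d z u : CPat n} : Plug s z u d → GM s k (.msg .rk (pl d z u))
  | rs {d z u : CPat n} : Plug s z u d → GM s k (.msg .rs (pl d z u))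
  | rep {d z u d' : CPat n} : Plug s z u d' → CStep s k d d' → GM s k (.msg .rep (pl d z u))

theorem GM.subst {n m : ℕ} {s k : CPat n} {t : Th n} (h : GM s k t) (θ : Var n → CPat m) :
    GM (s.subst θ) (k.subst θ) (t.subst θ) := by
  cases h with
  | tk h => exact .tk (h.subst θ)
  | rk h => exact .rk (h.subst θ)
  | rs h => exact .rs (h.subst θ)
  | rep h h' => exact .rep (h.subst θ) (h'.subst θ)

theorem GM.triple {n : ℕ} {s k d z u : CPat n} (h : Plug s z u d) : ∀ t ∈ triple d z u, GM s k t := by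
  intro t ht
  simp only [CPC.triple, List.mem_cons, List.not_mem_nil, or_false] at ht
  rcases ht with rfl | rfl | rfl
  · exact .tk h
  · exact .rk h
  · exact .rs h

theorem pl_inj {n : ℕ} {d z u d' z' u' : CPat n} :
    pl d z u = pl d' z' u' ↔ d = d' ∧ z = z' ∧ u = u' := by
  simp [pl, and_assoc]

theorem GM.rep_inv {n : ℕ} {s k d z u : CPat n} (h : GM s k (.msg .rep (pl d z u))) :
    ∃ d', Plug s z u d' ∧ CStep s k d d' := by
  generalize ht : Th.msg .rep (pl d z u) = t at h
  cases h <;> simp only [Th.msg.injEq, pl_inj, reduceCtorEq, false_and, true_and] at ht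
  obtain ⟨rfl, rfl, rfl⟩ := ht
  exact ⟨_, by assumption, by assumption⟩

theorem GM.search_inv {n : ℕ} {s k d z u : CPat n} {ch : Ch} (h : GM s k (.msg ch (pl d z u)))
    (hc : ch ≠ .rep) : Plug s z u d := by
  generalize ht : Th.msg ch (pl d z u) = t at h
  cases h <;> simp only [Th.msg.injEq, pl_inj] at ht <;> obtain ⟨rfl, rfl, rfl, rfl⟩ := ht
  · assumption
  · assumption
  · assumption
  · exact absurd rfl hc

/-- Descending and climbing keep the plugged pattern unchanged, and contracting at a position
rewrites the whole by closure under contexts. -/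
theorem Fire.good {n : ℕ} {s k D : CPat n} {ch : Ch} {O : List (Th n)} (h : Fire s k ch D O)
    (hg : GM s k (.msg ch D)) : ∀ t ∈ O, GM s k t := by
  cases h with
  | ev d => cases hg
  | tk d z x y =>
    have hp := hg.search_inv (by simp)
    intro t ht
    rcases List.mem_append.1 ht with ht | ht
    · exact GM.triple (.left hp) t ht
    · exact GM.triple (.right hp) t ht
  | rk d z x y =>
    obtain ⟨d', h, h'⟩ := (hg.search_inv (by simp)).step (.ruleK x y)
    simpa using GM.rep h h'
  | rs d z x y w =>
    obtain ⟨d', h, h'⟩ := (hg.search_inv (by simp)).step (.ruleS (k := k) x y w)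
    simpa using GM.rep h h'
  | left d z x y =>
    obtain ⟨d', h, h'⟩ := hg.rep_inv
    simpa using GM.rep (h.left_inv rfl) h'
  | right d z x y =>
    obtain ⟨d', h, h'⟩ := hg.rep_inv
    simpa using GM.rep (h.right_inv rfl) h'

/-! ### Weights -/

/-- Weight of a descent message. Each child is charged its own descent and two redex tests. -/
def wT {n : ℕ} (s : CPat n) : CPat n → CPat n → ℕ
  | .nm _, _ => 1
  | .comp x y, z => 1 + (wT s x (fl s y z) + 2 * ((fl s y z).sz + 2)) +
      (wT s y (fr s x z) + 2 * ((fr s x z).sz + 2))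

/-- A rebuilding message weighs the size of its stack, which shrinks as it climbs; a redex test
weighs more than the rebuilding message it can become. -/
def Th.wt {n : ℕ} (s : CPat n) : Th n → ℕ
  | .msg .tk (.comp (.comp _ z) u) => wT s u z
  | .msg .rk (.comp (.comp _ z) _) => z.sz + 2
  | .msg .rs (.comp (.comp _ z) _) => z.sz + 2
  | .msg .rep (.comp (.comp _ z) _) => z.sz
  | _ => 0

def wts {n : ℕ} (s : CPat n) (L : List (Th n)) : ℕ := (L.map (Th.wt s)).sum

theorem wts_perm {n : ℕ} {s : CPat n} {L L' : List (Th n)} (h : L.Perm L') : wts s L = wts s L' :=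
  (h.map _).sum_eq

theorem wts_cons {n : ℕ} (s : CPat n) (t : Th n) (L : List (Th n)) :
    wts s (t :: L) = t.wt s + wts s L := by simp [wts]

theorem wts_append {n : ℕ} (s : CPat n) (L L' : List (Th n)) :
    wts s (L ++ L') = wts s L + wts s L' := by simp [wts]

theorem wts_triple {n : ℕ} (s d z u : CPat n) :
    wts s (triple d z u) = wT s u z + 2 * (z.sz + 2) := by
  simp [wts, triple, Th.wt, pl]; omega

/-- Cost of evaluating `d` afresh: one server step and the search that it starts. It is added
separately by `Inv`, since `Th.wt` gives `ev` messages weight zero. -/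
def wev {n : ℕ} (s d : CPat n) : ℕ := 1 + (wT s d s + 2 * (s.sz + 2))

theorem Fire.wts_lt {n : ℕ} {s k D : CPat n} {ch : Ch} {O : List (Th n)} (h : Fire s k ch D O)
    (hc : ch ≠ .ev) : wts s O < (Th.msg ch D).wt s := by
  cases h with
  | ev d => exact absurd rfl hc
  | tk d z x y =>
    rw [wts_append, wts_triple, wts_triple]
    simp only [pl, Th.wt, wT]
    omega
  | rk d z x y => simp [wts, Th.wt, pl]
  | rs d z x y w => simp [wts, Th.wt, pl]
  | left d z x y => simp [wts, Th.wt, pl, fl, CPat.sz]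
  | right d z x y => simp [wts, Th.wt, pl, fr, CPat.sz]

/-! ### Coverage: every redex is found eventually -/

/-- `Cov s k d B ch z u`: the message `ch` at position `z`, `u` of `d` is in `B`, or was
in `B` and the messages that it leads to are covered. -/
inductive Cov {n : ℕ} (s k d : CPat n) (B : List (Th n)) : Ch → CPat n → CPat n → Prop
  | here {ch : Ch} {z u : CPat n} : .msg ch (pl d z u) ∈ B → Cov s k d B ch z u
  | tk {z x y : CPat n} : Cov s k d B .tk (fl s y z) x → Cov s k d B .rk (fl s y z) x →
      Cov s k d B .rs (fl s y z) x → Cov s k d B .tk (fr s x z) y →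
      Cov s k d B .rk (fr s x z) y → Cov s k d B .rs (fr s x z) y → Cov s k d B .tk z (.comp x y)
  | rk {z x : CPat n} (y : CPat n) : Cov s k d B .rep z x →
      Cov s k d B .rk z (.comp (.comp k x) y)
  | rs {z x y w : CPat n} : Cov s k d B .rep z (.comp (.comp x w) (.comp y w)) →
      Cov s k d B .rs z (.comp (.comp (.comp s x) y) w)
  | left {z x y : CPat n} : Cov s k d B .rep z (.comp x y) → Cov s k d B .rep (fl s y z) x
  | right {z x y : CPat n} : Cov s k d B .rep z (.comp y x) → Cov s k d B .rep (fr s y z) x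

theorem Cov.subst {n m : ℕ} {s k d : CPat n} {B : List (Th n)} {ch : Ch} {z u : CPat n}
    (h : Cov s k d B ch z u) (θ : Var n → CPat m) :
    Cov (s.subst θ) (k.subst θ) (d.subst θ) (B.map (Th.subst θ)) ch (z.subst θ) (u.subst θ) := by
  induction h with
  | here h => exact .here (List.mem_map_of_mem (f := Th.subst θ) h)
  | tk _ _ _ _ _ _ h1 h2 h3 h4 h5 h6 => exact .tk h1 h2 h3 h4 h5 h6
  | rk y _ ih => exact .rk _ ih
  | rs _ ih => exact .rs ih
  | left _ ih => exact .left ih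
  | right _ ih => exact .right ih

/-- Coverage is a tree with pending messages at the leaves, so replacing every leaf by a covering
tree preserves it. In this way coverage survives server reactions. -/
theorem Cov.bind {n : ℕ} {s k d : CPat n} {B B' : List (Th n)} {ch : Ch} {z u : CPat n}
    (h : Cov s k d B ch z u)
    (hB : ∀ ch z u, .msg ch (pl d z u) ∈ B → Cov s k d B' ch z u) : Cov s k d B' ch z u := by
  induction h with
  | here h => exact hB _ _ _ h
  | tk _ _ _ _ _ _ h1 h2 h3 h4 h5 h6 => exact .tk h1 h2 h3 h4 h5 h6
  | rk y _ ih => exact .rk _ ih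
  | rs _ ih => exact .rs ih
  | left _ ih => exact .left ih
  | right _ ih => exact .right ih

theorem Fire.cov {n : ℕ} {s k D : CPat n} {ch : Ch} {O : List (Th n)} (h : Fire s k ch D O)
    (hc : ch ≠ .ev) {d z u : CPat n} {B : List (Th n)} (hD : D = pl d z u) (hO : ∀ t ∈ O, t ∈ B) :
    Cov s k d B ch z u := by
  cases h with
  | ev d => exact absurd rfl hc
  | tk d z x y =>
    obtain ⟨rfl, rfl, rfl⟩ := pl_inj.1 hD
    simp only [triple, List.mem_append, List.mem_cons, List.not_mem_nil, or_false] at hO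
    exact .tk (.here (hO _ (by simp))) (.here (hO _ (by simp))) (.here (hO _ (by simp)))
      (.here (hO _ (by simp))) (.here (hO _ (by simp))) (.here (hO _ (by simp)))
  | rk d z x y =>
    obtain ⟨rfl, rfl, rfl⟩ := pl_inj.1 hD
    exact .rk y (.here (hO _ (by simp)))
  | rs d z x y w =>
    obtain ⟨rfl, rfl, rfl⟩ := pl_inj.1 hD
    exact .rs (.here (hO _ (by simp)))
  | left d z x y =>
    obtain ⟨rfl, rfl, rfl⟩ := pl_inj.1 hD
    exact .left (.here (hO _ (by simp)))
  | right d z x y =>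
    obtain ⟨rfl, rfl, rfl⟩ := pl_inj.1 hD
    exact .right (.here (hO _ (by simp)))

/-- The whole pattern is covered. -/
def Covers {n : ℕ} (s k d : CPat n) (B : List (Th n)) (z u : CPat n) : Prop :=
  Cov s k d B .tk z u ∧ Cov s k d B .rk z u ∧ Cov s k d B .rs z u

theorem Covers.triple {n : ℕ} {s k d : CPat n} {B : List (Th n)} {z u : CPat n}
    (h : ∀ t ∈ triple d z u, t ∈ B) : Covers s k d B z u :=
  ⟨.here (h _ (by simp [CPC.triple])), .here (h _ (by simp [CPC.triple])),
    .here (h _ (by simp [CPC.triple]))⟩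

/-- A step of a search message. -/
inductive FStep {n : ℕ} (s k : CPat n) : List (Th n) → List (Th n) → Prop
  | fire {ch : Ch} {D : CPat n} {O B B₀ : List (Th n)} : B.Perm (.msg ch D :: B₀) →
      Fire s k ch D O → ch ≠ .ev → FStep s k B (O ++ B₀)

namespace FStep

variable {n : ℕ} {s k : CPat n} {B B' : List (Th n)}

theorem good (h : FStep s k B B') (hg : ∀ t ∈ B, GM s k t) : ∀ t ∈ B', GM s k t := by
  cases h with
  | fire hp hf hc =>
    have hg' : ∀ t ∈ Th.msg _ _ :: _, GM s k t := fun t ht => hg t (hp.mem_iff.2 ht)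
    intro t ht
    rcases List.mem_append.1 ht with ht | ht
    · exact hf.good (hg' _ (by simp)) t ht
    · exact hg' t (by simp [ht])

theorem wts_lt (h : FStep s k B B') : wts s B' < wts s B := by
  cases h with
  | fire hp hf hc =>
    rw [wts_perm hp, wts_append, wts_cons]
    have := hf.wts_lt hc
    omega

theorem cov (h : FStep s k B B') {d : CPat n} {ch : Ch} {z u : CPat n}
    (hc : Cov s k d B ch z u) : Cov s k d B' ch z u := by
  cases h with
  | fire hp hf he =>
    refine hc.bind fun ch z u hm => ?_
    rcases List.mem_cons.1 (hp.mem_iff.1 hm) with h | h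
    · simp only [Th.msg.injEq] at h
      obtain ⟨rfl, h⟩ := h
      exact hf.cov he h.symm fun t ht => by simp [ht]
    · exact .here (by simp [h])

theorem covers (h : FStep s k B B') {d : CPat n} {z u : CPat n}
    (hc : Covers s k d B z u) : Covers s k d B' z u := ⟨h.cov hc.1, h.cov hc.2.1, h.cov hc.2.2⟩

end FStep

abbrev FSteps {n : ℕ} (s k : CPat n) : List (Th n) → List (Th n) → Prop :=
  Relation.ReflTransGen (FStep s k)

theorem FSteps.good {n : ℕ} {s k : CPat n} {B B' : List (Th n)} (h : FSteps s k B B')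
    (hg : ∀ t ∈ B, GM s k t) : ∀ t ∈ B', GM s k t := by
  induction h with
  | refl => exact hg
  | tail _ h ih => exact h.good ih

theorem exists_perm_of_mem {α : Type*} {a : α} {l : List α} (h : a ∈ l) : ∃ l', l.Perm (a :: l') := by
  obtain ⟨l1, l2, rfl⟩ := List.append_of_mem h
  exact ⟨l1 ++ l2, List.perm_middle⟩

theorem fire_mem {n : ℕ} {s k : CPat n} {B : List (Th n)} {ch : Ch} {D : CPat n} {O : List (Th n)}
    (h : .msg ch D ∈ B) (hf : Fire s k ch D O) (hc : ch ≠ .ev) :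
    ∃ B', FStep s k B B' ∧ ∀ t ∈ O, t ∈ B' := by
  obtain ⟨B0, hp⟩ := exists_perm_of_mem h
  exact ⟨_, .fire hp hf hc, fun t ht => by simp [ht]⟩

/-- The stack is popped frame by frame until it is `s`; at each level the rebuilding servers follow
the derivation of `Plug`. -/
theorem find_rep {n : ℕ} {s k d : CPat n} {z u x : CPat n} (hp : Plug s z u x) :
    ∀ {B : List (Th n)}, .msg .rep (pl d z u) ∈ B →
      ∃ B', FSteps s k B B' ∧ .msg .rep (pl d s x) ∈ B' := by
  induction hp with
  | nil u => intro B h; exact ⟨B, .refl, h⟩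
  | left _ ih =>
    intro B h
    obtain ⟨B1, h1, h2⟩ := fire_mem h (.left _ _ _ _) (by simp)
    obtain ⟨B2, h3, h4⟩ := ih (h2 _ (by simp))
    exact ⟨B2, .head h1 h3, h4⟩
  | right _ ih =>
    intro B h
    obtain ⟨B1, h1, h2⟩ := fire_mem h (.right _ _ _ _) (by simp)
    obtain ⟨B2, h3, h4⟩ := ih (h2 _ (by simp))
    exact ⟨B2, .head h1 h3, h4⟩

theorem find_cov_rep {n : ℕ} {s k d : CPat n} {B : List (Th n)} {ch : Ch} {z u : CPat n}
    (h : Cov s k d B ch z u) : ch = .rep → ∀ {x : CPat n}, Plug s z u x →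
      ∃ B', FSteps s k B B' ∧ .msg .rep (pl d s x) ∈ B' := by
  induction h with
  | here h => rintro rfl x hp; exact find_rep hp h
  | tk => rintro ⟨⟩
  | rk => rintro ⟨⟩
  | rs => rintro ⟨⟩
  | left _ ih => intro _ x hp; exact ih rfl (hp.left_inv rfl)
  | right _ ih => intro _ x hp; exact ih rfl (hp.right_inv rfl)

/-- The derivation of the rewrite step gives the path: descend towards the redex, test there, and
climb back. At each stage coverage offers two cases: the message is still pending and can be fired,
or it was fired earlier and its consequences are covered. -/
theorem find_step {n : ℕ} {s k d : CPat n} {u u' : CPat n} (h : CStep s k u u') :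
    ∀ {B : List (Th n)} {z x : CPat n}, Covers s k d B z u → Plug s z u' x →
      ∃ B', FSteps s k B B' ∧ .msg .rep (pl d s x) ∈ B' := by
  induction h with
  | ruleS x y w =>
    rintro B z d' ⟨-, -, h⟩ hp
    generalize hu : CPat.comp (.comp (.comp s x) y) w = u at h
    cases h with
    | here h =>
      subst hu
      obtain ⟨B1, h1, h2⟩ := fire_mem (s := s) (k := k) h (.rs _ _ _ _ _) (by simp)
      obtain ⟨B2, h3, h4⟩ := find_rep (k := k) (d := d) hp (h2 _ (by simp))
      exact ⟨B2, .head h1 h3, h4⟩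
    | rs h =>
      simp only [CPat.comp.injEq, true_and] at hu
      obtain ⟨⟨rfl, rfl⟩, rfl⟩ := hu
      exact find_cov_rep h rfl hp
  | ruleK x y =>
    rintro B z d' ⟨-, h, -⟩ hp
    generalize hu : CPat.comp (.comp k x) y = u at h
    cases h with
    | here h =>
      subst hu
      obtain ⟨B1, h1, h2⟩ := fire_mem (s := s) (k := k) h (.rk _ _ _ _) (by simp)
      obtain ⟨B2, h3, h4⟩ := find_rep (k := k) (d := d) hp (h2 _ (by simp))
      exact ⟨B2, .head h1 h3, h4⟩
    | rk _ h =>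
      simp only [CPat.comp.injEq, true_and] at hu
      obtain ⟨rfl, rfl⟩ := hu
      exact find_cov_rep h rfl hp
  | appL y _ ih =>
    rintro B z d' ⟨h, -, -⟩ hp
    cases h with
    | here h =>
      obtain ⟨B1, h1, h2⟩ := fire_mem (s := s) (k := k) h (.tk _ _ _ _) (by simp)
      obtain ⟨B2, h3, h4⟩ := ih (B := B1) (Covers.triple fun t ht => h2 _ (by simp [ht])) hp.left
      exact ⟨B2, .head h1 h3, h4⟩
    | tk h1 h2 h3 => exact ih ⟨h1, h2, h3⟩ hp.left
  | appR y _ ih =>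
    rintro B z d' ⟨h, -, -⟩ hp
    cases h with
    | here h =>
      obtain ⟨B1, h1, h2⟩ := fire_mem (s := s) (k := k) h (.tk _ _ _ _) (by simp)
      obtain ⟨B2, h3, h4⟩ := ih (B := B1) (Covers.triple fun t ht => h2 _ (by simp [ht])) hp.right
      exact ⟨B2, .head h1 h3, h4⟩
    | tk _ _ _ h1 h2 h3 => exact ih ⟨h1, h2, h3⟩ hp.right

/-! ### Abstract states -/

/-- The states of the machine as seen by its environment. -/
inductive Ab (n : ℕ) : Type
  | live (d : CPat n) : Ab n
  | com (d x : CPat n) : Ab n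
  | half (d : CPat n) : Ab n
  | halfCom (d x : CPat n) : Ab n

namespace Ab

def val {n : ℕ} : Ab n → CPat n
  | .live d => d
  | .com d _ => d
  | .half d => d
  | .halfCom d _ => d

def Fresh {n : ℕ} : Ab n → Prop
  | .live _ => True
  | .com _ _ => True
  | .half _ => False
  | .halfCom _ _ => False

def subst {n m : ℕ} (θ : Var n → CPat m) : Ab n → Ab m
  | .live d => .live (d.subst θ)
  | .com d x => .com (d.subst θ) (x.subst θ)
  | .half d => .half (d.subst θ)
  | .halfCom d x => .halfCom (d.subst θ) (x.subst θ)

/-- Internal steps. -/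
inductive Tau {n : ℕ} (s k : CPat n) : Ab n → Ab n → Prop
  | commit {d x : CPat n} : CStep s k d x → Tau s k (.live d) (.com d x)
  | withdraw (d x : CPat n) : Tau s k (.com d x) (.live x)
  | half {d x : CPat n} : CStep s k d x → Tau s k (.half d) (.halfCom d x)

/-- Outputs of the current value. -/
inductive Out {n : ℕ} : Ab n → CPat n → Ab n → Prop
  | live (d : CPat n) : Out (.live d) d (.half d)
  | com (d x : CPat n) : Out (.com d x) d (.halfCom d x)
  | halfCom (d x : CPat n) : Out (.halfCom d x) d (.live x)

end Ab

/-- `Inv s k ι N L`: the soup `L` of weight `N` is in state `ι`. -/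
inductive Inv {n : ℕ} (s k : CPat n) : Ab n → ℕ → List (Th n) → Prop
  | ev {d : CPat n} {L B : List (Th n)} : L.Perm (.msg .ev d :: B) → (∀ t ∈ B, GM s k t) →
      Inv s k (.live d) (wev s d + wts s B) L
  | offer {d : CPat n} {L B : List (Th n)} : L.Perm (.offer d :: .commit d :: B) →
      (∀ t ∈ B, GM s k t) → Covers s k d B s d → Inv s k (.live d) (wts s B) L
  | go {d : CPat n} {L B : List (Th n)} : L.Perm (.restart :: .msg .go d :: B) →
      (∀ t ∈ B, GM s k t) → Inv s k (.live d) (1 + wev s d + wts s B) L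
  | com {d x : CPat n} {L B : List (Th n)} : L.Perm (.offer d :: .withdraw d x :: B) →
      (∀ t ∈ B, GM s k t) → CStep s k d x → Inv s k (.com d x) (wts s B) L
  | half {d : CPat n} {L B : List (Th n)} : L.Perm (.restart :: .commit d :: B) →
      (∀ t ∈ B, GM s k t) → Covers s k d B s d → Inv s k (.half d) (wts s B) L
  | halfCom {d x : CPat n} {L B : List (Th n)} : L.Perm (.restart :: .withdraw d x :: B) →
      (∀ t ∈ B, GM s k t) → CStep s k d x → Inv s k (.halfCom d x) (wts s B) L
  | halfGo {d x : CPat n} {L B : List (Th n)} : L.Perm (.offer d :: .msg .go x :: B) →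
      (∀ t ∈ B, GM s k t) → CStep s k d x → Inv s k (.halfCom d x) (wts s B) L

theorem Perm_cons_inv {α : Type*} {m x : α} {L₀ L₁ : List α} (h : (m :: L₀).Perm (x :: L₁)) :
    (m = x ∧ L₀.Perm L₁) ∨ ∃ L₂, L₁.Perm (m :: L₂) ∧ L₀.Perm (x :: L₂) := by
  by_cases hm : m = x
  · subst hm; exact .inl ⟨rfl, h.cons_inv⟩
  · have hmem : m ∈ L₁ := by
      have := h.mem_iff.1 (List.mem_cons_self (a := m))
      simpa [hm] using this
    obtain ⟨L2, hL⟩ := exists_perm_of_mem hmem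
    refine .inr ⟨L2, hL, ?_⟩
    have : (m :: L₀).Perm (m :: x :: L2) := h.trans ((hL.cons x).trans (.swap _ _ _))
    exact this.cons_inv

/-- `L` emits `d` on the public channel and becomes `L'`. -/
inductive Emit {n : ℕ} : List (Th n) → CPat n → List (Th n) → Prop
  | offer {d : CPat n} {L L₀ : List (Th n)} : L.Perm (.offer d :: L₀) → Emit L d (.restart :: L₀)
  | withdraw {d x : CPat n} {L L₀ : List (Th n)} :
      L.Perm (.withdraw d x :: L₀) → Emit L d (.msg .go x :: L₀)

abbrev SSteps {n : ℕ} (s k : CPat n) : List (Th n) → List (Th n) → Prop :=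
  Relation.ReflTransGen (SStep s k)

theorem FStep.lift {n : ℕ} {s k : CPat n} {B B' : List (Th n)} (h : FStep s k B B')
    {t u : Th n} {L : List (Th n)} (hL : L.Perm (t :: u :: B)) :
    ∃ L', SStep s k L L' ∧ L'.Perm (t :: u :: B') := by
  cases h with
  | @fire ch D O _ B0 hp hf hc =>
    refine ⟨_, .fire (L₀ := t :: u :: B0) (hL.trans ?_) hf, ?_⟩
    · refine .trans (((hp.cons u).trans (.swap _ _ _)).cons t) (.swap _ _ _)
    · refine .trans List.perm_middle (List.Perm.cons t ?_)
      exact List.perm_middle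

theorem FSteps.lift {n : ℕ} {s k : CPat n} {B B' : List (Th n)} (h : FSteps s k B B')
    {t u : Th n} {L : List (Th n)} (hL : L.Perm (t :: u :: B)) :
    ∃ L', SSteps s k L L' ∧ L'.Perm (t :: u :: B') := by
  induction h with
  | refl => exact ⟨L, .refl, hL⟩
  | tail _ h ih =>
    obtain ⟨L1, h1, h2⟩ := ih
    obtain ⟨L2, h3, h4⟩ := h.lift h2
    exact ⟨L2, h1.tail h3, h4⟩

theorem GM.not_offer {n : ℕ} {s k d : CPat n} : ¬ GM s k (.offer d) := fun h => by cases h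

theorem GM.not_withdraw {n : ℕ} {s k d x : CPat n} : ¬ GM s k (.withdraw d x) := fun h => by cases h

theorem GM.not_restart {n : ℕ} {s k : CPat n} : ¬ GM s k .restart := fun h => by cases h

theorem GM.not_commit {n : ℕ} {s k d : CPat n} : ¬ GM s k (.commit d) := fun h => by cases h

theorem GM.not_ev {n : ℕ} {s k d : CPat n} : ¬ GM s k (.msg .ev d) := fun h => by cases h

theorem GM.not_go {n : ℕ} {s k d : CPat n} : ¬ GM s k (.msg .go d) := fun h => by cases h

theorem good_perm {n : ℕ} {s k : CPat n} {B B' : List (Th n)} (hg : ∀ t ∈ B, GM s k t)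
    (h : B.Perm B') : ∀ t ∈ B', GM s k t := fun t ht => hg t (h.mem_iff.2 ht)

theorem good_head {n : ℕ} {s k : CPat n} {t : Th n} {B B' : List (Th n)}
    (hg : ∀ t ∈ B, GM s k t) (h : B.Perm (t :: B')) : GM s k t := hg t (h.mem_iff.2 (by simp))

/-- A soup with two control threads and search messages. -/
theorem split_two {n : ℕ} {t u m : Th n} {L B L₀ : List (Th n)}
    (hL : L.Perm (t :: u :: B)) (h : L.Perm (m :: L₀)) :
    (m = t ∧ L₀.Perm (u :: B)) ∨ (m = u ∧ L₀.Perm (t :: B)) ∨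
      ∃ B₀, B.Perm (m :: B₀) ∧ L₀.Perm (t :: u :: B₀) := by
  rcases Perm_cons_inv (h.symm.trans hL) with h | ⟨L2, h1, h2⟩
  · exact .inl h
  · rcases Perm_cons_inv h1.symm with ⟨rfl, h3⟩ | ⟨L3, h3, h4⟩
    · exact .inr (.inl ⟨rfl, h2.trans (h3.cons t)⟩)
    · exact .inr (.inr ⟨L3, h3, h2.trans (h4.cons t)⟩)

theorem fire_B {n : ℕ} {s k D : CPat n} {ch : Ch} {O B B₀ : List (Th n)}
    (hg : ∀ t ∈ B, GM s k t) (hp : B.Perm (.msg ch D :: B₀)) (hf : Fire s k ch D O) :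
    FStep s k B (O ++ B₀) := by
  refine .fire hp hf ?_
  rintro rfl
  exact GM.not_ev (good_head hg hp)

/-- How the control threads `t`, `u` and the messages `B` can move. -/
theorem SStep.two {n : ℕ} {s k : CPat n} {t u : Th n} {L L' B : List (Th n)}
    (hL : L.Perm (t :: u :: B)) (hg : ∀ t ∈ B, GM s k t)
    (ht : ∀ d, t ≠ .msg .ev d) (ht' : ∀ d, t ≠ .msg .rep d)
    (hu : ∀ d, u ≠ .msg .ev d) (hu' : ∀ d, u ≠ .msg .rep d)
    (hs : ∀ ch D, t = .msg ch D → ch = .go) (hs' : ∀ ch D, u = .msg ch D → ch = .go)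
    (h : SStep s k L L') :
    (∃ B', FStep s k B B' ∧ L'.Perm (t :: u :: B')) ∨
    (∃ d x B₀, B.Perm (.msg .rep (pl d s x) :: B₀) ∧
      ((t = .commit d ∧ L'.Perm (.withdraw d x :: u :: B₀)) ∨
        (u = .commit d ∧ L'.Perm (.withdraw d x :: t :: B₀)))) ∨
    (∃ x, ((t = .msg .go x ∧ u = .restart) ∨ (u = .msg .go x ∧ t = .restart)) ∧
      L'.Perm (.msg .ev x :: B)) ∨
    (∃ d x, ((t = .offer d ∧ u = .withdraw d x) ∨ (u = .offer d ∧ t = .withdraw d x)) ∧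
      L'.Perm (.restart :: .msg .go x :: B)) := by
  cases h with
  | @fire ch D O _ L0 hp hf =>
    have hgo : ∀ {O D}, ¬ Fire s k .go D O := fun h => by cases h
    rcases split_two hL hp with ⟨rfl, -⟩ | ⟨rfl, -⟩ | ⟨B0, h1, h2⟩
    · obtain rfl := hs _ _ rfl; exact absurd hf hgo
    · obtain rfl := hs' _ _ rfl; exact absurd hf hgo
    · refine .inl ⟨_, fire_B hg h1 hf, (h2.append_left O).trans ?_⟩
      exact List.perm_middle.trans (List.Perm.cons t List.perm_middle)
  | @commit d x _ L0 hp =>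
    rcases split_two hL hp with ⟨rfl, -⟩ | ⟨rfl, -⟩ | ⟨B0, h1, h2⟩
    · exact absurd rfl (ht' _)
    · exact absurd rfl (hu' _)
    · refine .inr (.inl ⟨d, x, B0, h1, ?_⟩)
      rcases split_two h2 (.refl _) with h | h | ⟨B1, h3, h4⟩
      · exact .inl ⟨h.1.symm, h.2.cons _⟩
      · exact .inr ⟨h.1.symm, h.2.cons _⟩
      · exact absurd (hg _ (h1.mem_iff.2 (List.mem_cons_of_mem _ (h3.mem_iff.2 List.mem_cons_self)))) GM.not_commit
  | @restart x _ L0 hp =>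
    refine .inr (.inr (.inl ⟨x, ?_⟩))
    rcases split_two hL hp with ⟨rfl, h⟩ | ⟨rfl, h⟩ | ⟨B0, h1, h2⟩
    · rcases Perm_cons_inv h with ⟨rfl, h5⟩ | ⟨B1, h3, h4⟩
      · exact ⟨.inl ⟨rfl, rfl⟩, h5.cons _⟩
      · exact absurd (good_head hg h3) GM.not_restart
    · rcases Perm_cons_inv h with ⟨rfl, h5⟩ | ⟨B1, h3, h4⟩
      · exact ⟨.inr ⟨rfl, rfl⟩, h5.cons _⟩
      · exact absurd (good_head hg h3) GM.not_restart
    · exact absurd (good_head hg h1) GM.not_go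
  | @withdraw d x _ L0 hp =>
    refine .inr (.inr (.inr ⟨d, x, ?_⟩))
    rcases split_two hL hp with ⟨rfl, h⟩ | ⟨rfl, h⟩ | ⟨B0, h1, h2⟩
    · rcases Perm_cons_inv h with ⟨rfl, h5⟩ | ⟨B1, h3, h4⟩
      · exact ⟨.inl ⟨rfl, rfl⟩, (h5.cons _).cons _⟩
      · exact absurd (good_head hg h3) GM.not_withdraw
    · rcases Perm_cons_inv h with ⟨rfl, h5⟩ | ⟨B1, h3, h4⟩
      · exact ⟨.inr ⟨rfl, rfl⟩, (h5.cons _).cons _⟩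
      · exact absurd (good_head hg h3) GM.not_withdraw
    · exact absurd (good_head hg h1) GM.not_offer

/-- How the control threads `t`, `u` can emit. -/
theorem Emit.two {n : ℕ} {s k : CPat n} {t u : Th n} {L L' B : List (Th n)} {d : CPat n}
    (hL : L.Perm (t :: u :: B)) (hg : ∀ t ∈ B, GM s k t) (h : Emit L d L') :
    (t = .offer d ∧ L'.Perm (.restart :: u :: B)) ∨ (u = .offer d ∧ L'.Perm (.restart :: t :: B)) ∨
    (∃ x, t = .withdraw d x ∧ L'.Perm (.msg .go x :: u :: B)) ∨
    (∃ x, u = .withdraw d x ∧ L'.Perm (.msg .go x :: t :: B)) := by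
  cases h with
  | offer hp =>
    rcases split_two hL hp with ⟨rfl, h⟩ | ⟨rfl, h⟩ | ⟨B0, h1, h2⟩
    · exact .inl ⟨rfl, h.cons _⟩
    · exact .inr (.inl ⟨rfl, h.cons _⟩)
    · exact absurd (good_head hg h1) GM.not_offer
  | withdraw hp =>
    rcases split_two hL hp with ⟨rfl, h⟩ | ⟨rfl, h⟩ | ⟨B0, h1, h2⟩
    · exact .inr (.inr (.inl ⟨_, rfl, h.cons _⟩))
    · exact .inr (.inr (.inr ⟨_, rfl, h.cons _⟩))
    · exact absurd (good_head hg h1) GM.not_withdraw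

theorem two_control {n : ℕ} {s k : CPat n} {t u m m' : Th n} {L L₀ B : List (Th n)}
    (hL : L.Perm (t :: u :: B)) (hg : ∀ t ∈ B, GM s k t) (h : L.Perm (m :: m' :: L₀))
    (hm : ¬ GM s k m) (hm' : ¬ GM s k m') : (m = t ∧ m' = u) ∨ (m = u ∧ m' = t) := by
  rcases split_two hL h with ⟨rfl, h⟩ | ⟨rfl, h⟩ | ⟨B0, h1, h2⟩
  · rcases Perm_cons_inv h with ⟨rfl, -⟩ | ⟨B1, h3, -⟩
    · exact .inl ⟨rfl, rfl⟩
    · exact absurd (good_head hg h3) hm'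
  · rcases Perm_cons_inv h with ⟨rfl, -⟩ | ⟨B1, h3, -⟩
    · exact .inr ⟨rfl, rfl⟩
    · exact absurd (good_head hg h3) hm'
  · exact absurd (good_head hg h1) hm

namespace Inv

variable {n : ℕ} {s k : CPat n} {ι : Ab n} {N : ℕ} {L : List (Th n)}

theorem subst (h : Inv s k ι N L) {m : ℕ} (θ : Var n → CPat m) :
    ∃ N', Inv (s.subst θ) (k.subst θ) (ι.subst θ) N' (L.map (Th.subst θ)) := by
  have hg : ∀ {B : List (Th n)}, (∀ t ∈ B, GM s k t) →
      ∀ t ∈ B.map (Th.subst θ), GM (s.subst θ) (k.subst θ) t := by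
    intro B hB t ht
    obtain ⟨t', ht', rfl⟩ := List.mem_map.1 ht
    exact (hB t' ht').subst θ
  have hc : ∀ {B : List (Th n)} {d : CPat n}, Covers s k d B s d →
      Covers (s.subst θ) (k.subst θ) (d.subst θ) (B.map (Th.subst θ)) (s.subst θ) (d.subst θ) :=
    fun h => ⟨h.1.subst θ, h.2.1.subst θ, h.2.2.subst θ⟩
  cases h with
  | ev h h1 => exact ⟨_, .ev (h.map (Th.subst θ)) (hg h1)⟩
  | offer h h1 h2 => exact ⟨_, .offer (h.map (Th.subst θ)) (hg h1) (hc h2)⟩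
  | go h h1 => exact ⟨_, .go (h.map (Th.subst θ)) (hg h1)⟩
  | com h h1 h2 => exact ⟨_, .com (h.map (Th.subst θ)) (hg h1) (h2.subst θ)⟩
  | half h h1 h2 => exact ⟨_, .half (h.map (Th.subst θ)) (hg h1) (hc h2)⟩
  | halfCom h h1 h2 => exact ⟨_, .halfCom (h.map (Th.subst θ)) (hg h1) (h2.subst θ)⟩
  | halfGo h h1 h2 => exact ⟨_, .halfGo (h.map (Th.subst θ)) (hg h1) (h2.subst θ)⟩

theorem triple_good (d : CPat n) : ∀ t ∈ triple d s d, GM s k t := GM.triple (.nil d)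

/-- Truthfulness of the consumed message, whose stack is empty, says that `x` is a reduct of `d`.
The weight drops because a rebuilding message with stack `s` has positive weight. -/
theorem commit_step {d d' x : CPat n} {B B₀ : List (Th n)} (hg : ∀ t ∈ B, GM s k t)
    (hp : B.Perm (.msg .rep (pl d s x) :: B₀)) (hd : Th.commit d' = .commit d) :
    d' = d ∧ CStep s k d x ∧ wts s B₀ < wts s B ∧ ∀ t ∈ B₀, GM s k t := by
  simp only [Th.commit.injEq] at hd
  obtain ⟨d1, h1, h2⟩ := (good_head hg hp).rep_inv
  obtain rfl := h1.nil_inv rfl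
  refine ⟨hd, h2, ?_, fun t ht => good_perm hg hp t (by simp [ht])⟩
  rw [wts_perm hp, wts_cons]
  have := s.sz_pos
  simp only [pl, Th.wt]
  omega

/-- Steps of the machine are steps of the abstract state. -/
theorem tau (h : Inv s k ι N L) {L' : List (Th n)} (hs : SStep s k L L') :
    ∃ ι' N', Inv s k ι' N' L' ∧ ((ι' = ι ∧ N' < N) ∨ (Ab.Tau s k ι ι' ∧
      ((ι.val = ι'.val ∧ N' < N) ∨ (ι.Fresh ∧ CStep s k ι.val ι'.val)))) := by
  cases h with
  | @ev d _ B h h1 =>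
    cases hs with
    | @fire ch D O _ L0 hp hf =>
      rcases Perm_cons_inv (hp.symm.trans h) with ⟨e, h2⟩ | ⟨B0, h2, h3⟩
      · simp only [Th.msg.injEq] at e
        obtain ⟨rfl, rfl⟩ := e
        cases hf with
        | ev =>
          refine ⟨_, _, .offer (B := triple D s D ++ L0) (.refl _) ?_ (.triple fun t ht => by simp [ht]),
            .inl ⟨rfl, ?_⟩⟩
          · intro t ht
            rcases List.mem_append.1 ht with ht | ht
            · exact triple_good _ t ht
            · exact good_perm h1 h2.symm t ht
          · rw [wts_append, wts_triple, wts_perm h2, wev]; omega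
      · have hF := fire_B h1 h2 hf
        refine ⟨_, _, .ev (B := O ++ B0) ((h3.append_left O).trans List.perm_middle) (hF.good h1),
          .inl ⟨rfl, ?_⟩⟩
        have := hF.wts_lt; omega
    | commit hp =>
      rcases Perm_cons_inv (hp.symm.trans h) with ⟨e, h2⟩ | ⟨B0, h2, h3⟩
      · simp at e
      · rcases Perm_cons_inv h3 with ⟨e, h4⟩ | ⟨B1, h4, h5⟩
        · simp at e
        · exact absurd (h1 _ (h2.mem_iff.2 (List.mem_cons_of_mem _ (h4.mem_iff.2 List.mem_cons_self)))) GM.not_commit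
    | restart hp =>
      rcases Perm_cons_inv (hp.symm.trans h) with ⟨e, h2⟩ | ⟨B0, h2, h3⟩
      · simp at e
      · exact absurd (good_head h1 h2) GM.not_go
    | withdraw hp =>
      rcases Perm_cons_inv (hp.symm.trans h) with ⟨e, h2⟩ | ⟨B0, h2, h3⟩
      · simp at e
      · exact absurd (good_head h1 h2) GM.not_offer
  | @offer d _ B h h1 h2 =>
    rcases hs.two h h1 (by simp) (by simp) (by simp) (by simp) (by simp) (by simp) with
      ⟨B', hF, hL⟩ | ⟨d', x, B0, hp, h | h⟩ | ⟨x, h, h'⟩ | ⟨d', x, h, h'⟩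
    · exact ⟨_, _, .offer hL (hF.good h1) (hF.covers h2), .inl ⟨rfl, hF.wts_lt⟩⟩
    · simp at h
    · obtain ⟨rfl, hc, hw, hg⟩ := commit_step h1 hp h.1
      exact ⟨_, _, .com (h.2.trans (.swap _ _ _)) hg hc, .inr ⟨.commit hc, .inl ⟨rfl, hw⟩⟩⟩
    · simp at h
    · simp at h
  | @go d _ B h h1 =>
    rcases hs.two h h1 (by simp) (by simp) (by simp) (by simp) (by simp)
      (fun _ _ e => by cases e; rfl) with
      ⟨B', hF, hL⟩ | ⟨d', x, B0, hp, h | h⟩ | ⟨x, h, h'⟩ | ⟨d', x, h, h'⟩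
    · refine ⟨_, _, .go hL (hF.good h1), .inl ⟨rfl, ?_⟩⟩
      have := hF.wts_lt; omega
    · simp at h
    · simp at h
    · obtain ⟨e, -⟩ | ⟨e, -⟩ := h
      · simp at e
      · cases e
        refine ⟨_, _, .ev h' h1, .inl ⟨rfl, by omega⟩⟩
    · simp at h
  | @com d x _ B h h1 h2 =>
    rcases hs.two h h1 (by simp) (by simp) (by simp) (by simp) (by simp) (by simp) with
      ⟨B', hF, hL⟩ | ⟨d', x, B0, hp, h | h⟩ | ⟨x, h, h'⟩ | ⟨d', x, h, h'⟩
    · exact ⟨_, _, .com hL (hF.good h1) h2, .inl ⟨rfl, hF.wts_lt⟩⟩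
    · simp at h
    · simp at h
    · simp at h
    · obtain ⟨e, e'⟩ | ⟨e, -⟩ := h
      · cases e; cases e'
        -- This is the only internal step that changes the value. The weight may grow here, and the
        -- reduction from `d` to `x` pays for it.
        exact ⟨_, _, .go h' h1, .inr ⟨.withdraw _ _, .inr ⟨trivial, h2⟩⟩⟩
      · simp at e
  | @half d _ B h h1 h2 =>
    rcases hs.two h h1 (by simp) (by simp) (by simp) (by simp) (by simp) (by simp) with
      ⟨B', hF, hL⟩ | ⟨d', x, B0, hp, h | h⟩ | ⟨x, h, h'⟩ | ⟨d', x, h, h'⟩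
    · exact ⟨_, _, .half hL (hF.good h1) (hF.covers h2), .inl ⟨rfl, hF.wts_lt⟩⟩
    · simp at h
    · obtain ⟨rfl, hc, hw, hg⟩ := commit_step h1 hp h.1
      exact ⟨_, _, .halfCom (h.2.trans (.swap _ _ _)) hg hc, .inr ⟨.half hc, .inl ⟨rfl, hw⟩⟩⟩
    · simp at h
    · simp at h
  | @halfCom d x _ B h h1 h2 =>
    rcases hs.two h h1 (by simp) (by simp) (by simp) (by simp) (by simp) (by simp) with
      ⟨B', hF, hL⟩ | ⟨d', x, B0, hp, h | h⟩ | ⟨x, h, h'⟩ | ⟨d', x, h, h'⟩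
    · exact ⟨_, _, .halfCom hL (hF.good h1) h2, .inl ⟨rfl, hF.wts_lt⟩⟩
    · simp at h
    · simp at h
    · simp at h
    · simp at h
  | @halfGo d x _ B h h1 h2 =>
    rcases hs.two h h1 (by simp) (by simp) (by simp) (by simp) (by simp)
      (fun _ _ e => by cases e; rfl) with
      ⟨B', hF, hL⟩ | ⟨d', x, B0, hp, h | h⟩ | ⟨x, h, h'⟩ | ⟨d', x, h, h'⟩
    · exact ⟨_, _, .halfGo hL (hF.good h1) h2, .inl ⟨rfl, hF.wts_lt⟩⟩
    · simp at h
    · simp at h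
    · simp at h
    · simp at h

/-- Every live machine reaches the state in which it offers its value. -/
theorem to_offer {d : CPat n} (h : Inv s k (.live d) N L) : ∃ L' B, SSteps s k L L' ∧
    L'.Perm (.offer d :: .commit d :: B) ∧ (∀ t ∈ B, GM s k t) ∧ Covers s k d B s d := by
  have ev : ∀ {L B : List (Th n)}, L.Perm (.msg .ev d :: B) → (∀ t ∈ B, GM s k t) →
      ∃ L' B, SSteps s k L L' ∧
        L'.Perm (.offer d :: .commit d :: B) ∧ (∀ t ∈ B, GM s k t) ∧ Covers s k d B s d := by
    intro L B h h1
    refine ⟨_, triple d s d ++ B, .single (.fire h (.ev d)), .refl _, ?_,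
      .triple fun t ht => by simp [ht]⟩
    intro t ht
    rcases List.mem_append.1 ht with ht | ht
    · exact triple_good _ t ht
    · exact h1 t ht
  cases h with
  | ev h h1 => exact ev h h1
  | offer h h1 h2 => exact ⟨L, _, .refl, h, h1, h2⟩
  | go h h1 =>
    obtain ⟨L', B, h2, h3⟩ := ev (L := .msg .ev d :: _) (.refl _) h1
    exact ⟨L', B, .head (.restart (h.trans (.swap _ _ _))) h2, h3⟩

/-- The other control thread `t` is an offer or a restart receiver in the applications. It stands by
while the search is driven to `x`, so a commitment is possible before and after an offer is
consumed. -/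
theorem commit_steps {d x : CPat n} {B : List (Th n)} {t : Th n}
    (hL : L.Perm (t :: .commit d :: B)) (hg : ∀ t ∈ B, GM s k t) (hc : Covers s k d B s d)
    (hx : CStep s k d x) :
    ∃ L' B', SSteps s k L L' ∧ L'.Perm (t :: .withdraw d x :: B') ∧ ∀ t ∈ B', GM s k t := by
  obtain ⟨B1, h1, h2⟩ := find_step hx hc (.nil x)
  obtain ⟨L1, h3, h4⟩ := h1.lift hL
  obtain ⟨B2, hp⟩ := exists_perm_of_mem h2
  refine ⟨_, B2, h3.tail (.commit (d := d) (x := x) (L₀ := t :: B2) (h4.trans ?_)), .swap _ _ _,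
    fun t ht => good_perm (h1.good hg) hp t (by simp [ht])⟩
  refine .trans ((hp.cons _).cons _) ?_
  refine .trans ((List.Perm.swap _ _ _).cons t) ?_
  refine .trans (List.Perm.swap _ _ _) ((List.Perm.swap _ _ _).cons _)

/-- Steps of the abstract state are realised by the machine. -/
theorem realize (h : Inv s k ι N L) {ι' : Ab n} (ht : Ab.Tau s k ι ι') :
    ∃ L' N', SSteps s k L L' ∧ Inv s k ι' N' L' := by
  cases ht with
  | commit hx =>
    obtain ⟨L1, B, h1, h2, h3, h4⟩ := h.to_offer
    obtain ⟨L2, B', h5, h6, h7⟩ := commit_steps h2 h3 h4 hx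
    exact ⟨L2, _, h1.trans h5, .com h6 h7 hx⟩
  | withdraw d x =>
    cases h with
    | com h h1 h2 => exact ⟨_, _, .single (.withdraw h), .go (.refl _) h1⟩
  | half hx =>
    cases h with
    | half h h1 h2 =>
      obtain ⟨L2, B', h5, h6, h7⟩ := commit_steps h h1 h2 hx
      exact ⟨L2, _, h5, .halfCom h6 h7 hx⟩

/-- Outputs of the abstract state are realised by the machine. -/
theorem realize_out (h : Inv s k ι N L) {d : CPat n} {ι' : Ab n} (ht : Ab.Out ι d ι') :
    ∃ L₁ L' N', SSteps s k L L₁ ∧ Emit L₁ d L' ∧ Inv s k ι' N' L' := by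
  cases ht with
  | live =>
    obtain ⟨L1, B, h1, h2, h3, h4⟩ := h.to_offer
    exact ⟨L1, _, _, h1, .offer h2, .half (.refl _) h3 h4⟩
  | com d x =>
    cases h with
    | com h h1 h2 => exact ⟨L, _, _, .refl, .offer h, .halfCom (.refl _) h1 h2⟩
  | halfCom d x =>
    cases h with
    | halfCom h h1 h2 =>
      exact ⟨L, _, _, .refl, .withdraw (h.trans (.swap _ _ _)), .go (.swap _ _ _) h1⟩
    | halfGo h h1 h2 => exact ⟨L, _, _, .refl, .offer h, .go (.refl _) h1⟩

/-- A committed machine shows the same pattern twice. Consuming the offer leaves `restart` with the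
withdrawal, consuming the withdrawal leaves the offer with `go x`; both are `halfCom d x`, so the
environment cannot tell which thread it met. -/
theorem emit (h : Inv s k ι N L) {d : CPat n} {L' : List (Th n)} (he : Emit L d L') :
    ∃ ι' N', Ab.Out ι d ι' ∧ Inv s k ι' N' L' ∧ (ι.Fresh → N' = N) := by
  cases h with
  | @ev d' _ B h h1 =>
    cases he with
    | offer hp =>
      rcases Perm_cons_inv (hp.symm.trans h) with ⟨e, h2⟩ | ⟨B0, h2, h3⟩
      · simp at e
      · exact absurd (good_head h1 h2) GM.not_offer
    | withdraw hp =>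
      rcases Perm_cons_inv (hp.symm.trans h) with ⟨e, h2⟩ | ⟨B0, h2, h3⟩
      · simp at e
      · exact absurd (good_head h1 h2) GM.not_withdraw
  | offer h h1 h2 =>
    rcases he.two h h1 with ⟨e, hL⟩ | ⟨e, hL⟩ | ⟨x, e, hL⟩ | ⟨x, e, hL⟩ <;> cases e
    exact ⟨_, _, .live _, .half hL h1 h2, fun _ => rfl⟩
  | go h h1 =>
    rcases he.two h h1 with ⟨e, hL⟩ | ⟨e, hL⟩ | ⟨x, e, hL⟩ | ⟨x, e, hL⟩ <;> cases e
  | com h h1 h2 =>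
    rcases he.two h h1 with ⟨e, hL⟩ | ⟨e, hL⟩ | ⟨x, e, hL⟩ | ⟨x, e, hL⟩ <;> cases e
    · exact ⟨_, _, .com _ _, .halfCom hL h1 h2, fun _ => rfl⟩
    · exact ⟨_, _, .com _ _, .halfGo (hL.trans (.swap _ _ _)) h1 h2, fun _ => rfl⟩
  | half h h1 h2 =>
    rcases he.two h h1 with ⟨e, hL⟩ | ⟨e, hL⟩ | ⟨x, e, hL⟩ | ⟨x, e, hL⟩ <;> cases e
  | halfCom h h1 h2 =>
    rcases he.two h h1 with ⟨e, hL⟩ | ⟨e, hL⟩ | ⟨x, e, hL⟩ | ⟨x, e, hL⟩ <;> cases e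
    exact ⟨_, _, .halfCom _ _, .go (hL.trans (.swap _ _ _)) h1, False.elim⟩
  | halfGo h h1 h2 =>
    rcases he.two h h1 with ⟨e, hL⟩ | ⟨e, hL⟩ | ⟨x, e, hL⟩ | ⟨x, e, hL⟩ <;> cases e
    exact ⟨_, _, .halfCom _ _, .go hL h1, False.elim⟩

/-- There is at most one offer. -/
theorem offer_unique (h : Inv s k ι N L) {d d' : CPat n} {L₀ : List (Th n)} :
    ¬ L.Perm (.offer d :: .offer d' :: L₀) := by
  intro hp
  cases h with
  | ev h h1 =>
    rcases Perm_cons_inv (hp.symm.trans h) with ⟨e, -⟩ | ⟨B0, h2, -⟩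
    · simp at e
    · exact absurd (good_head h1 h2) GM.not_offer
  | _ h h1 =>
    rcases two_control h h1 hp GM.not_offer GM.not_offer with ⟨e, e'⟩ | ⟨e, e'⟩ <;>
      simp at e e'

/-- There is at most one withdrawal. -/
theorem withdraw_unique (h : Inv s k ι N L) {d d' x x' : CPat n} {L₀ : List (Th n)} :
    ¬ L.Perm (.withdraw d x :: .withdraw d' x' :: L₀) := by
  intro hp
  cases h with
  | ev h h1 =>
    rcases Perm_cons_inv (hp.symm.trans h) with ⟨e, -⟩ | ⟨B0, h2, -⟩
    · simp at e
    · exact absurd (good_head h1 h2) GM.not_withdraw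
  | _ h h1 =>
    rcases two_control h h1 hp GM.not_withdraw GM.not_withdraw with ⟨e, e'⟩ | ⟨e, e'⟩ <;>
      simp at e e'

end Inv

/-! ### Unification through lists -/

theorem lift_zero {n m : ℕ} (θ : Var n → CPat m) : lift θ 0 = θ := by
  have h : ∀ d : CPat m, d.wk 0 = d := by
    intro d
    induction d with
    | nm x => cases x <;> rfl
    | comp d e h1 h2 => simp only [CPat.wk, h1, h2]
  funext x
  cases x with
  | free a => exact h _
  | bound i =>
    change Fin n at i
    have : lift θ 0 (.bound (Fin.castAdd 0 i)) = θ (.bound i) := by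
      simp only [lift, Fin.addCases_left, h]
    exact this

theorem Unify.of_list {n j k : ℕ} {p : Pat n j} {q : Pat n k} {l l' : List (CPat n)}
    (h : runify p.raw q.raw = some (l, l')) :
    ∃ σ ρ, Unify p q σ ρ ∧ List.ofFn σ = l ∧ List.ofFn ρ = l' := by
  obtain ⟨rfl, rfl⟩ := runify_length p q _ h
  refine ⟨fun i => l.get i, fun i => l'.get i, ?_, List.ofFn_get l, List.ofFn_get l'⟩
  rw [Unify_iff, List.ofFn_get, List.ofFn_get, h]

theorem runify_comp_some {n : ℕ} {p q p' q' : RPat n} {l l' : List (CPat n)} :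
    runify (.comp p q) (.comp p' q') = some (l, l') ↔
      ∃ a a' b b', runify p p' = some (a, a') ∧ runify q q' = some (b, b') ∧
        l = a ++ b ∧ l' = a' ++ b' := by
  rw [runify]
  rcases runify p p' with _ | ⟨a, a'⟩
  · simp
  · rcases runify q q' with _ | ⟨b, b'⟩
    · simp
    · simp only [Option.some.injEq, Prod.mk.injEq]
      constructor
      · rintro ⟨rfl, rfl⟩; exact ⟨a, a', b, b', ⟨rfl, rfl⟩, ⟨rfl, rfl⟩, rfl, rfl⟩
      · rintro ⟨_, _, _, _, ⟨rfl, rfl⟩, ⟨rfl, rfl⟩, rfl, rfl⟩; exact ⟨rfl, rfl⟩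

theorem runify_toPat_lam {n : ℕ} {d : CPat n} {l l' : List (CPat n)} :
    runify d.toPat.raw .lam = some (l, l') ↔ l = [] ∧ l' = [d] := by
  have : runify d.toPat.raw .lam = some ([], [d]) := by
    cases d with
    | nm x => rfl
    | comp d e =>
      have := toC_toPat (.comp d e)
      simp only [CPat.toPat, Pat.raw] at this ⊢
      rw [runify, this]
  rw [this]
  simp [eq_comm]

theorem runify_lam_toPat {n : ℕ} {d : CPat n} {l l' : List (CPat n)} :
    runify .lam d.toPat.raw = some (l, l') ↔ l = [d] ∧ l' = [] := by
  rw [runify, toC_toPat]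
  simp [eq_comm]

theorem runify_lam_lam {n : ℕ} {l l' : List (CPat n)} :
    ¬ runify (.lam : RPat n) .lam = some (l, l') := by
  simp [runify, RPat.toC]

theorem runify_toPat_comp {n : ℕ} {d : CPat n} {p q : RPat n} {l l' : List (CPat n)}
    (h : runify d.toPat.raw (.comp p q) = some (l, l')) :
    ∃ d₁ d₂ a a' b b', d = .comp d₁ d₂ ∧ runify d₁.toPat.raw p = some (a, a') ∧
      runify d₂.toPat.raw q = some (b, b') ∧ l = a ++ b ∧ l' = a' ++ b' := by
  cases d with
  | nm x => simp [CPat.toPat, Pat.raw, runify] at h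
  | comp d e =>
    obtain ⟨a, a', b, b', h1, h2, h3, h4⟩ := runify_comp_some.1 h
    exact ⟨d, e, a, a', b, b', rfl, h1, h2, h3, h4⟩

theorem runify_toPat_toPat {n : ℕ} {d e : CPat n} {l l' : List (CPat n)} :
    runify d.toPat.raw e.toPat.raw = some (l, l') ↔ d = e ∧ l = [] ∧ l' = [] := by
  induction d generalizing e l l' with
  | nm x =>
    cases e with
    | nm y =>
      simp only [CPat.toPat, Pat.raw, runify]
      split <;> simp_all [eq_comm]
    | comp e1 e2 => simp [CPat.toPat, Pat.raw, runify]
  | comp d1 d2 h1 h2 =>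
    cases e with
    | nm y => simp [CPat.toPat, Pat.raw, runify]
    | comp e1 e2 =>
      refine runify_comp_some.trans ?_
      simp only [h1, h2, CPat.comp.injEq]
      constructor
      · rintro ⟨a, a', b, b', ⟨rfl, rfl, rfl⟩, ⟨rfl, rfl, rfl⟩, rfl, rfl⟩
        exact ⟨⟨rfl, rfl⟩, rfl, rfl⟩
      · rintro ⟨⟨rfl, rfl⟩, rfl, rfl⟩
        exact ⟨_, _, _, _, ⟨rfl, rfl, rfl⟩, ⟨rfl, rfl, rfl⟩, rfl, rfl⟩

theorem runify_toProt_toProt {n : ℕ} {d e : CPat n} {l l' : List (CPat n)} :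
    runify d.toProt.raw e.toProt.raw = some (l, l') ↔ d = e ∧ l = [] ∧ l' = [] := by
  induction d generalizing e l l' with
  | nm x =>
    cases e with
    | nm y =>
      simp only [CPat.toProt, Pat.raw, runify]
      split <;> simp_all [eq_comm]
    | comp e1 e2 => simp [CPat.toProt, Pat.raw, runify]
  | comp d1 d2 h1 h2 =>
    cases e with
    | nm y => simp [CPat.toProt, Pat.raw, runify]
    | comp e1 e2 =>
      refine runify_comp_some.trans ?_
      simp only [h1, h2, CPat.comp.injEq]
      constructor
      · rintro ⟨a, a', b, b', ⟨rfl, rfl, rfl⟩, ⟨rfl, rfl, rfl⟩, rfl, rfl⟩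
        exact ⟨⟨rfl, rfl⟩, rfl, rfl⟩
      · rintro ⟨⟨rfl, rfl⟩, rfl, rfl⟩
        exact ⟨_, _, _, _, ⟨rfl, rfl, rfl⟩, ⟨rfl, rfl, rfl⟩, rfl, rfl⟩

/-! ### The machine as a process -/

/-- The private name `a`, the public channel `c` and the combinators. -/
structure Env (n : ℕ) : Type where
  a : CPat n
  c : CPat n
  s : CPat n
  k : CPat n

def Env.subst {n m : ℕ} (θ : Var n → CPat m) (E : Env n) : Env m :=
  ⟨E.a.subst θ, E.c.subst θ, E.s.subst θ, E.k.subst θ⟩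

def Env.wk {n : ℕ} (j : ℕ) (E : Env n) : Env (n + j) := ⟨E.a.wk j, E.c.wk j, E.s.wk j, E.k.wk j⟩

theorem Env.wk_subst_lift {n m : ℕ} (θ : Var n → CPat m) (j : ℕ) (E : Env n) :
    (E.wk j).subst (lift θ j) = (E.subst θ).wk j := by
  simp [Env.wk, Env.subst, CPat.wk_subst_lift]

theorem Env.wk_subst_instS {n j : ℕ} (σ : Fin j → CPat n) (E : Env n) :
    (E.wk j).subst (instS σ) = E := by
  simp [Env.wk, Env.subst, CPat.wk_subst_instS]

/-- Six channels from one private name, so that a machine needs a single restriction. The trees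
differ in size or in the size of their left branch, whatever pattern replaces `a`. -/
def Ch.tree {n : ℕ} (a : CPat n) : Ch → CPat n
  | .ev => a
  | .tk => .comp a a
  | .rk => .comp a (.comp a a)
  | .rs => .comp (.comp a a) a
  | .rep => .comp (.comp a a) (.comp a a)
  | .go => .comp a (.comp a (.comp a a))

theorem Ch.tree_subst {n m : ℕ} (θ : Var n → CPat m) (a : CPat n) (ch : Ch) :
    (ch.tree a).subst θ = ch.tree (a.subst θ) := by cases ch <;> rfl

theorem CPat.ne_comp_self {n : ℕ} (a : CPat n) : a ≠ .comp a a := fun h => by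
  have := congrArg CPat.sz h
  simp only [CPat.sz] at this
  omega

theorem Ch.tree_inj {n : ℕ} {a : CPat n} {ch ch' : Ch} (h : ch.tree a = ch'.tree a) : ch = ch' := by
  have hs := congrArg CPat.sz h
  have ha := a.ne_comp_self
  cases ch <;> cases ch' <;> first | rfl | skip
  all_goals
    simp only [Ch.tree, CPat.sz] at hs
    first
      | omega
      | (simp only [Ch.tree, CPat.comp.injEq] at h
         first | exact absurd h.1 ha | exact absurd h.1.symm ha)

/-- Unification is symmetric, so polarity has to be encoded: messages end in `λ • a` and receivers
in `a • λ`. A message meets a receiver, while two messages or two receivers would set `λ` against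
`λ`, which fails. -/
def msgPat {n : ℕ} (E : Env n) (ch : Ch) (D : CPat n) : Pat n (0 + (0 + (1 + 0))) :=
  .comp (ch.tree E.a).toProt (.comp D.toPat (.comp .lam E.a.toPat))

def rcvPat {n j : ℕ} (E : Env n) (ch : Ch) (p : Pat n j) : Pat n (0 + (j + (0 + 1))) :=
  .comp (ch.tree E.a).toProt (.comp p (.comp E.a.toPat .lam))

/-- Since `c` is protected, a lone `λ` cannot capture the offer; a partner has to mention `c`. -/
def pubPat {n : ℕ} (c d : CPat n) : Pat n 0 := .comp c.toProt d.toPat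

theorem msgPat_subst {n m : ℕ} (θ : Var n → CPat m) (E : Env n) (ch : Ch) (D : CPat n) :
    (msgPat E ch D).subst θ = msgPat (E.subst θ) ch (D.subst θ) := by
  simp [msgPat, Pat.subst, CPat.toPat_subst, CPat.toProt_subst, Ch.tree_subst, Env.subst]

theorem rcvPat_subst {n m j : ℕ} (θ : Var n → CPat m) (E : Env n) (ch : Ch) (p : Pat n j) :
    (rcvPat E ch p).subst θ = rcvPat (E.subst θ) ch (p.subst θ) := by
  simp [rcvPat, Pat.subst, CPat.toPat_subst, CPat.toProt_subst, Ch.tree_subst, Env.subst]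

theorem pubPat_subst {n m : ℕ} (θ : Var n → CPat m) (c d : CPat n) :
    (pubPat c d).subst θ = pubPat (c.subst θ) (d.subst θ) := by
  show Pat.comp _ _ = Pat.comp _ _
  rw [CPat.toPat_subst, CPat.toProt_subst]

def bv (n : ℕ) {j : ℕ} (i : Fin j) : CPat (n + j) := .nm (.bound (Fin.natAdd n i))

theorem bv_subst_lift {n m j : ℕ} (θ : Var n → CPat m) (i : Fin j) :
    (bv n i).subst (lift θ j) = bv m i := by
  simp [bv, CPat.subst, lift]

theorem bv_subst_instS {n j : ℕ} (σ : Fin j → CPat n) (i : Fin j) :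
    (bv n i).subst (instS σ) = σ i := by
  simp [bv, CPat.subst, instS]

def vars (n j : ℕ) : List (CPat (n + j)) := List.ofFn fun i : Fin j => bv n i

theorem vars_subst_lift {n m j : ℕ} (θ : Var n → CPat m) :
    (vars n j).map (CPat.subst (lift θ j)) = vars m j := by
  simp only [vars, List.map_ofFn]
  congr 1
  funext i
  exact bv_subst_lift θ i

theorem vars_subst_instS {n j : ℕ} (σ : Fin j → CPat n) :
    (vars n j).map (CPat.subst (instS σ)) = List.ofFn σ := by
  simp only [vars, List.map_ofFn]
  congr 1
  funext i
  exact bv_subst_instS σ i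

def msgP {n : ℕ} (E : Env n) (ch : Ch) (D : CPat n) : Proc n := .caseOf (msgPat E ch D) .zero

/-- The public pattern is that of an offer, so this thread can be consumed by the environment or by
the machine's own offer. -/
def withdrawP {n : ℕ} (E : Env n) (d x : CPat n) : Proc n :=
  .caseOf (pubPat E.c d) (.par (msgP E .go x) .zero : Proc n)

/-- Two names are bound: index 0 is the payload, index 1 the copy of `a` received for the polarity
check. The same numbering is used by `commitP`. -/
def restartP {n : ℕ} (E : Env n) : Proc n :=
  .caseOf (rcvPat E .go .lam) (.par (msgP (E.wk _) .ev (bv n (0 : Fin 2))) .zero)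

def offerP {n : ℕ} (E : Env n) (d : CPat n) : Proc n :=
  .caseOf (pubPat E.c d) (.par (restartP E) .zero : Proc n)

/-- The value `d` and the empty stack `s` are matched literally, so only finished rebuildings for
this very value are accepted. -/
def commitPat {n : ℕ} (s d : CPat n) : Pat n 1 := .comp (.comp d.toPat s.toPat) .lam

def commitP {n : ℕ} (E : Env n) (d : CPat n) : Proc n :=
  .caseOf (rcvPat E .rep (commitPat E.s d))
    (.par (withdrawP (E.wk _) (d.wk _) (bv n (0 : Fin 2))) .zero)

def Th.proc {n : ℕ} (E : Env n) : Th n → Proc n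
  | .msg ch D => msgP E ch D
  | .offer d => offerP E d
  | .withdraw d x => withdrawP E d x
  | .restart => restartP E
  | .commit d => commitP E d

def pars {n : ℕ} (l : List (Proc n)) : Proc n := l.foldr .par .zero

def thr {n : ℕ} (E : Env n) (L : List (Th n)) : Proc n := pars (L.map (Th.proc E))

theorem msgP_subst {n m : ℕ} (θ : Var n → CPat m) (E : Env n) (ch : Ch) (D : CPat n) :
    (msgP E ch D).subst θ = msgP (E.subst θ) ch (D.subst θ) := by
  simp [msgP, Proc.subst, msgPat_subst]

theorem withdrawP_subst {n m : ℕ} (θ : Var n → CPat m) (E : Env n) (d x : CPat n) :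
    (withdrawP E d x).subst θ = withdrawP (E.subst θ) (d.subst θ) (x.subst θ) := by
  rw [withdrawP, Proc.subst, lift_zero, pubPat_subst]
  simp only [Proc.subst, msgP_subst]
  rfl

theorem restartP_subst {n m : ℕ} (θ : Var n → CPat m) (E : Env n) :
    (restartP E).subst θ = restartP (E.subst θ) := by
  simp only [restartP, Proc.subst, rcvPat_subst, msgP_subst, Env.wk_subst_lift, Pat.subst]
  congr 3
  exact bv_subst_lift θ _

theorem offerP_subst {n m : ℕ} (θ : Var n → CPat m) (E : Env n) (d : CPat n) :
    (offerP E d).subst θ = offerP (E.subst θ) (d.subst θ) := by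
  rw [offerP, Proc.subst, lift_zero, pubPat_subst]
  simp only [Proc.subst, restartP_subst]
  rfl

theorem commitPat_subst {n m : ℕ} (θ : Var n → CPat m) (s d : CPat n) :
    (commitPat s d).subst θ = commitPat (s.subst θ) (d.subst θ) := by
  show Pat.comp (.comp _ _) _ = Pat.comp (.comp _ _) _
  rw [CPat.toPat_subst, CPat.toPat_subst]
  rfl

theorem commitP_subst {n m : ℕ} (θ : Var n → CPat m) (E : Env n) (d : CPat n) :
    (commitP E d).subst θ = commitP (E.subst θ) (d.subst θ) := by
  simp only [commitP, Proc.subst, rcvPat_subst, withdrawP_subst, Env.wk_subst_lift,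
    commitPat_subst, CPat.wk_subst_lift]
  congr 3
  exact bv_subst_lift θ _

theorem Th.proc_subst {n m : ℕ} (θ : Var n → CPat m) (E : Env n) (t : Th n) :
    (t.proc E).subst θ = (t.subst θ).proc (E.subst θ) := by
  cases t with
  | msg ch D => exact msgP_subst _ _ _ _
  | offer d => exact offerP_subst _ _ _
  | withdraw d x => exact withdrawP_subst _ _ _ _
  | restart => exact restartP_subst _ _
  | commit d => exact commitP_subst _ _ _

theorem thr_subst {n m : ℕ} (θ : Var n → CPat m) (E : Env n) (L : List (Th n)) :
    (thr E L).subst θ = thr (E.subst θ) (L.map (Th.subst θ)) := by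
  induction L with
  | nil => rfl
  | cons t L ih =>
    show Proc.par _ _ = Proc.par _ _
    rw [Th.proc_subst]
    exact congrArg _ ih

/-- The replicated servers. -/
inductive Srv : Type
  | ev | tk | rk | rs | left | right

namespace Srv

def ch : Srv → Ch
  | ev => .ev
  | tk => .tk
  | rk => .rk
  | rs => .rs
  | left => .rep
  | right => .rep

def ar : Srv → ℕ
  | ev => 1
  | tk => 4
  | rk => 4
  | rs => 5
  | left => 4
  | right => 4

def pat {n : ℕ} (s k : CPat n) : (r : Srv) → Pat n r.ar
  | ev => .lam
  | tk => .comp (.comp .lam .lam) (.comp .lam .lam)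
  | rk => (.comp (.comp .lam .lam) (.comp (.comp k.toPat .lam) .lam) : Pat n ((1 + 1) + ((0 + 1) + 1)))
  | rs => (.comp (.comp .lam .lam) (.comp (.comp (.comp s.toPat .lam) .lam) .lam) :
      Pat n ((1 + 1) + (((0 + 1) + 1) + 1)))
  | left => (.comp (.comp .lam (.comp (.comp s.toPat .lam) .lam)) .lam :
      Pat n ((1 + ((0 + 1) + 1)) + 1))
  | right => (.comp (.comp .lam (.comp (.comp (CPat.comp s s).toPat .lam) .lam)) .lam :
      Pat n ((1 + ((0 + 1) + 1)) + 1))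

/-- The threads that a server spawns, given the values of its binding names. -/
def out {n : ℕ} (s : CPat n) : Srv → List (CPat n) → List (Th n)
  -- The last entry of each list is the copy of `a` from the polarity check and is ignored.
  | ev, [d, _] => .offer d :: .commit d :: triple d s d
  | tk, [d, z, x, y, _] => triple d (fl s y z) x ++ triple d (fr s x z) y
  | rk, [d, z, x, _, _] => [.msg .rep (pl d z x)]
  | rs, [d, z, x, y, w, _] => [.msg .rep (pl d z (.comp (.comp x w) (.comp y w)))]
  | left, [d, y, z, x, _] => [.msg .rep (pl d z (.comp x y))]
  | right, [d, y, z, x, _] => [.msg .rep (pl d z (.comp y x))]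
  | _, _ => []

theorem pat_subst {n m : ℕ} (θ : Var n → CPat m) (s k : CPat n) (r : Srv) :
    (r.pat s k).subst θ = r.pat (s.subst θ) (k.subst θ) := by
  cases r with
  | ev => rfl
  | tk => rfl
  | rk => simp only [pat, ar, Pat.subst, CPat.toPat_subst]
  | rs => simp only [pat, ar, Pat.subst, CPat.toPat_subst]
  | left => simp only [pat, ar, Pat.subst, CPat.toPat_subst]
  | right => simp only [pat, ar, Pat.subst, CPat.toPat_subst, CPat.subst]

theorem out_subst {n m : ℕ} (θ : Var n → CPat m) (s : CPat n) (r : Srv) (l : List (CPat n)) :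
    (r.out s l).map (Th.subst θ) = r.out (s.subst θ) (l.map (CPat.subst θ)) := by
  rcases l with _ | ⟨x1, _ | ⟨x2, _ | ⟨x3, _ | ⟨x4, _ | ⟨x5, _ | ⟨x6, _ | ⟨x7, l⟩⟩⟩⟩⟩⟩⟩ <;>
    cases r <;> rfl

def proc {n : ℕ} (E : Env n) (r : Srv) : Proc n :=
  .caseOf (rcvPat E r.ch (r.pat E.s E.k)) (thr (E.wk _) (r.out (E.wk _).s (vars n _)))

theorem proc_subst {n m : ℕ} (θ : Var n → CPat m) (E : Env n) (r : Srv) :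
    (r.proc E).subst θ = r.proc (E.subst θ) := by
  simp only [proc, Proc.subst, rcvPat_subst, pat_subst, thr_subst, out_subst, Env.wk_subst_lift,
    vars_subst_lift]
  have : ((E.wk (0 + (r.ar + (0 + 1)))).s.subst (lift θ _)) = ((E.subst θ).wk _).s :=
    CPat.wk_subst_lift _ _ _
  rw [this]
  rfl

def all : List Srv := [ev, tk, rk, rs, left, right]

theorem mem_all (r : Srv) : r ∈ all := by cases r <;> simp [all]

end Srv

def servers {n : ℕ} (E : Env n) : Proc n := pars (Srv.all.map fun r => .rep (r.proc E))

def coreEnv {n : ℕ} (c s k : CPat n) : Env (n + 1) := ⟨bv n (0 : Fin 1), c.wk 1, s.wk 1, k.wk 1⟩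

/-- The machine on the public channel `c` with the soup `L`. -/
def core {n : ℕ} (c s k : CPat n) (L : List (Th (n + 1))) : Proc n :=
  .res (.par (servers (coreEnv c s k)) (thr (coreEnv c s k) L))

theorem coreEnv_subst {n m : ℕ} (θ : Var n → CPat m) (c s k : CPat n) :
    (coreEnv c s k).subst (lift θ 1) = coreEnv (c.subst θ) (s.subst θ) (k.subst θ) := by
  simp [coreEnv, Env.subst, CPat.wk_subst_lift, bv_subst_lift]

theorem servers_subst {n m : ℕ} (θ : Var n → CPat m) (E : Env n) :
    (servers E).subst θ = servers (E.subst θ) := by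
  simp only [servers, Srv.all, List.map, pars, List.foldr, Proc.subst, Srv.proc_subst]

theorem core_subst {n m : ℕ} (θ : Var n → CPat m) (c s k : CPat n) (L : List (Th (n + 1))) :
    (core c s k L).subst θ =
      core (c.subst θ) (s.subst θ) (k.subst θ) (L.map (Th.subst (lift θ 1))) := by
  simp only [core, Proc.subst, servers_subst, thr_subst, coreEnv_subst]

theorem Srv.proc_inst {n : ℕ} (E : Env n) (r : Srv) (ρ : Fin (0 + (r.ar + (0 + 1))) → CPat n) :
    (thr (E.wk _) (r.out (E.wk _).s (vars n _))).inst ρ = thr E (r.out E.s (List.ofFn ρ)) := by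
  rw [Proc.inst_eq, thr_subst, Srv.out_subst, Env.wk_subst_instS, vars_subst_instS]
  have : (E.wk (0 + (r.ar + (0 + 1)))).s.subst (instS ρ) = E.s := CPat.wk_subst_instS _ _
  rw [this]

/-! ### Which threads communicate -/

section

variable {n : ℕ} {E : Env n}

/-- In the polarity part, `λ` would have to unify with `λ`, which is not communicable. -/
theorem not_unify_msg_msg {ch ch' : Ch} {D D' : CPat n} {σ ρ} :
    ¬ Unify (msgPat E ch D) (msgPat E ch' D') σ ρ := by
  intro h
  obtain ⟨_, _, _, _, -, h, -⟩ := runify_comp_some.1 (Unify_iff.1 h)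
  obtain ⟨_, _, _, _, -, h, -⟩ := runify_comp_some.1 h
  obtain ⟨_, _, _, _, h, -⟩ := runify_comp_some.1 h
  exact runify_lam_lam h

theorem not_unify_rcv_rcv {j j' : ℕ} {ch ch' : Ch} {p : Pat n j} {p' : Pat n j'} {σ ρ} :
    ¬ Unify (rcvPat E ch p) (rcvPat E ch' p') σ ρ := by
  intro h
  obtain ⟨_, _, _, _, -, h, -⟩ := runify_comp_some.1 (Unify_iff.1 h)
  obtain ⟨_, _, _, _, -, h, -⟩ := runify_comp_some.1 h
  obtain ⟨_, _, _, _, -, h, -⟩ := runify_comp_some.1 h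
  exact runify_lam_lam h

theorem unify_msg_rcv {j : ℕ} {ch ch' : Ch} {D : CPat n} {p : Pat n j} {σ ρ}
    (h : Unify (msgPat E ch D) (rcvPat E ch' p) σ ρ) :
    ch = ch' ∧ ∃ a l, runify D.toPat.raw p.raw = some (a, l) ∧ List.ofFn ρ = l ++ [E.a] := by
  obtain ⟨_, _, _, _, h1, h, -, e⟩ := runify_comp_some.1 (Unify_iff.1 h)
  obtain ⟨_, _, _, _, h2, h', -, rfl⟩ := runify_comp_some.1 h
  obtain ⟨_, _, _, _, h3, h4, -, rfl⟩ := runify_comp_some.1 h'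
  obtain ⟨e1, rfl, rfl⟩ := runify_toProt_toProt.1 h1
  obtain ⟨rfl, rfl⟩ := runify_lam_toPat.1 h3
  obtain ⟨rfl, rfl⟩ := runify_toPat_lam.1 h4
  exact ⟨Ch.tree_inj e1, _, _, h2, e⟩

theorem unify_msg_rcv_of {j : ℕ} {ch : Ch} {D : CPat n} {p : Pat n j} {a l : List (CPat n)}
    (h : runify D.toPat.raw p.raw = some (a, l)) :
    ∃ σ ρ, Unify (msgPat E ch D) (rcvPat E ch p) σ ρ ∧ List.ofFn ρ = l ++ [E.a] := by
  have : runify (msgPat E ch D).raw (rcvPat E ch p).raw = some (a ++ [E.a], l ++ [E.a]) := by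
    refine runify_comp_some.2 ⟨[], [], _, _, runify_toProt_toProt.2 ⟨rfl, rfl, rfl⟩,
      runify_comp_some.2 ⟨_, _, [E.a], [E.a], h, runify_comp_some.2 ⟨_, _, _, _,
        runify_lam_toPat.2 ⟨rfl, rfl⟩, runify_toPat_lam.2 ⟨rfl, rfl⟩, rfl, rfl⟩, rfl, rfl⟩, rfl, rfl⟩
  obtain ⟨σ, ρ, h, -, h2⟩ := Unify.of_list this
  exact ⟨σ, ρ, h, h2⟩

/-- Both channels are protected throughout, so they would have to be equal patterns. -/
theorem not_unify_msg_pub (hc : ∀ ch : Ch, ch.tree E.a ≠ E.c) {ch : Ch} {D d : CPat n} {σ ρ} :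
    ¬ Unify (msgPat E ch D) (pubPat E.c d) σ ρ := by
  intro h
  obtain ⟨_, _, _, _, h1, -⟩ := runify_comp_some.1 (Unify_iff.1 h)
  exact hc ch (runify_toProt_toProt.1 h1).1

theorem not_unify_rcv_pub (hc : ∀ ch : Ch, ch.tree E.a ≠ E.c) {j : ℕ} {ch : Ch} {p : Pat n j}
    {d : CPat n} {σ ρ} : ¬ Unify (rcvPat E ch p) (pubPat E.c d) σ ρ := by
  intro h
  obtain ⟨_, _, _, _, h1, -⟩ := runify_comp_some.1 (Unify_iff.1 h)
  exact hc ch (runify_toProt_toProt.1 h1).1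

theorem unify_pub_pub {c d c' d' : CPat n} {σ ρ} (h : Unify (pubPat c d) (pubPat c' d') σ ρ) :
    c = c' ∧ d = d' := by
  obtain ⟨_, _, _, _, h1, h2, -⟩ := runify_comp_some.1 (Unify_iff.1 h)
  exact ⟨(runify_toProt_toProt.1 h1).1, (runify_toPat_toPat.1 h2).1⟩

theorem unify_pub_self (c d : CPat n) :
    ∃ σ ρ, Unify (pubPat c d) (pubPat c d) σ ρ := by
  obtain ⟨σ, ρ, h, -⟩ := Unify.of_list (p := pubPat c d) (q := pubPat c d) (l := []) (l' := [])
    (runify_comp_some.2 ⟨_, _, _, _, runify_toProt_toProt.2 ⟨rfl, rfl, rfl⟩,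
      runify_toPat_toPat.2 ⟨rfl, rfl, rfl⟩, rfl, rfl⟩)
  exact ⟨σ, ρ, h⟩

/-- Matching a server pattern reads the payload apart component by component; the literal parts
force exactly the shapes listed in `Fire`. -/
theorem Srv.fire {s k : CPat n} {r : Srv} {D x : CPat n} {a l : List (CPat n)}
    (h : runify D.toPat.raw (r.pat s k).raw = some (a, l)) :
    Fire s k r.ch D (r.out s (l ++ [x])) := by
  cases r with
  | ev =>
    obtain ⟨-, rfl⟩ := runify_toPat_lam.1 h
    exact .ev D
  | tk =>
    obtain ⟨_, _, _, _, _, _, rfl, h1, h2, -, rfl⟩ := runify_toPat_comp h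
    obtain ⟨_, _, _, _, _, _, rfl, h3, h4, -, rfl⟩ := runify_toPat_comp h1
    obtain ⟨_, _, _, _, _, _, rfl, h5, h6, -, rfl⟩ := runify_toPat_comp h2
    obtain ⟨-, rfl⟩ := runify_toPat_lam.1 h3
    obtain ⟨-, rfl⟩ := runify_toPat_lam.1 h4
    obtain ⟨-, rfl⟩ := runify_toPat_lam.1 h5
    obtain ⟨-, rfl⟩ := runify_toPat_lam.1 h6
    exact .tk _ _ _ _
  | rk =>
    obtain ⟨_, _, _, _, _, _, rfl, h1, h2, -, rfl⟩ := runify_toPat_comp h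
    obtain ⟨_, _, _, _, _, _, rfl, h3, h4, -, rfl⟩ := runify_toPat_comp h1
    obtain ⟨_, _, _, _, _, _, rfl, h5, h6, -, rfl⟩ := runify_toPat_comp h2
    obtain ⟨_, _, _, _, _, _, rfl, h7, h8, -, rfl⟩ := runify_toPat_comp h5
    obtain ⟨-, rfl⟩ := runify_toPat_lam.1 h3
    obtain ⟨-, rfl⟩ := runify_toPat_lam.1 h4
    obtain ⟨-, rfl⟩ := runify_toPat_lam.1 h6
    obtain ⟨rfl, -, rfl⟩ := runify_toPat_toPat.1 h7
    obtain ⟨-, rfl⟩ := runify_toPat_lam.1 h8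
    exact .rk _ _ _ _
  | rs =>
    obtain ⟨_, _, _, _, _, _, rfl, h1, h2, -, rfl⟩ := runify_toPat_comp h
    obtain ⟨_, _, _, _, _, _, rfl, h3, h4, -, rfl⟩ := runify_toPat_comp h1
    obtain ⟨_, _, _, _, _, _, rfl, h5, h6, -, rfl⟩ := runify_toPat_comp h2
    obtain ⟨_, _, _, _, _, _, rfl, h7, h8, -, rfl⟩ := runify_toPat_comp h5
    obtain ⟨_, _, _, _, _, _, rfl, h9, h10, -, rfl⟩ := runify_toPat_comp h7
    obtain ⟨-, rfl⟩ := runify_toPat_lam.1 h3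
    obtain ⟨-, rfl⟩ := runify_toPat_lam.1 h4
    obtain ⟨-, rfl⟩ := runify_toPat_lam.1 h6
    obtain ⟨-, rfl⟩ := runify_toPat_lam.1 h8
    obtain ⟨rfl, -, rfl⟩ := runify_toPat_toPat.1 h9
    obtain ⟨-, rfl⟩ := runify_toPat_lam.1 h10
    exact .rs _ _ _ _ _
  | left =>
    obtain ⟨_, _, _, _, _, _, rfl, h1, h2, -, rfl⟩ := runify_toPat_comp h
    obtain ⟨_, _, _, _, _, _, rfl, h3, h4, -, rfl⟩ := runify_toPat_comp h1
    obtain ⟨_, _, _, _, _, _, rfl, h5, h6, -, rfl⟩ := runify_toPat_comp h4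
    obtain ⟨_, _, _, _, _, _, rfl, h7, h8, -, rfl⟩ := runify_toPat_comp h5
    obtain ⟨-, rfl⟩ := runify_toPat_lam.1 h2
    obtain ⟨-, rfl⟩ := runify_toPat_lam.1 h3
    obtain ⟨-, rfl⟩ := runify_toPat_lam.1 h6
    obtain ⟨rfl, -, rfl⟩ := runify_toPat_toPat.1 h7
    obtain ⟨-, rfl⟩ := runify_toPat_lam.1 h8
    exact .left _ _ _ _
  | right =>
    obtain ⟨_, _, _, _, _, _, rfl, h1, h2, -, rfl⟩ := runify_toPat_comp h
    obtain ⟨_, _, _, _, _, _, rfl, h3, h4, -, rfl⟩ := runify_toPat_comp h1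
    obtain ⟨_, _, _, _, _, _, rfl, h5, h6, -, rfl⟩ := runify_toPat_comp h4
    obtain ⟨_, _, _, _, _, _, rfl, h7, h8, -, rfl⟩ := runify_toPat_comp h5
    obtain ⟨-, rfl⟩ := runify_toPat_lam.1 h2
    obtain ⟨-, rfl⟩ := runify_toPat_lam.1 h3
    obtain ⟨-, rfl⟩ := runify_toPat_lam.1 h6
    obtain ⟨rfl, -, rfl⟩ := runify_toPat_toPat.1 h7
    obtain ⟨-, rfl⟩ := runify_toPat_lam.1 h8
    exact .right _ _ _ _

theorem runify_comp_of {p q p' q' : RPat n} {a b : List (CPat n)}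
    (h : runify p p' = some ([], a)) (h' : runify q q' = some ([], b)) :
    runify (.comp p q) (.comp p' q') = some ([], a ++ b) :=
  runify_comp_some.2 ⟨_, _, _, _, h, h', rfl, rfl⟩

theorem runify_lam_of (d : CPat n) : runify d.toPat.raw .lam = some ([], [d]) :=
  runify_toPat_lam.2 ⟨rfl, rfl⟩

theorem runify_self_of (d : CPat n) : runify d.toPat.raw d.toPat.raw = some ([], []) :=
  runify_toPat_toPat.2 ⟨rfl, rfl, rfl⟩

theorem Fire.srv {s k : CPat n} {ch : Ch} {D : CPat n} {O : List (Th n)} (h : Fire s k ch D O) :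
    ∃ (r : Srv) (l : List (CPat n)), r.ch = ch ∧
      runify D.toPat.raw (r.pat s k).raw = some ([], l) ∧ ∀ x, r.out s (l ++ [x]) = O := by
  cases h with
  | ev d => exact ⟨.ev, _, rfl, runify_lam_of _, fun _ => rfl⟩
  | tk d z x y =>
    exact ⟨.tk, _, rfl, runify_comp_of (runify_comp_of (runify_lam_of d) (runify_lam_of z))
      (runify_comp_of (runify_lam_of x) (runify_lam_of y)), fun _ => rfl⟩
  | rk d z x y =>
    exact ⟨.rk, _, rfl, runify_comp_of (runify_comp_of (runify_lam_of d) (runify_lam_of z))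
      (runify_comp_of (runify_comp_of (runify_self_of k) (runify_lam_of x)) (runify_lam_of y)),
      fun _ => rfl⟩
  | rs d z x y w =>
    exact ⟨.rs, _, rfl, runify_comp_of (runify_comp_of (runify_lam_of d) (runify_lam_of z))
      (runify_comp_of (runify_comp_of (runify_comp_of (runify_self_of s) (runify_lam_of x))
        (runify_lam_of y)) (runify_lam_of w)), fun _ => rfl⟩
  | left d z x y =>
    exact ⟨.left, _, rfl, runify_comp_of (runify_comp_of (runify_lam_of d) (runify_comp_of
      (runify_comp_of (runify_self_of s) (runify_lam_of y)) (runify_lam_of z))) (runify_lam_of x),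
      fun _ => rfl⟩
  | right d z x y =>
    exact ⟨.right, _, rfl, runify_comp_of (runify_comp_of (runify_lam_of d) (runify_comp_of
      (runify_comp_of (runify_self_of (.comp s s)) (runify_lam_of y)) (runify_lam_of z)))
      (runify_lam_of x), fun _ => rfl⟩

end

/-! ### Parallel compositions of lists -/

theorem pars_perm {n : ℕ} {l l' : List (Proc n)} (h : l.Perm l') : StrEq (pars l) (pars l') := by
  induction h with
  | nil => exact .refl _
  | cons x _ ih => exact .parR _ ih
  | swap x y l => exact .left_comm _ _ _
  | trans _ _ h1 h2 => exact h1.trans h2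

theorem pars_append {n : ℕ} (l l' : List (Proc n)) :
    StrEq (pars (l ++ l')) (.par (pars l) (pars l')) := by
  induction l with
  | nil => exact .symm (.zero_par _)
  | cons x l ih => exact .trans (.parR _ ih) (.par_assoc _ _ _)

theorem thr_perm {n : ℕ} (E : Env n) {L L' : List (Th n)} (h : L.Perm L') :
    StrEq (thr E L) (thr E L') := pars_perm (h.map _)

theorem thr_append {n : ℕ} (E : Env n) (L L' : List (Th n)) :
    StrEq (thr E (L ++ L')) (.par (thr E L) (thr E L')) := by
  unfold thr
  rw [List.map_append]
  exact pars_append _ _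

theorem com_pars {α : Type*} {n : ℕ} (f : α → Proc n) {Q : Proc n} : ∀ {A : List α} {X : Proc n},
    Com (pars (A.map f)) Q X → ∃ a A' X', A.Perm (a :: A') ∧ Com (f a) Q X' ∧
      StrEq X (.par X' (pars (A'.map f))) := by
  intro A
  induction A with
  | nil => intro X h; cases h
  | cons a A ih =>
    intro X h
    cases h with
    | parL _ h => exact ⟨a, A, _, .refl _, h, .refl _⟩
    | parR _ h =>
      obtain ⟨b, A', X', hp, h, e⟩ := ih h
      exact ⟨b, a :: A', X', (hp.cons a).trans (.swap _ _ _), h,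
        .trans (.parR _ e) (.left_comm _ _ _)⟩

theorem tau_pars {α : Type*} {n : ℕ} (f : α → Proc n) : ∀ {A : List α} {X : Proc n},
    Tau (pars (A.map f)) X →
      (∃ a A' X', A.Perm (a :: A') ∧ Tau (f a) X' ∧ StrEq X (.par X' (pars (A'.map f)))) ∨
      (∃ a b A' X', A.Perm (a :: b :: A') ∧ Com (f a) (f b) X' ∧
        StrEq X (.par X' (pars (A'.map f)))) := by
  intro A
  induction A with
  | nil => intro X h; cases h
  | cons a A ih =>
    intro X h
    cases h with
    | com h =>
      obtain ⟨X1, h1, e1⟩ := h.symm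
      obtain ⟨b, A', X2, hp, h2, e2⟩ := com_pars f h1
      obtain ⟨X3, h3, e3⟩ := h2.symm
      exact .inr ⟨a, b, A', X3, hp.cons a, h3, e1.symm.trans (e2.trans (.parL _ e3.symm))⟩
    | parL _ h => exact .inl ⟨a, A, _, .refl _, h, .refl _⟩
    | parR _ h =>
      rcases ih h with ⟨b, A', X', hp, h, e⟩ | ⟨b, b', A', X', hp, h, e⟩
      · exact .inl ⟨b, a :: A', X', (hp.cons a).trans (.swap _ _ _), h,
          .trans (.parR _ e) (.left_comm _ _ _)⟩
      · exact .inr ⟨b, b', a :: A', X', ((hp.cons a).trans (.swap _ _ _)).trans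
          ((List.Perm.swap _ _ _).cons b), h, .trans (.parR _ e) (.left_comm _ _ _)⟩

theorem sb_pars {α : Type*} {n : ℕ} (f : α → Proc n) {S T : Set Name} : ∀ {A : List α},
    SB (pars (A.map f)) S T → ∃ a A', A.Perm (a :: A') ∧ SB (f a) S T := by
  intro A
  induction A with
  | nil => intro h; cases h
  | cons a A ih =>
    intro h
    rcases SB_par.1 h with h | h
    · exact ⟨a, A, .refl _, h⟩
    · obtain ⟨b, A', hp, h⟩ := ih h
      exact ⟨b, a :: A', (hp.cons a).trans (.swap _ _ _), h⟩

theorem not_hasOk_pars {α : Type*} {n : ℕ} (f : α → Proc n) (hf : ∀ a, ¬ HasOk (f a))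
    (A : List α) : ¬ HasOk (pars (A.map f)) := by
  induction A with
  | nil => exact not_hasOk_zero
  | cons a A ih =>
    intro h
    rcases hasOk_par.1 h with h | h
    · exact hf a h
    · exact ih h

theorem com_case {n j k : ℕ} {p : Pat n j} {q : Pat n k} {C : Proc (n + j)} {D : Proc (n + k)}
    {X : Proc n} (h : Com (.caseOf p C) (.caseOf q D) X) :
    ∃ σ ρ, Unify p q σ ρ ∧ StrEq X (.par (C.inst σ) (D.inst ρ)) := by
  cases h with
  | case h =>
    cases h with
    | comm _ _ h => exact ⟨_, _, h.swap, .par_comm _ _⟩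

theorem not_tau_case {n j : ℕ} {p : Pat n j} {C : Proc (n + j)} {X : Proc n} :
    ¬ Tau (.caseOf p C) X := fun h => by cases h

/-! ### Names that the environment does not know -/

theorem pv_toPat {n : ℕ} (d : CPat n) : d.toPat.pv = ∅ := by
  induction d with
  | nm x => rfl
  | comp d e h1 h2 => show d.toPat.pv ∪ e.toPat.pv = ∅; rw [h1, h2]; simp

/-- A protected name only meets the same name, plain or protected: `λ` accepts communicable patterns
alone, and these contain no protection. -/
theorem Unify.pv_av {n j k : ℕ} {p : Pat n j} {q : Pat n k} {σ ρ} (h : Unify p q σ ρ) :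
    q.pv ⊆ p.av := by
  induction h with
  | nm_nm x => simp [Pat.pv]
  | nm_prot x => simp [Pat.pv, Pat.av]
  | prot_nm x => simp [Pat.pv]
  | prot_prot x => simp [Pat.pv, Pat.av]
  | lam_left d => simp [pv_toPat]
  | lam_right d => simp [Pat.pv]
  | comp _ _ h1 h2 => exact Set.union_subset_union h1 h2

/-- An unknown protected name prevents interaction. -/
theorem Int.known {m k : ℕ} {P' X : Proc m} {q : Pat m k} {D : Proc (m + k)} (h : Int P' q D X) :
    ∀ {n : ℕ} {f : Fin n → Fin m} (P : Proc n), P' = P.subst (renS f) →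
      ∀ i, .bound i ∈ q.pv → i ∈ Set.range f := by
  induction h with
  | @comm _ _ _ p q _ _ C D h =>
    intro n f P e i hi
    cases P with
    | caseOf p0 C0 =>
      simp only [Proc.subst, Proc.caseOf.injEq] at e
      obtain ⟨rfl, e1, -⟩ := e
      cases e1
      have := h.pv_av hi
      rw [renS_eq_vren, av_vren] at this
      obtain ⟨x, -, hx⟩ := this
      cases x with
      | free a => simp [Var.map] at hx
      | bound j => simp only [Var.map, Var.bound.injEq] at hx; exact ⟨j, hx⟩
    | _ => simp [Proc.subst] at e
  | parL Q _ ih =>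
    intro n f P e i hi
    cases P with
    | par P1 P2 =>
      simp only [Proc.subst, Proc.par.injEq] at e
      exact ih P1 e.1 i hi
    | _ => simp [Proc.subst] at e
  | parR Q _ ih =>
    intro n f P e i hi
    cases P with
    | par P1 P2 =>
      simp only [Proc.subst, Proc.par.injEq] at e
      exact ih P2 e.2 i hi
    | _ => simp [Proc.subst] at e
  | rep _ ih =>
    intro n f P e i hi
    cases P with
    | rep P1 =>
      simp only [Proc.subst, Proc.rep.injEq] at e
      exact ih P1 e i hi
    | _ => simp [Proc.subst] at e
  | res _ ih =>
    intro n f P e i hi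
    cases P with
    | res P1 =>
      simp only [Proc.subst, Proc.res.injEq, lift_renS] at e
      obtain ⟨j, hj⟩ := ih P1 e (Fin.castAdd 1 i) (by
        rw [wkS, renS_eq_vren, pv_vren]; exact ⟨_, hi, rfl⟩)
      induction j using Fin.addCases with
      | left j => simp only [liftF, Fin.addCases_left] at hj; exact ⟨j, Fin.castAdd_injective _ _ hj⟩
      | right j =>
        simp only [liftF, Fin.addCases_right] at hj
        have := congrArg Fin.val hj
        simp at this
        omega
    | _ => simp [Proc.subst] at e

theorem last_notMem (n : ℕ) (i : Fin 1) : Fin.natAdd n i ∉ Set.range (Fin.castAdd 1 : Fin n → _) := by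
  rintro ⟨j, hj⟩
  have := congrArg Fin.val hj
  simp at this
  omega

theorem not_int_wk {n k : ℕ} {Q : Proc n} {X : Proc (n + 1)} {q : Pat (n + 1) k} {D : Proc (n + 1 + k)}
    (hq : .bound (Fin.natAdd n (0 : Fin 1)) ∈ q.pv) : ¬ Int (Q.subst (wkS 1)) q D X :=
  fun h => last_notMem n 0 (h.known Q rfl _ hq)

/-! ### Steps of the soup are steps of the process -/

/-- Communication of two threads. -/
inductive React {n : ℕ} (s : CPat n) : Th n → Th n → List (Th n) → Prop
  | commit (d x : CPat n) : React s (.msg .rep (pl d s x)) (.commit d) [.withdraw d x]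
  | restart (x : CPat n) : React s (.msg .go x) .restart [.msg .ev x]
  | withdraw (d x : CPat n) : React s (.offer d) (.withdraw d x) [.restart, .msg .go x]

section

variable {n : ℕ} {E : Env n}

theorem commitPat_some {s d D : CPat n} {a l : List (CPat n)}
    (h : runify D.toPat.raw (commitPat s d).raw = some (a, l)) :
    ∃ x, D = pl d s x ∧ l = [x] := by
  obtain ⟨_, _, _, _, _, _, rfl, h1, h2, -, rfl⟩ := runify_toPat_comp h
  obtain ⟨_, _, _, _, _, _, rfl, h3, h4, -, rfl⟩ := runify_toPat_comp h1
  obtain ⟨rfl, -, rfl⟩ := runify_toPat_toPat.1 h3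
  obtain ⟨rfl, -, rfl⟩ := runify_toPat_toPat.1 h4
  obtain ⟨-, rfl⟩ := runify_toPat_lam.1 h2
  exact ⟨_, rfl, rfl⟩

theorem ofFn_two {ρ : Fin 2 → CPat n} {x y : CPat n} (h : List.ofFn ρ = [x, y]) : ρ 0 = x := by
  simp only [List.ofFn_succ, List.ofFn_zero, List.cons.injEq] at h
  exact h.1

theorem withdrawP_inst (E : Env n) (d : CPat n) (ρ : Fin 2 → CPat n) :
    (withdrawP (E.wk 2) (d.wk 2) (bv n (0 : Fin 2))).inst ρ = withdrawP E d (ρ 0) := by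
  rw [Proc.inst_eq, withdrawP_subst, Env.wk_subst_instS, CPat.wk_subst_instS, bv_subst_instS]

theorem msgP_inst (E : Env n) (ch : Ch) (ρ : Fin 2 → CPat n) :
    (msgP (E.wk 2) ch (bv n (0 : Fin 2))).inst ρ = msgP E ch (ρ 0) := by
  rw [Proc.inst_eq, msgP_subst, Env.wk_subst_instS, bv_subst_instS]

theorem msg_com_commit {ch : Ch} {D d : CPat n} {X : Proc n} (h : Com (msgP E ch D) (commitP E d) X) :
    ∃ x, ch = .rep ∧ D = pl d E.s x ∧ StrEq X (thr E [.withdraw d x]) := by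
  obtain ⟨σ, ρ, hu, e⟩ := com_case h
  obtain ⟨rfl, a, l, h1, h2⟩ := unify_msg_rcv hu
  obtain ⟨x, rfl, rfl⟩ := commitPat_some h1
  refine ⟨x, rfl, rfl, e.trans (.trans (.zero_par _) ?_)⟩
  have := withdrawP_inst E d ρ
  rw [ofFn_two h2] at this
  show StrEq (.par _ .zero) (.par (withdrawP E d x) .zero)
  rw [← this]
  exact .refl _

theorem msg_com_restart {ch : Ch} {D : CPat n} {X : Proc n} (h : Com (msgP E ch D) (restartP E) X) :
    ch = .go ∧ StrEq X (thr E [.msg .ev D]) := by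
  obtain ⟨σ, ρ, hu, e⟩ := com_case h
  obtain ⟨rfl, a, l, h1, h2⟩ := unify_msg_rcv hu
  obtain ⟨-, rfl⟩ := runify_toPat_lam.1 h1
  refine ⟨rfl, e.trans (.trans (.zero_par _) ?_)⟩
  have := msgP_inst E .ev ρ
  rw [ofFn_two h2] at this
  show StrEq (.par _ .zero) (.par (msgP E .ev D) .zero)
  rw [← this]
  exact .refl _

theorem offer_com_withdraw {d d' x : CPat n} {X : Proc n}
    (h : Com (offerP E d) (withdrawP E d' x) X) :
    d = d' ∧ StrEq X (thr E [.restart, .msg .go x]) := by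
  obtain ⟨σ, ρ, hu, e⟩ := com_case h
  obtain ⟨-, rfl⟩ := unify_pub_pub hu
  refine ⟨rfl, e.trans ?_⟩
  rw [Proc.inst_zero, Proc.inst_zero]
  exact .trans (.assoc' _ _ _) (.parR _ (.zero_par _))

/-- Polarity and the public channel rule out all other pairs. Two offers, or two withdrawals, could
carry the same value; they are left over here and excluded by the invariant of the machine. -/
theorem Th.com (hc : ∀ ch : Ch, ch.tree E.a ≠ E.c) {t t' : Th n} {X : Proc n}
    (h : Com (t.proc E) (t'.proc E) X) :
    (∃ O, (React E.s t t' O ∨ React E.s t' t O) ∧ StrEq X (thr E O)) ∨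
      (∃ d d', t = .offer d ∧ t' = .offer d') ∨
      (∃ d x d' x', t = .withdraw d x ∧ t' = .withdraw d' x') := by
  have mm : ∀ {ch D ch' D' X}, ¬ Com (msgP E ch D) (msgP E ch' D') X := fun h => by
    obtain ⟨σ, ρ, hu, -⟩ := com_case h; exact not_unify_msg_msg hu
  have mo : ∀ {ch D d X}, ¬ Com (msgP E ch D) (offerP E d) X := fun h => by
    obtain ⟨σ, ρ, hu, -⟩ := com_case h; exact not_unify_msg_pub hc hu
  have mw : ∀ {ch D d x X}, ¬ Com (msgP E ch D) (withdrawP E d x) X := fun h => by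
    obtain ⟨σ, ρ, hu, -⟩ := com_case h; exact not_unify_msg_pub hc hu
  have ro : ∀ {d X}, ¬ Com (restartP E) (offerP E d) X := fun h => by
    obtain ⟨σ, ρ, hu, -⟩ := com_case h; exact not_unify_rcv_pub hc hu
  have rw : ∀ {d x X}, ¬ Com (restartP E) (withdrawP E d x) X := fun h => by
    obtain ⟨σ, ρ, hu, -⟩ := com_case h; exact not_unify_rcv_pub hc hu
  have co : ∀ {e d X}, ¬ Com (commitP E e) (offerP E d) X := fun h => by
    obtain ⟨σ, ρ, hu, -⟩ := com_case h; exact not_unify_rcv_pub hc hu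
  have cw : ∀ {e d x X}, ¬ Com (commitP E e) (withdrawP E d x) X := fun h => by
    obtain ⟨σ, ρ, hu, -⟩ := com_case h; exact not_unify_rcv_pub hc hu
  have rr : ∀ {X}, ¬ Com (restartP E) (restartP E) X := fun h => by
    obtain ⟨σ, ρ, hu, -⟩ := com_case h; exact not_unify_rcv_rcv hu
  have rc : ∀ {d X}, ¬ Com (restartP E) (commitP E d) X := fun h => by
    obtain ⟨σ, ρ, hu, -⟩ := com_case h; exact not_unify_rcv_rcv hu
  have cc : ∀ {d d' X}, ¬ Com (commitP E d) (commitP E d') X := fun h => by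
    obtain ⟨σ, ρ, hu, -⟩ := com_case h; exact not_unify_rcv_rcv hu
  obtain ⟨Y, h', e⟩ := h.symm
  cases t with
  | msg ch D =>
    cases t' with
    | msg ch' D' => exact absurd h mm
    | offer d => exact absurd h mo
    | withdraw d x => exact absurd h mw
    | restart =>
      obtain ⟨rfl, e⟩ := msg_com_restart h
      exact .inl ⟨_, .inl (.restart _), e⟩
    | commit d =>
      obtain ⟨x, rfl, rfl, e⟩ := msg_com_commit h
      exact .inl ⟨_, .inl (.commit _ _), e⟩
  | offer d =>
    cases t' with
    | msg ch' D' => exact absurd h' mo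
    | offer d' => exact .inr (.inl ⟨_, _, rfl, rfl⟩)
    | withdraw d' x =>
      obtain ⟨rfl, e⟩ := offer_com_withdraw h
      exact .inl ⟨_, .inl (.withdraw _ _), e⟩
    | restart => exact absurd h' ro
    | commit d => exact absurd h' co
  | withdraw d x =>
    cases t' with
    | msg ch' D' => exact absurd h' mw
    | offer d' =>
      obtain ⟨rfl, e'⟩ := offer_com_withdraw h'
      exact .inl ⟨_, .inr (.withdraw _ _), e.symm.trans e'⟩
    | withdraw d' x' => exact .inr (.inr ⟨_, _, _, _, rfl, rfl⟩)
    | restart => exact absurd h' rw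
    | commit d => exact absurd h' cw
  | restart =>
    cases t' with
    | msg ch' D' =>
      obtain ⟨rfl, e'⟩ := msg_com_restart h'
      exact .inl ⟨_, .inr (.restart _), e.symm.trans e'⟩
    | offer d' => exact absurd h ro
    | withdraw d' x' => exact absurd h rw
    | restart => exact absurd h rr
    | commit d => exact absurd h rc
  | commit d =>
    cases t' with
    | msg ch' D' =>
      obtain ⟨x, rfl, rfl, e'⟩ := msg_com_commit h'
      exact .inl ⟨_, .inr (.commit _ _), e.symm.trans e'⟩
    | offer d' => exact absurd h co
    | withdraw d' x' => exact absurd h cw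
    | restart => exact absurd h' rc
    | commit d => exact absurd h cc

theorem Th.not_tau {t : Th n} {X : Proc n} : ¬ Tau (t.proc E) X := by
  cases t <;> exact not_tau_case

theorem Srv.com (hc : ∀ ch : Ch, ch.tree E.a ≠ E.c) {t : Th n} {r : Srv} {X : Proc n}
    (h : Com (t.proc E) (r.proc E) X) :
    ∃ ch D O, t = .msg ch D ∧ Fire E.s E.k ch D O ∧ StrEq X (thr E O) := by
  obtain ⟨Y, h', e⟩ := h.symm
  cases t with
  | msg ch D =>
    obtain ⟨σ, ρ, hu, e⟩ := com_case h
    obtain ⟨rfl, a, l, h1, h2⟩ := unify_msg_rcv hu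
    refine ⟨_, D, _, rfl, Srv.fire (x := E.a) h1, e.trans (.trans (.zero_par _) ?_)⟩
    rw [Srv.proc_inst, h2]
    exact .refl _
  | offer d => obtain ⟨σ, ρ, hu, -⟩ := com_case h'; exact absurd hu (not_unify_rcv_pub hc)
  | withdraw d x => obtain ⟨σ, ρ, hu, -⟩ := com_case h'; exact absurd hu (not_unify_rcv_pub hc)
  | restart => obtain ⟨σ, ρ, hu, -⟩ := com_case h; exact absurd hu not_unify_rcv_rcv
  | commit d => obtain ⟨σ, ρ, hu, -⟩ := com_case h; exact absurd hu not_unify_rcv_rcv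

/-- One copy of the chosen server is unfolded from its replication. -/
theorem servers_absorb (E : Env n) (r : Srv) :
    StrEq (servers E) (.par (r.proc E) (servers E)) := by
  obtain ⟨A, hp⟩ := exists_perm_of_mem r.mem_all
  have e := pars_perm (hp.map fun r => Proc.rep (r.proc E))
  refine e.trans (.trans (.parL _ (.rep_unfold _)) (.trans (.assoc' _ _ _) (.parR _ e.symm)))

theorem com_servers {Q X : Proc n} (h : Com (servers E) Q X) :
    ∃ r X', Com (Srv.proc E r) Q X' ∧ StrEq X (.par X' (servers E)) := by
  obtain ⟨r, A, X1, hp, h, e⟩ := com_pars _ h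
  cases h with
  | rep h =>
    have e' := pars_perm (hp.map fun r => Proc.rep (r.proc E))
    exact ⟨r, _, h, e.trans (.trans (.assoc' _ _ _) (.parR _ e'.symm))⟩

theorem not_tau_servers {X : Proc n} : ¬ Tau (servers E) X := by
  have no : ∀ {r r' X}, ¬ Com (Srv.proc E r) (Srv.proc E r') X := fun h => by
    obtain ⟨σ, ρ, hu, -⟩ := com_case h; exact not_unify_rcv_rcv hu
  intro h
  rcases tau_pars _ h with ⟨r, A, X', -, h, -⟩ | ⟨r, r', A, X', -, h, -⟩
  · cases h with
    | rep h => exact not_tau_case h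
    | repCom h => exact no h
  · cases h with
    | rep h =>
      obtain ⟨Y, h, -⟩ := h.symm
      cases h with
      | rep h => exact no h

theorem com_thr {L : List (Th n)} {Q X : Proc n} (h : Com (thr E L) Q X) :
    ∃ t L₀ X', L.Perm (t :: L₀) ∧ Com (t.proc E) Q X' ∧ StrEq X (.par X' (thr E L₀)) :=
  com_pars _ h

/-- Internal steps of the process are steps of the soup. -/
theorem tau_soup (hc : ∀ ch : Ch, ch.tree E.a ≠ E.c) {L : List (Th n)} {X : Proc n}
    (ho : ∀ d d' L₀, ¬ L.Perm (.offer d :: .offer d' :: L₀))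
    (hw : ∀ d x d' x' L₀, ¬ L.Perm (.withdraw d x :: .withdraw d' x' :: L₀))
    (h : Tau (.par (servers E) (thr E L)) X) :
    ∃ L', SStep E.s E.k L L' ∧ StrEq X (.par (servers E) (thr E L')) := by
  cases h with
  | com h =>
    obtain ⟨r, X1, h, e⟩ := com_servers h
    obtain ⟨X2, h, e2⟩ := h.symm
    obtain ⟨t, L0, X3, hp, h, e3⟩ := com_thr h
    obtain ⟨ch, D, O, rfl, hf, e4⟩ := Srv.com hc h
    refine ⟨O ++ L0, .fire hp hf, e.trans (.trans (.par_comm _ _) (.parR _ ?_))⟩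
    exact e2.symm.trans (e3.trans (.trans (.parL _ e4) (.symm (thr_append _ _ _))))
  | parL _ h => exact absurd h not_tau_servers
  | parR _ h =>
    rcases tau_pars _ h with ⟨t, L0, X', -, h, -⟩ | ⟨t, t', L0, X', hp, h, e⟩
    · exact absurd h Th.not_tau
    · rcases Th.com hc h with ⟨O, h, e'⟩ | ⟨d, d', rfl, rfl⟩ | ⟨d, x, d', x', rfl, rfl⟩
      · have key : ∀ {t t' : Th n}, L.Perm (t :: t' :: L0) → React E.s t t' O →
            SStep E.s E.k L (O ++ L0) := by
          intro t t' hp h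
          cases h with
          | commit d x => exact .commit hp
          | restart x => exact .restart hp
          | withdraw d x => exact .withdraw hp
        refine ⟨O ++ L0, ?_, .parR _ (e.trans (.trans (.parL _ e') (.symm (thr_append _ _ _))))⟩
        rcases h with h | h
        · exact key hp h
        · exact key (hp.trans (.swap _ _ _)) h
      · exact absurd hp (ho _ _ _)
      · exact absurd hp (hw _ _ _ _ _)

theorem red_thr {t t' : Th n} {L L₀ O : List (Th n)} (hp : L.Perm (t :: t' :: L₀))
    (h : Red (.par (t.proc E) (t'.proc E)) (thr E O)) : Red (thr E L) (thr E (O ++ L₀)) := by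
  refine (Red.par (thr E L₀) h).congr ?_ (.symm (thr_append _ _ _))
  exact .trans (.assoc' _ _ _) (thr_perm E hp.symm)

/-- Steps of the soup are steps of the process. -/
theorem SStep.red {L L' : List (Th n)} (h : SStep E.s E.k L L') :
    Red (.par (servers E) (thr E L)) (.par (servers E) (thr E L')) := by
  cases h with
  | @fire ch D O _ L0 hp hf =>
    obtain ⟨r, l, rfl, h1, h2⟩ := hf.srv
    obtain ⟨σ, ρ, hu, h3⟩ := unify_msg_rcv_of (E := E) (ch := r.ch) h1
    have hr : Red (.par (msgP E r.ch D) (r.proc E)) (thr E O) := by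
      refine (Red.comm (.zero) _ hu).congr (.refl _) ?_
      rw [Srv.proc_inst, h3, h2]
      exact .zero_par _
    refine (Red.par (.par (servers E) (thr E L0)) hr).congr ?_ ?_
    · refine .trans (.parL _ (.par_comm _ _)) (.trans (.par_par_comm _ _ _ _) ?_)
      exact .par_congr (.symm (servers_absorb E r)) (thr_perm E hp.symm)
    · exact .trans (.left_comm _ _ _) (.parR _ (.symm (thr_append _ _ _)))
  | @commit d x _ L0 hp =>
    refine Red.parR _ (red_thr (O := [.withdraw d x]) hp ?_)
    have h1 : runify (pl d E.s x).toPat.raw (commitPat E.s d).raw = some ([], [x]) :=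
      runify_comp_of (runify_comp_of (runify_self_of d) (runify_self_of E.s)) (runify_lam_of x)
    obtain ⟨σ, ρ, hu, h3⟩ := unify_msg_rcv_of (E := E) (ch := .rep) h1
    refine (Red.comm (.zero) _ hu).congr (.refl _) (.trans (.zero_par _) ?_)
    have := withdrawP_inst E d ρ
    rw [ofFn_two h3] at this
    show StrEq (.par _ .zero) (.par (withdrawP E d x) .zero)
    rw [← this]
    exact .refl _
  | @restart x _ L0 hp =>
    refine Red.parR _ (red_thr (O := [.msg .ev x]) hp ?_)
    obtain ⟨σ, ρ, hu, h3⟩ := unify_msg_rcv_of (E := E) (ch := .go) (p := .lam) (runify_lam_of x)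
    refine (Red.comm (.zero) _ hu).congr (.refl _) (.trans (.zero_par _) ?_)
    have := msgP_inst E .ev ρ
    rw [ofFn_two h3] at this
    show StrEq (.par _ .zero) (.par (msgP E .ev x) .zero)
    rw [← this]
    exact .refl _
  | @withdraw d x _ L0 hp =>
    refine Red.parR _ (red_thr (O := [.restart, .msg .go x]) hp ?_)
    obtain ⟨σ, ρ, hu⟩ := unify_pub_self E.c d
    refine (Red.comm (j := 0) (k := 0) (.par (restartP E) .zero) (.par (msgP E .go x) .zero) hu).congr
      (.refl _) ?_
    rw [Proc.inst_zero, Proc.inst_zero]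
    exact .trans (.assoc' _ _ _) (.parR _ (.zero_par _))

end

/-! ### States in the scope of the private name -/

theorem CPat.subst_wk {n m : ℕ} (θ : Var n → CPat m) (d : CPat n) :
    (d.subst θ).wk 1 = (d.wk 1).subst (lift θ 1) := (CPat.wk_subst_lift θ 1 d).symm

namespace Ab

variable {n : ℕ}

def wk : Ab n → Ab (n + 1) := Ab.subst (wkS 1)

theorem wk_val (ι : Ab n) : ι.wk.val = ι.val.wk 1 := by
  cases ι <;> exact (CPat.wk_eq_subst 1 _).symm

theorem subst_val {m : ℕ} (θ : Var n → CPat m) (ι : Ab n) : (ι.subst θ).val = ι.val.subst θ := by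
  cases ι <;> rfl

theorem wk_fresh (ι : Ab n) : ι.wk.Fresh ↔ ι.Fresh := by cases ι <;> rfl

theorem subst_fresh {m : ℕ} (θ : Var n → CPat m) (ι : Ab n) : (ι.subst θ).Fresh ↔ ι.Fresh := by
  cases ι <;> rfl

theorem wk_subst_lift {m : ℕ} (θ : Var n → CPat m) (ι : Ab n) :
    ι.wk.subst (lift θ 1) = (ι.subst θ).wk := by
  cases ι <;> simp [wk, subst, ← CPat.wk_eq_subst, CPat.wk_subst_lift]

theorem wk_live (d : CPat n) : (live d).wk = live (d.wk 1) := by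
  simp [wk, subst, CPat.wk_eq_subst]

theorem Tau.subst {m : ℕ} {s k : CPat n} {ι ι' : Ab n} (h : Tau s k ι ι') (θ : Var n → CPat m) :
    Tau (s.subst θ) (k.subst θ) (ι.subst θ) (ι'.subst θ) := by
  cases h with
  | commit h => exact .commit (h.subst θ)
  | withdraw d x => exact .withdraw _ _
  | half h => exact .half (h.subst θ)

theorem Tau.wk {s k : CPat n} {ι ι' : Ab n} (h : Tau s k ι ι') :
    Tau (s.wk 1) (k.wk 1) ι.wk ι'.wk := by
  rw [CPat.wk_eq_subst, CPat.wk_eq_subst]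
  exact h.subst _

theorem Tau.reflect {s k : CPat n} {ι : Ab n} {ι' : Ab (n + 1)}
    (h : Tau (s.wk 1) (k.wk 1) ι.wk ι') : ∃ ι₀, ι' = ι₀.wk ∧ Tau s k ι ι₀ := by
  cases ι with
  | live d =>
    cases h with
    | commit h =>
      obtain ⟨x, rfl, hx⟩ := h.reflect (CPat.wk_eq_subst 1 d).symm
      exact ⟨.com d x, by simp [Ab.wk, Ab.subst, CPat.wk_eq_subst], .commit hx⟩
  | com d x => cases h with
    | withdraw => exact ⟨.live x, rfl, .withdraw _ _⟩
  | half d =>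
    cases h with
    | half h =>
      obtain ⟨x, rfl, hx⟩ := h.reflect (CPat.wk_eq_subst 1 d).symm
      exact ⟨.halfCom d x, by simp [Ab.wk, Ab.subst, CPat.wk_eq_subst], .half hx⟩
  | halfCom d x => cases h

theorem Out.subst {m : ℕ} {ι ι' : Ab n} {d : CPat n} (h : Out ι d ι') (θ : Var n → CPat m) :
    Out (ι.subst θ) (d.subst θ) (ι'.subst θ) := by
  cases h with
  | live d => exact .live _
  | com d x => exact .com _ _
  | halfCom d x => exact .halfCom _ _

theorem Out.wk {ι ι' : Ab n} {d : CPat n} (h : Out ι d ι') : Out ι.wk (d.wk 1) ι'.wk := by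
  rw [CPat.wk_eq_subst]
  exact h.subst _

theorem Out.reflect {ι : Ab n} {d : CPat (n + 1)} {ι' : Ab (n + 1)} (h : Out ι.wk d ι') :
    ∃ d₀ ι₀, d = d₀.wk 1 ∧ ι' = ι₀.wk ∧ Out ι d₀ ι₀ := by
  cases ι with
  | live d => cases h with
    | live => exact ⟨d, _, (CPat.wk_eq_subst 1 d).symm, rfl, .live d⟩
  | com d x => cases h with
    | com => exact ⟨d, .halfCom d x, (CPat.wk_eq_subst 1 d).symm, rfl, .com d x⟩
  | half d => cases h
  | halfCom d x => cases h with
    | halfCom => exact ⟨d, .live x, (CPat.wk_eq_subst 1 d).symm, rfl, .halfCom d x⟩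

theorem Out.val_eq {ι ι' : Ab n} {d : CPat n} (h : Out ι d ι') : d = ι.val := by cases h <;> rfl

end Ab

theorem pubPat_wk {n : ℕ} (c d : CPat n) :
    (pubPat c d).subst (wkS 1) = pubPat (c.wk 1) (d.wk 1) := by
  rw [pubPat_subst, CPat.wk_eq_subst, CPat.wk_eq_subst]

/-! ### Protected names of public patterns -/

theorem last_notMem_pv_wk {n : ℕ} (c : CPat n) :
    .bound (Fin.natAdd n (0 : Fin 1)) ∉ (c.wk 1).toProt.pv := by
  rw [CPat.wk_eq_subst, ← CPat.toProt_subst, wkS, renS_eq_vren, pv_vren]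
  rintro ⟨x, -, h⟩
  cases x with
  | free a => simp [Var.map] at h
  | bound i => simp only [Var.map, Var.bound.injEq] at h; exact last_notMem n 0 ⟨i, h⟩

theorem mem_pv_tree {n : ℕ} (x : Var n) (ch : Ch) : x ∈ (ch.tree (.nm x)).toProt.pv := by
  cases ch <;> simp [Ch.tree, CPat.toProt, Pat.pv]

/-- The channel comes from outside the restriction and cannot contain the private name, while every
tree contains it. -/
theorem tree_ne_channel {n : ℕ} (c s k : CPat n) (ch : Ch) :
    ch.tree (coreEnv c s k).a ≠ (coreEnv c s k).c := fun h => by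
  have := mem_pv_tree (.bound (Fin.natAdd n (0 : Fin 1))) ch
  refine last_notMem_pv_wk c ?_
  rw [show c.wk 1 = ch.tree (coreEnv c s k).a from h.symm]
  exact this

theorem mem_pv_rcvPat {n j : ℕ} (c s k : CPat n) (ch : Ch) (p : Pat (n + 1) j) :
    .bound (Fin.natAdd n (0 : Fin 1)) ∈ (rcvPat (coreEnv c s k) ch p).pv :=
  .inl (mem_pv_tree _ ch)

theorem mem_pv_msgPat {n : ℕ} (c s k : CPat n) (ch : Ch) (D : CPat (n + 1)) :
    .bound (Fin.natAdd n (0 : Fin 1)) ∈ (msgPat (coreEnv c s k) ch D).pv :=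
  .inl (mem_pv_tree _ ch)

/-! ### The behaviour of the machine -/

theorem core_perm {n : ℕ} (c s k : CPat n) {L L' : List (Th (n + 1))} (h : L.Perm L') :
    StrEq (core c s k L) (core c s k L') := .res_congr (.parR _ (thr_perm _ h))

/-- The soup lives under the private name, but its abstract state does not mention that name;
reflecting along the weakening expresses the step in the outer scope. -/
theorem core_tau {n : ℕ} {c s k : CPat n} {ι : Ab n} {N : ℕ} {L : List (Th (n + 1))} {X : Proc n}
    (hi : Inv (s.wk 1) (k.wk 1) ι.wk N L) (h : Tau (core c s k L) X) :
    ∃ ι' N' L', StrEq X (core c s k L') ∧ Inv (s.wk 1) (k.wk 1) ι'.wk N' L' ∧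
      ((ι' = ι ∧ N' < N) ∨ (Ab.Tau s k ι ι' ∧
        ((ι.val = ι'.val ∧ N' < N) ∨ (ι.Fresh ∧ CStep s k ι.val ι'.val)))) := by
  cases h with
  | res h =>
    obtain ⟨L', hs, e⟩ := tau_soup (tree_ne_channel c s k) (fun _ _ _ => hi.offer_unique)
      (fun _ _ _ _ _ => hi.withdraw_unique) h
    obtain ⟨ι', N', hi', hd⟩ := hi.tau hs
    rcases hd with ⟨rfl, hN⟩ | ⟨ht, hd⟩
    · exact ⟨ι, N', L', .res_congr e, hi', .inl ⟨rfl, hN⟩⟩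
    · obtain ⟨ι₀, rfl, ht'⟩ := ht.reflect
      refine ⟨ι₀, N', L', .res_congr e, hi', .inr ⟨ht', ?_⟩⟩
      rw [Ab.wk_val, Ab.wk_val, Ab.wk_fresh] at hd
      refine hd.imp (fun h => ⟨CPat.wk_inj h.1, h.2⟩) (fun h => ⟨h.1, ?_⟩)
      obtain ⟨e', h1, h2⟩ := h.2.reflect rfl
      rw [CPat.wk_inj h1]
      exact h2

theorem SSteps.wk {n : ℕ} {c s k : CPat n} {L L' : List (Th (n + 1))}
    (h : SSteps (s.wk 1) (k.wk 1) L L') : Wk (core c s k L) (core c s k L') := by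
  induction h with
  | refl => exact .refl _
  | tail _ h ih => exact ih.trans (.of_red (.res (SStep.red (E := coreEnv c s k) h)))

theorem core_realize {n : ℕ} {c s k : CPat n} {ι ι' : Ab n} {N : ℕ} {L : List (Th (n + 1))}
    (hi : Inv (s.wk 1) (k.wk 1) ι.wk N L) (h : Ab.Tau s k ι ι') :
    ∃ N' L', Wk (core c s k L) (core c s k L') ∧ Inv (s.wk 1) (k.wk 1) ι'.wk N' L' := by
  obtain ⟨L', N', hs, hi'⟩ := hi.realize h.wk
  exact ⟨N', L', hs.wk, hi'⟩

theorem Emit.outS {n : ℕ} {c s k d : CPat n} {L L' : List (Th (n + 1))}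
    (h : Emit L (d.wk 1) L') : ∃ T₀ T', StrEq (core c s k L) T₀ ∧ OutS T₀ (pubPat c d) T' ∧
      StrEq T' (core c s k L') := by
  cases h with
  | offer hp =>
    refine ⟨_, _, core_perm c s k hp, .res ?_, .res_congr (.parR _ (.parL _ (.par_zero _)))⟩
    rw [pubPat_wk]
    exact .parR _ (.parL _ (.case _ _))
  | withdraw hp =>
    refine ⟨_, _, core_perm c s k hp, .res ?_, .res_congr (.parR _ (.parL _ (.par_zero _)))⟩
    rw [pubPat_wk]
    exact .parR _ (.parL _ (.case _ _))

theorem core_realize_out {n : ℕ} {c s k d : CPat n} {ι ι' : Ab n} {N : ℕ} {L : List (Th (n + 1))}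
    (hi : Inv (s.wk 1) (k.wk 1) ι.wk N L) (h : Ab.Out ι d ι') :
    ∃ T₀ T' N' L', Wk (core c s k L) T₀ ∧ OutS T₀ (pubPat c d) T' ∧ StrEq T' (core c s k L') ∧
      Inv (s.wk 1) (k.wk 1) ι'.wk N' L' := by
  obtain ⟨L₁, L', N', hs, he, hi'⟩ := hi.realize_out h.wk
  obtain ⟨T₀, T', e, ho, e'⟩ := he.outS (c := c) (s := s) (k := k)
  exact ⟨T₀, T', N', L', hs.wk.trans (.of_strEq e), ho, e', hi'⟩

theorem core_emit {n : ℕ} {c s k : CPat n} {ι : Ab n} {N : ℕ} {L L' : List (Th (n + 1))}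
    {d : CPat (n + 1)} (hi : Inv (s.wk 1) (k.wk 1) ι.wk N L) (he : Emit L d L')
    {Q : Proc n} {D X : Proc (n + 1)}
    (h : Int (k := 0) (Q.subst (wkS 1)) (pubPat (c.wk 1) d) D X) :
    ∃ d₀ ι' N' X₀, Ab.Out ι d₀ ι' ∧ Inv (s.wk 1) (k.wk 1) ι'.wk N' L' ∧ (ι.Fresh → N' = N) ∧
      Int (k := 0) Q (pubPat c d₀) .zero X₀ ∧ StrEq X (.par (X₀.subst (wkS 1)) D) := by
  obtain ⟨X', h', e⟩ := h.zero_cont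
  obtain ⟨ι', N', ho, hi', hf⟩ := hi.emit he
  obtain ⟨d₀, ι₀, rfl, rfl, ho'⟩ := ho.reflect
  obtain ⟨X₀, hX, rfl⟩ := h'.reflect (castAdd_inj n) Q (pubPat c d₀) .zero rfl (pubPat_wk c d₀) rfl
  exact ⟨d₀, ι₀, N', X₀, ho', hi', fun h => hf ((Ab.wk_fresh ι).2 h), hX, e⟩

theorem core_com_residual {n : ℕ} {c s k : CPat n} {t : Th (n + 1)} {L₀ : List (Th (n + 1))}
    {X₀ : Proc n} {X' X : Proc (n + 1)}
    (e' : StrEq X' (.par (X₀.subst (wkS 1)) (.par (t.proc (coreEnv c s k)) .zero)))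
    (e : StrEq X (.par X' (thr (coreEnv c s k) L₀))) :
    StrEq (.res (.par (servers (coreEnv c s k)) X)) (.par (core c s k (t :: L₀)) X₀) := by
  refine .trans (.res_congr (.trans (.parR _ (e.trans (.parL _ e'))) ?_))
    (.symm (.extrudeL _ _))
  refine .trans (.parR _ (.assoc' _ _ _)) (.trans (.left_comm _ _ _) (.trans (.par_comm _ _) ?_))
  exact .parL _ (.parR _ (.parL _ (.par_zero _)))

/-- Servers, messages and private receivers protect the private name, which the partner does not
know (`not_int_wk`). Only offers and withdrawals remain. -/
theorem core_com {n : ℕ} {c s k : CPat n} {ι : Ab n} {N : ℕ} {L : List (Th (n + 1))}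
    {Q X : Proc n} (hi : Inv (s.wk 1) (k.wk 1) ι.wk N L) (h : Com (core c s k L) Q X) :
    ∃ d ι' N' L' X₀, Ab.Out ι d ι' ∧ Inv (s.wk 1) (k.wk 1) ι'.wk N' L' ∧ (ι.Fresh → N' = N) ∧
      Int (k := 0) Q (pubPat c d) .zero X₀ ∧ StrEq X (.par (core c s k L') X₀) := by
  cases h with
  | res h =>
    cases h with
    | parL _ h =>
      obtain ⟨r, X', h, -⟩ := com_servers h
      cases h with
      | case h => exact absurd h (not_int_wk (mem_pv_rcvPat _ _ _ _ _))
    | parR _ h =>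
      obtain ⟨t, L₀, X', hp, h, e⟩ := com_thr h
      cases t with
      | msg ch D => cases h with
        | case h => exact absurd h (not_int_wk (mem_pv_msgPat _ _ _ _ _))
      | restart => cases h with
        | case h => exact absurd h (not_int_wk (mem_pv_rcvPat _ _ _ _ _))
      | commit d => cases h with
        | case h => exact absurd h (not_int_wk (mem_pv_rcvPat _ _ _ _ _))
      | offer d => cases h with
        | case h =>
          obtain ⟨d₀, ι', N', X₀, h1, h2, h3, h4, h5⟩ := core_emit hi (.offer hp) h
          exact ⟨d₀, ι', N', _, X₀, h1, h2, h3, h4, core_com_residual h5 e⟩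
      | withdraw d x => cases h with
        | case h =>
          obtain ⟨d₀, ι', N', X₀, h1, h2, h3, h4, h5⟩ := core_emit hi (.withdraw hp) h
          exact ⟨d₀, ι', N', _, X₀, h1, h2, h3, h4, core_com_residual h5 e⟩

theorem not_hasOk_core {n : ℕ} (c s k : CPat n) (L : List (Th (n + 1))) :
    ¬ HasOk (core c s k L) := by
  rw [core, hasOk_res, hasOk_par]
  rintro (h | h)
  · exact not_hasOk_pars _ (fun r h => not_hasOk_case _ _ (hasOk_rep.1 h)) _ h
  · refine not_hasOk_pars _ (fun t h => ?_) _ h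
    cases t <;> exact not_hasOk_case _ _ h

/-- The sets of names of a barb on `c • d`. -/
theorem sb_pubPat {n : ℕ} {c d : CPat n} {A B : Set Name} {C : Proc n}
    (h : SB (.caseOf (pubPat c d) C) A B) :
    (∀ i, .bound i ∉ (pubPat c d).pv) ∧ A = {a | .free a ∈ (pubPat c d).pv} ∧
      B = {a | .free a ∈ (pubPat c d).av} := SB_case.1 h

theorem OutS.sb {n : ℕ} {T T' : Proc n} {p : Pat n 0} (h : OutS T p T') :
    (∀ i, .bound i ∉ p.pv) → SB T {a | .free a ∈ p.pv} {a | .free a ∈ p.av} := by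
  induction h with
  | case p C => exact fun h => .case (k := 0) C h
  | parL _ _ ih => exact fun h => .parL _ (ih h)
  | parR _ _ ih => exact fun h => .parR _ (ih h)
  | rep _ ih => exact fun h => .rep (ih h)
  | @res n P P' p _ ih =>
    intro h
    refine .res ?_
    have := ih (by rw [wkS, renS_eq_vren, pv_vren, bound_mem_map]; exact h)
    simp only [wkS, renS_eq_vren, pv_vren, av_vren, free_mem_map] at this
    exact this

theorem core_sb {n : ℕ} {c s k : CPat n} {ι : Ab n} {N : ℕ} {L : List (Th (n + 1))}
    {A B : Set Name} (hi : Inv (s.wk 1) (k.wk 1) ι.wk N L) (h : SB (core c s k L) A B) :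
    ∃ d ι', Ab.Out ι d ι' ∧ (∀ i, .bound i ∉ (pubPat c d).pv) ∧
      A = {a | .free a ∈ (pubPat c d).pv} ∧ B = {a | .free a ∈ (pubPat c d).av} := by
  rw [core, SB_res, SB_par] at h
  rcases h with h | h
  · obtain ⟨r, -, -, h⟩ := sb_pars _ h
    exact absurd (mem_pv_rcvPat c s k _ _) ((SB_case.1 (SB_rep.1 h)).1 _)
  · obtain ⟨t, L₀, hp, h⟩ := sb_pars _ h
    have out : ∀ {d : CPat (n + 1)} {L' : List (Th (n + 1))} {C : Proc (n + 1)}, Emit L d L' →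
        SB (.caseOf (pubPat (c.wk 1) d) C) A B → ∃ d ι', Ab.Out ι d ι' ∧
        (∀ i, .bound i ∉ (pubPat c d).pv) ∧ A = {a | .free a ∈ (pubPat c d).pv} ∧
          B = {a | .free a ∈ (pubPat c d).av} := by
      intro d L' C he h
      obtain ⟨ι', N', ho, -⟩ := hi.emit he
      obtain ⟨d₀, ι₀, rfl, rfl, ho'⟩ := ho.reflect
      have := sb_pubPat h
      rw [← pubPat_wk] at this
      simp only [wkS, renS_eq_vren, pv_vren, av_vren, free_mem_map, bound_mem_map] at this
      exact ⟨d₀, ι₀, ho', this⟩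
    cases t with
    | msg ch D => exact absurd (mem_pv_msgPat c s k _ _) ((SB_case.1 h).1 _)
    | restart => exact absurd (mem_pv_rcvPat c s k _ _) ((SB_case.1 h).1 _)
    | commit d => exact absurd (mem_pv_rcvPat c s k _ _) ((SB_case.1 h).1 _)
    | offer d => exact out (.offer hp) h
    | withdraw d x => exact out (.withdraw hp) h

/-! ### Collectors -/

/-- The machine that starts with the value `d`. -/
def start {n : ℕ} (c s k d : CPat n) : Proc n := core c s k [.msg .ev (d.wk 1)]

theorem start_subst {n m : ℕ} (θ : Var n → CPat m) (c s k d : CPat n) :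
    (start c s k d).subst θ = start (c.subst θ) (s.subst θ) (k.subst θ) (d.subst θ) := by
  rw [start, core_subst, start, CPat.subst_wk]
  rfl

def colPat {n : ℕ} (a : CPat n) : Pat n (0 + 1) := .comp a.toProt .lam

/-- Collects the right component `y` on `b` and starts with `x • y`. -/
def colR {n : ℕ} (b c s k x : CPat n) : Proc n :=
  .caseOf (colPat b) (start (c.wk _) (s.wk _) (k.wk _) (.comp (x.wk _) (bv n (0 : Fin (0 + 1)))))

/-- Collects the left component on `a` and then the right component on `b`. -/
def colL {n : ℕ} (a b c s k : CPat n) : Proc n :=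
  .caseOf (colPat a) (colR (b.wk _) (c.wk _) (s.wk _) (k.wk _) (bv n (0 : Fin (0 + 1))))

theorem colPat_subst {n m : ℕ} (θ : Var n → CPat m) (a : CPat n) :
    (colPat a).subst θ = colPat (a.subst θ) := by
  show Pat.comp _ _ = Pat.comp _ _
  rw [CPat.toProt_subst]
  rfl

theorem colR_subst {n m : ℕ} (θ : Var n → CPat m) (b c s k x : CPat n) :
    (colR b c s k x).subst θ =
      colR (b.subst θ) (c.subst θ) (s.subst θ) (k.subst θ) (x.subst θ) := by
  simp only [colR, Proc.subst, colPat_subst, start_subst, CPat.wk_subst_lift, CPat.subst]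
  congr 3
  exact bv_subst_lift θ _

theorem colL_subst {n m : ℕ} (θ : Var n → CPat m) (a b c s k : CPat n) :
    (colL a b c s k).subst θ =
      colL (a.subst θ) (b.subst θ) (c.subst θ) (s.subst θ) (k.subst θ) := by
  simp only [colL, Proc.subst, colPat_subst, colR_subst, CPat.wk_subst_lift]
  congr 2
  exact bv_subst_lift θ _

theorem colR_inst {n : ℕ} (c s k x : CPat n) (σ : Fin (0 + 1) → CPat n) :
    (start (c.wk (0 + 1)) (s.wk _) (k.wk _) (.comp (x.wk _) (bv n (0 : Fin (0 + 1))))).inst σ =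
      start c s k (.comp x (σ 0)) := by
  rw [Proc.inst_eq, start_subst]
  simp only [CPat.subst, CPat.wk_subst_instS, bv_subst_instS]

theorem colL_inst {n : ℕ} (b c s k : CPat n) (σ : Fin (0 + 1) → CPat n) :
    (colR (b.wk (0 + 1)) (c.wk _) (s.wk _) (k.wk _) (bv n (0 : Fin (0 + 1)))).inst σ =
      colR b c s k (σ 0) := by
  rw [Proc.inst_eq, colR_subst]
  simp only [CPat.wk_subst_instS, bv_subst_instS]

theorem unify_col_pub {n : ℕ} {g c d : CPat n} {σ ρ} (h : Unify (colPat g) (pubPat c d) σ ρ) :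
    g = c ∧ σ 0 = d := by
  obtain ⟨_, _, _, _, h1, h2, e, -⟩ := runify_comp_some.1 (Unify_iff.1 h)
  obtain ⟨rfl, rfl, rfl⟩ := runify_toProt_toProt.1 h1
  obtain ⟨rfl, -⟩ := runify_lam_toPat.1 h2
  refine ⟨rfl, ?_⟩
  simpa using e

theorem unify_col_pub_of {n : ℕ} (c d : CPat n) :
    ∃ σ ρ, Unify (colPat c) (pubPat c d) σ ρ ∧ σ 0 = d := by
  obtain ⟨σ, ρ, h, -⟩ := Unify.of_list (p := colPat c) (q := pubPat c d)
    (runify_comp_some.2 ⟨_, _, _, _, runify_toProt_toProt.2 ⟨rfl, rfl, rfl⟩,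
      runify_lam_toPat.2 ⟨rfl, rfl⟩, rfl, rfl⟩)
  exact ⟨σ, ρ, h, (unify_col_pub h).2⟩

/-! ### Trees of machines -/

/-- Channels of the two components of an application. -/
def chL (n : ℕ) : CPat (n + 1 + 1) := (bv n (0 : Fin 1)).wk 1

def chR (n : ℕ) : CPat (n + 1 + 1) := bv (n + 1) (0 : Fin 1)

def CPat.w2 {n : ℕ} (d : CPat n) : CPat (n + 1 + 1) := (d.wk 1).wk 1

theorem CPat.w2_subst {n m : ℕ} (θ : Var n → CPat m) (d : CPat n) :
    d.w2.subst (lift (lift θ 1) 1) = (d.subst θ).w2 := by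
  simp only [CPat.w2, CPat.wk_subst_lift]

theorem chL_subst {n m : ℕ} (θ : Var n → CPat m) : (chL n).subst (lift (lift θ 1) 1) = chL m := by
  simp only [chL, CPat.wk_subst_lift, bv_subst_lift]

theorem chR_subst {n m : ℕ} (θ : Var n → CPat m) : (chR n).subst (lift (lift θ 1) 1) = chR m :=
  bv_subst_lift _ _

theorem chL_ne_chR (n : ℕ) : chL n ≠ chR n := fun h => by
  simp only [chL, chR, bv, CPat.wk, Var.wk, CPat.nm.injEq, Var.bound.injEq] at h
  exact last_notMem (n + 1) 0 ⟨_, h⟩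

theorem CStep.reflect_w2 {n : ℕ} {s k d : CPat n} {d' e' : CPat (n + 1 + 1)}
    (h : CStep s.w2 k.w2 d' e') (hd : d' = d.w2) : ∃ e, e' = e.w2 ∧ CStep s k d e := by
  obtain ⟨e1, rfl, h1⟩ := h.reflect hd
  obtain ⟨e2, rfl, h2⟩ := h1.reflect rfl
  exact ⟨e2, rfl, h2⟩

/-- A collector with the processes for the components. -/
def node {n : ℕ} (G T₁ T₂ : Proc (n + 1 + 1)) : Proc n := .res (.res (.par (.par G T₁) T₂))

def waitL {n : ℕ} (c s k : CPat n) : Proc (n + 1 + 1) := colL (chL n) (chR n) c.w2 s.w2 k.w2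

def waitR {n : ℕ} (c s k x : CPat n) : Proc (n + 1 + 1) := colR (chR n) c.w2 s.w2 k.w2 x.w2

/-- `Rep c s k ι N T`: the process `T` on the channel `c` is in the state `ι`, and can do at most
`N` internal steps before a genuine reduction step. -/
inductive Rep : {n : ℕ} → CPat n → CPat n → CPat n → Ab n → ℕ → Proc n → Prop
  | core {n : ℕ} {c s k : CPat n} {ι : Ab n} {N : ℕ} {L : List (Th (n + 1))} :
      Inv (s.wk 1) (k.wk 1) ι.wk N L → Rep c s k ι N (core c s k L)
  | left {n : ℕ} {c s k x y : CPat n} {ι₁ ι₂ : Ab (n + 1 + 1)} {N₁ N₂ : ℕ}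
      {T₁ T₂ : Proc (n + 1 + 1)} : Rep (chL n) s.w2 k.w2 ι₁ N₁ T₁ → Rep (chR n) s.w2 k.w2 ι₂ N₂ T₂ →
      ι₁.Fresh → ι₂.Fresh → ι₁.val = x.w2 → ι₂.val = y.w2 →
      -- The `2` pays for the two inputs of the collector, and `wev` for the machine that it starts.
      -- Only the values that the components show count for the abstract state, not their
      -- commitments.
      Rep c s k (.live (.comp x y)) (wev (s.wk 1) ((CPat.comp x y).wk 1) + N₁ + N₂ + 2)
        (node (waitL c s k) T₁ T₂)
  | right {n : ℕ} {c s k x y : CPat n} {ι₁ ι₂ : Ab (n + 1 + 1)} {N₁ N₂ : ℕ}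
      {T₁ T₂ : Proc (n + 1 + 1)} : Rep (chL n) s.w2 k.w2 ι₁ N₁ T₁ → Rep (chR n) s.w2 k.w2 ι₂ N₂ T₂ →
      -- The first component has been read: its value `x` is fixed in the collector, and its later
      -- state is irrelevant.
      ¬ ι₁.Fresh → ι₂.Fresh → ι₂.val = y.w2 →
      Rep c s k (.live (.comp x y)) (wev (s.wk 1) ((CPat.comp x y).wk 1) + N₁ + N₂ + 1)
        (node (waitR c s k x) T₁ T₂)
  -- Both components have been read and nobody listens on their channels any more; they stay as
  -- leftovers beside the machine and count only for the measure.
  | done {n : ℕ} {c s k : CPat n} {ι : Ab n} {ι₁ ι₂ : Ab (n + 1 + 1)} {N N₁ N₂ : ℕ} {T : Proc n}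
      {T₁ T₂ : Proc (n + 1 + 1)} : Rep c s k ι N T →
      Rep (chL n) s.w2 k.w2 ι₁ N₁ T₁ → Rep (chR n) s.w2 k.w2 ι₂ N₂ T₂ → ¬ ι₁.Fresh → ¬ ι₂.Fresh →
      Rep c s k ι (N + N₁ + N₂) (.par T (node .zero T₁ T₂))
  | str {n : ℕ} {c s k : CPat n} {ι : Ab n} {N : ℕ} {T T' : Proc n} :
      Rep c s k ι N T → StrEq T T' → Rep c s k ι N T'

theorem Rep.start {n : ℕ} (c s k d : CPat n) :
    Rep c s k (.live d) (wev (s.wk 1) (d.wk 1)) (start c s k d) := by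
  refine .core ?_
  rw [Ab.wk_live]
  exact .ev (B := []) (.refl _) (by simp)

theorem waitL_subst {n m : ℕ} (θ : Var n → CPat m) (c s k : CPat n) :
    (waitL c s k).subst (lift (lift θ 1) 1) = waitL (c.subst θ) (s.subst θ) (k.subst θ) := by
  simp only [waitL, colL_subst, chL_subst, chR_subst, CPat.w2_subst]

theorem waitR_subst {n m : ℕ} (θ : Var n → CPat m) (c s k x : CPat n) :
    (waitR c s k x).subst (lift (lift θ 1) 1) =
      waitR (c.subst θ) (s.subst θ) (k.subst θ) (x.subst θ) := by
  simp only [waitR, colR_subst, chR_subst, CPat.w2_subst]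

theorem node_subst {n m : ℕ} (θ : Var n → CPat m) (G T₁ T₂ : Proc (n + 1 + 1)) :
    (node G T₁ T₂).subst θ = node (G.subst (lift (lift θ 1) 1)) (T₁.subst (lift (lift θ 1) 1))
      (T₂.subst (lift (lift θ 1) 1)) := rfl

/-- The measure is not preserved, since substitution enlarges the patterns; congruence only needs
some measure. -/
theorem Rep.subst {n : ℕ} {c s k : CPat n} {ι : Ab n} {N : ℕ} {T : Proc n} (h : Rep c s k ι N T) :
    ∀ {m : ℕ} (θ : Var n → CPat m),
      ∃ N', Rep (c.subst θ) (s.subst θ) (k.subst θ) (ι.subst θ) N' (T.subst θ) := by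
  induction h with
  | core hi =>
    intro m θ
    obtain ⟨N', hi'⟩ := hi.subst (lift θ 1)
    rw [CPat.wk_subst_lift, CPat.wk_subst_lift, Ab.wk_subst_lift] at hi'
    rw [core_subst]
    exact ⟨N', .core hi'⟩
  | left _ _ h1 h2 h3 h4 ih1 ih2 =>
    intro m θ
    obtain ⟨N1, ih1⟩ := ih1 (lift (lift θ 1) 1)
    obtain ⟨N2, ih2⟩ := ih2 (lift (lift θ 1) 1)
    rw [chL_subst, CPat.w2_subst, CPat.w2_subst] at ih1
    rw [chR_subst, CPat.w2_subst, CPat.w2_subst] at ih2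
    rw [node_subst, waitL_subst]
    exact ⟨_, .left ih1 ih2 ((Ab.subst_fresh _ _).2 h1) ((Ab.subst_fresh _ _).2 h2)
      (by rw [Ab.subst_val, h3, CPat.w2_subst]) (by rw [Ab.subst_val, h4, CPat.w2_subst])⟩
  | right _ _ h1 h2 h4 ih1 ih2 =>
    intro m θ
    obtain ⟨N1, ih1⟩ := ih1 (lift (lift θ 1) 1)
    obtain ⟨N2, ih2⟩ := ih2 (lift (lift θ 1) 1)
    rw [chL_subst, CPat.w2_subst, CPat.w2_subst] at ih1
    rw [chR_subst, CPat.w2_subst, CPat.w2_subst] at ih2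
    rw [node_subst, waitR_subst]
    exact ⟨_, .right ih1 ih2 (mt (Ab.subst_fresh _ _).1 h1) ((Ab.subst_fresh _ _).2 h2)
      (by rw [Ab.subst_val, h4, CPat.w2_subst])⟩
  | done _ _ _ h1 h2 ih ih1 ih2 =>
    intro m θ
    obtain ⟨N, ih⟩ := ih θ
    obtain ⟨N1, ih1⟩ := ih1 (lift (lift θ 1) 1)
    obtain ⟨N2, ih2⟩ := ih2 (lift (lift θ 1) 1)
    rw [chL_subst, CPat.w2_subst, CPat.w2_subst] at ih1
    rw [chR_subst, CPat.w2_subst, CPat.w2_subst] at ih2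
    exact ⟨_, .done ih ih1 ih2 (mt (Ab.subst_fresh _ _).1 h1) (mt (Ab.subst_fresh _ _).1 h2)⟩
  | str _ e ih =>
    intro m θ
    obtain ⟨N, ih⟩ := ih θ
    exact ⟨N, .str ih (e.subst θ)⟩

theorem Rep.not_hasOk {n : ℕ} {c s k : CPat n} {ι : Ab n} {N : ℕ} {T : Proc n}
    (h : Rep c s k ι N T) : ¬ HasOk T := by
  induction h with
  | core _ => exact not_hasOk_core _ _ _ _
  | left _ _ _ _ _ _ ih1 ih2 =>
    rw [node, hasOk_res, hasOk_res, hasOk_par, hasOk_par]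
    rintro ((h | h) | h)
    · exact not_hasOk_case _ _ h
    · exact ih1 h
    · exact ih2 h
  | right _ _ _ _ _ ih1 ih2 =>
    rw [node, hasOk_res, hasOk_res, hasOk_par, hasOk_par]
    rintro ((h | h) | h)
    · exact not_hasOk_case _ _ h
    · exact ih1 h
    · exact ih2 h
  | done _ _ _ _ _ ih ih1 ih2 =>
    rw [hasOk_par, node, hasOk_res, hasOk_res, hasOk_par, hasOk_par]
    rintro (h | ((h | h) | h))
    · exact ih h
    · exact not_hasOk_zero h
    · exact ih1 h
    · exact ih2 h
  | str _ e ih => exact fun h => ih ((HasOk.congr e).2 h)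

/-! ### Interaction with the environment -/

theorem mem_pv_chL (n : ℕ) :
    .bound (Fin.castAdd 1 (Fin.natAdd n (0 : Fin 1))) ∈ (chL n).toProt.pv := rfl

theorem mem_pv_chR (n : ℕ) : .bound (Fin.natAdd (n + 1) (0 : Fin 1)) ∈ (chR n).toProt.pv := rfl

theorem not_int_chL {n k : ℕ} {Q : Proc n} {X : Proc (n + 1 + 1)} {q : Pat (n + 1 + 1) k}
    {D : Proc (n + 1 + 1 + k)} (hq : (chL n).toProt.pv ⊆ q.pv) :
    ¬ Int ((Q.subst (wkS 1)).subst (wkS 1)) q D X := by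
  intro h
  obtain ⟨j, hj⟩ := h.known (f := Fin.castAdd 1 ∘ Fin.castAdd 1) Q
    (by rw [wkS, wkS, Proc.subst_subst, renS_subst_renS]) _ (hq (mem_pv_chL n))
  exact last_notMem n 0 ⟨j, Fin.castAdd_injective _ _ hj⟩

theorem not_int_chR {n k : ℕ} {Q : Proc n} {X : Proc (n + 1 + 1)} {q : Pat (n + 1 + 1) k}
    {D : Proc (n + 1 + 1 + k)} (hq : (chR n).toProt.pv ⊆ q.pv) :
    ¬ Int ((Q.subst (wkS 1)).subst (wkS 1)) q D X :=
  not_int_wk (hq (mem_pv_chR n))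

/-- Collectors and components speak only on restricted, protected channels, so the environment
reaches nothing but the top machine. -/
theorem Rep.com {n : ℕ} {c s k : CPat n} {ι : Ab n} {N : ℕ} {T : Proc n} (h : Rep c s k ι N T) :
    ∀ {Q X : Proc n}, Com T Q X → ∃ d ι' N' T' X₀, Ab.Out ι d ι' ∧ Rep c s k ι' N' T' ∧
      (ι.Fresh → N' = N) ∧ Int (k := 0) Q (pubPat c d) .zero X₀ ∧ StrEq X (.par T' X₀) := by
  induction h with
  | core hi =>
    intro Q X h
    obtain ⟨d, ι', N', L', X₀, h1, h2, h3, h4, h5⟩ := core_com hi h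
    exact ⟨d, ι', N', _, X₀, h1, .core h2, h3, h4, h5⟩
  | left _ _ _ _ _ _ ih1 ih2 =>
    intro Q X h
    cases h with
    | res h => cases h with
      | res h => cases h with
        | parL _ h => cases h with
          | parL _ h => cases h with
            | case h => exact absurd h (not_int_chL Set.subset_union_left)
          | parR _ h =>
            obtain ⟨d, _, _, _, _, -, -, -, h, -⟩ := ih1 h
            exact absurd h (not_int_chL Set.subset_union_left)
        | parR _ h =>
          obtain ⟨d, _, _, _, _, -, -, -, h, -⟩ := ih2 h
          exact absurd h (not_int_chR Set.subset_union_left)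
  | right _ _ _ _ _ ih1 ih2 =>
    intro Q X h
    cases h with
    | res h => cases h with
      | res h => cases h with
        | parL _ h => cases h with
          | parL _ h => cases h with
            | case h => exact absurd h (not_int_chR Set.subset_union_left)
          | parR _ h =>
            obtain ⟨d, _, _, _, _, -, -, -, h, -⟩ := ih1 h
            exact absurd h (not_int_chL Set.subset_union_left)
        | parR _ h =>
          obtain ⟨d, _, _, _, _, -, -, -, h, -⟩ := ih2 h
          exact absurd h (not_int_chR Set.subset_union_left)
  | done _ r1 r2 h1 h2 ih ih1 ih2 =>
    intro Q X h
    cases h with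
    | parL _ h =>
      obtain ⟨d, ι', N', T', X₀, ho, hr, hf, hX, e⟩ := ih h
      exact ⟨d, ι', _, _, X₀, ho, .done hr r1 r2 h1 h2, fun h => by rw [hf h], hX,
        .trans (.parL _ e) (.right_comm _ _ _)⟩
    | parR _ h => cases h with
      | res h => cases h with
        | res h => cases h with
          | parL _ h => cases h with
            | parL _ h => cases h
            | parR _ h =>
              obtain ⟨d, _, _, _, _, -, -, -, h, -⟩ := ih1 h
              exact absurd h (not_int_chL Set.subset_union_left)
          | parR _ h =>
            obtain ⟨d, _, _, _, _, -, -, -, h, -⟩ := ih2 h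
            exact absurd h (not_int_chR Set.subset_union_left)
  | str _ e ih =>
    intro Q X h
    obtain ⟨X', h', e'⟩ := h.congr_left e.symm
    obtain ⟨d, ι', N', T', X₀, ho, hr, hf, hX, e1⟩ := ih h'
    exact ⟨d, ι', N', T', X₀, ho, hr, hf, hX, e'.trans e1⟩

theorem Rep.sb {n : ℕ} {c s k : CPat n} {ι : Ab n} {N : ℕ} {T : Proc n} {A B : Set Name}
    (h : Rep c s k ι N T) : SB T A B → ∃ d ι', Ab.Out ι d ι' ∧ (∀ i, .bound i ∉ (pubPat c d).pv) ∧
      A = {a | .free a ∈ (pubPat c d).pv} ∧ B = {a | .free a ∈ (pubPat c d).av} := by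
  induction h with
  | core hi => exact core_sb hi
  | left _ _ _ _ _ _ ih1 ih2 =>
    intro h
    rw [node, SB_res, SB_res, SB_par, SB_par] at h
    rcases h with (h | h) | h
    · exact absurd (Or.inl (mem_pv_chL _)) ((SB_case.1 h).1 _)
    · obtain ⟨_, _, -, h, -⟩ := ih1 h
      exact absurd (Or.inl (mem_pv_chL _)) (h _)
    · obtain ⟨_, _, -, h, -⟩ := ih2 h
      exact absurd (Or.inl (mem_pv_chR _)) (h _)
  | right _ _ _ _ _ ih1 ih2 =>
    intro h
    rw [node, SB_res, SB_res, SB_par, SB_par] at h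
    rcases h with (h | h) | h
    · exact absurd (Or.inl (mem_pv_chR _)) ((SB_case.1 h).1 _)
    · obtain ⟨_, _, -, h, -⟩ := ih1 h
      exact absurd (Or.inl (mem_pv_chL _)) (h _)
    · obtain ⟨_, _, -, h, -⟩ := ih2 h
      exact absurd (Or.inl (mem_pv_chR _)) (h _)
  | done _ _ _ _ _ ih ih1 ih2 =>
    intro h
    rw [SB_par, node, SB_res, SB_res, SB_par, SB_par] at h
    rcases h with h | (h | h) | h
    · exact ih h
    · exact absurd h not_SB_zero
    · obtain ⟨_, _, -, h, -⟩ := ih1 h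
      exact absurd (Or.inl (mem_pv_chL _)) (h _)
    · obtain ⟨_, _, -, h, -⟩ := ih2 h
      exact absurd (Or.inl (mem_pv_chR _)) (h _)
  | str _ e ih => exact fun h => ih ((SB.congr e).2 h)

/-! ### Internal steps -/

theorem Rep.com_col {n : ℕ} {c s k g : CPat n} {ι : Ab n} {N : ℕ} {T : Proc n}
    (h : Rep c s k ι N T) {C : Proc (n + (0 + 1))} {X : Proc n}
    (hX : Com (.caseOf (colPat g) C) T X) :
    g = c ∧ ∃ σ ι' N' T', σ 0 = ι.val ∧ Ab.Out ι ι.val ι' ∧ Rep c s k ι' N' T' ∧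
      (ι.Fresh → N' = N) ∧ StrEq X (.par (C.inst σ) T') := by
  obtain ⟨Y, hY, e⟩ := hX.symm
  obtain ⟨d, ι', N', T', X₀, ho, hr, hf, hi, e'⟩ := h.com hY
  cases hi with
  | comm _ _ hu =>
    obtain ⟨rfl, hd⟩ := unify_col_pub hu
    obtain rfl := ho.val_eq
    refine ⟨rfl, _, ι', N', T', hd, ho, hr, hf, e.symm.trans (e'.trans ?_)⟩
    exact .trans (.par_comm _ _) (.parL _ (.par_zero _))

/-- Each tree communicates only through patterns with its own channel protected, and distinct
protected channels do not unify. -/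
theorem Rep.not_com {n : ℕ} {c c' s k s' k' : CPat n} {ι ι' : Ab n} {N N' : ℕ} {T T' X : Proc n}
    (h : Rep c s k ι N T) (h' : Rep c' s' k' ι' N' T') (hc : c ≠ c') : ¬ Com T T' X := by
  intro hX
  obtain ⟨d, _, _, _, X₀, -, -, -, hi, -⟩ := h.com hX
  obtain ⟨Y, hY, -⟩ := (Com.case hi).symm
  obtain ⟨d, _, _, _, X₀, -, -, -, hi, -⟩ := h'.com hY
  cases hi with
  | comm _ _ hu => exact hc (unify_pub_pub hu).1

theorem tau_node {n : ℕ} {s k s' k' : CPat (n + 1 + 1)} {ι₁ ι₂ : Ab (n + 1 + 1)} {N₁ N₂ : ℕ}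
    {G T₁ T₂ : Proc (n + 1 + 1)} {X : Proc n} (h₁ : Rep (chL n) s k ι₁ N₁ T₁)
    (h₂ : Rep (chR n) s' k' ι₂ N₂ T₂) (hG : ∀ X, ¬ Tau G X) (h : Tau (node G T₁ T₂) X) :
    (∃ Y, Tau T₁ Y ∧ X = node G Y T₂) ∨ (∃ Y, Tau T₂ Y ∧ X = node G T₁ Y) ∨
      (∃ Y, Com G T₁ Y ∧ X = .res (.res (.par Y T₂))) ∨
      ∃ Y, Com G T₂ Y ∧ X = .res (.res (.par Y T₁)) := by
  cases h with
  | res h => cases h with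
    | res h => cases h with
      | com h => cases h with
        | parL _ h => exact .inr (.inr (.inr ⟨_, h, rfl⟩))
        | parR _ h => exact absurd h (h₁.not_com h₂ (chL_ne_chR n))
      | parL _ h => cases h with
        | com h => exact .inr (.inr (.inl ⟨_, h, rfl⟩))
        | parL _ h => exact absurd h (hG _)
        | parR _ h => exact .inl ⟨_, h, rfl⟩
      | parR _ h => exact .inr (.inl ⟨_, h, rfl⟩)

theorem Ab.Tau.fresh {n : ℕ} {s k : CPat n} {ι ι' : Ab n} (h : Ab.Tau s k ι ι') :
    ι.Fresh ↔ ι'.Fresh := by cases h <;> rfl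

theorem Ab.fresh_of_taus {n : ℕ} {s k : CPat n} {ι ι' : Ab n}
    (h : Relation.ReflTransGen (Ab.Tau s k) ι ι') : ι.Fresh ↔ ι'.Fresh := by
  induction h with
  | refl => rfl
  | tail _ h ih => exact ih.trans h.fresh

theorem Ab.Out.not_fresh {n : ℕ} {ι ι' : Ab n} {d : CPat n} (h : Ab.Out ι d ι') (hf : ι.Fresh) :
    ¬ ι'.Fresh := by
  cases h with
  | live => exact id
  | com => exact id
  | halfCom => exact hf.elim

theorem Ab.Fresh.exists_out {n : ℕ} {ι : Ab n} (h : ι.Fresh) : ∃ ι', Ab.Out ι ι.val ι' ∧ ¬ ι'.Fresh := by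
  cases ι with
  | live d => exact ⟨_, .live d, id⟩
  | com d x => exact ⟨_, .com d x, id⟩
  | half d => exact h.elim
  | halfCom d x => exact h.elim

/-- An internal step: the measure decreases or a genuine reduction step is made. -/
def Ab.Progress {n : ℕ} (s k : CPat n) (ι : Ab n) (N : ℕ) (ι' : Ab n) (N' : ℕ) : Prop :=
  Relation.ReflTransGen (Ab.Tau s k) ι ι' ∧
    ((ι.val = ι'.val ∧ N' < N) ∨ (ι.Fresh ∧ CStep s k ι.val ι'.val))

theorem Ab.Progress.lt {n : ℕ} {s k : CPat n} {ι ι' : Ab n} {N N' : ℕ}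
    (h : Ab.Progress s k ι N ι' N') (hf : ¬ ι.Fresh) : N' < N :=
  h.2.elim And.right fun h => absurd h.1 hf

theorem Ab.Progress.of_lt {n : ℕ} {s k : CPat n} {ι : Ab n} {N N' : ℕ} (h : N' < N) :
    Ab.Progress s k ι N ι N' := ⟨.refl, .inl ⟨rfl, h⟩⟩

/-- When a component withdraws its old value, the value of the application changes at once;
abstractly this is a commitment followed by a withdrawal. -/
theorem Ab.Progress.of_step {n : ℕ} {s k d e : CPat n} {N N' : ℕ} (h : CStep s k d e) :
    Ab.Progress s k (.live d) N (.live e) N' :=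
  ⟨.tail (.single (.commit h)) (.withdraw d e), .inr ⟨trivial, h⟩⟩

/-- Internal steps of a component of an application. -/
theorem Ab.Progress.child {n : ℕ} {s k x : CPat n} {ι ι' : Ab (n + 1 + 1)} {N N' : ℕ}
    (h : Ab.Progress s.w2 k.w2 ι N ι' N') (hx : ι.val = x.w2) :
    ∃ x', ι'.val = x'.w2 ∧ ((x' = x ∧ N' < N) ∨ CStep s k x x') := by
  rcases h.2 with ⟨e, hN⟩ | ⟨-, hs⟩
  · exact ⟨x, e ▸ hx, .inl ⟨rfl, hN⟩⟩
  · obtain ⟨x', e, h⟩ := hs.reflect_w2 hx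
    exact ⟨x', e, .inr h⟩

/-- A commitment inside an unread component leaves the value of the application unchanged and lowers
the measure. Its withdrawal reduces the application in that argument. Reading a component lowers the
measure, and components already read are no longer fresh, so their steps only lower it. -/
theorem Rep.tau {n : ℕ} {c s k : CPat n} {ι : Ab n} {N : ℕ} {T : Proc n} (h : Rep c s k ι N T) :
    ∀ {X : Proc n}, Tau T X → ∃ ι' N', Rep c s k ι' N' X ∧ Ab.Progress s k ι N ι' N' := by
  induction h with
  | core hi =>
    intro X h
    obtain ⟨ι', N', L', e, hi', hd⟩ := core_tau hi h
    refine ⟨ι', N', .str (.core hi') e.symm, ?_⟩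
    rcases hd with ⟨rfl, hN⟩ | ⟨ht, hd⟩
    · exact .of_lt hN
    · exact ⟨.single ht, hd⟩
  | @left n c s k x y ι₁ ι₂ N₁ N₂ T₁ T₂ r1 r2 h1 h2 h3 h4 ih1 ih2 =>
    intro X h
    rcases tau_node r1 r2 (fun _ => not_tau_case) h with ⟨Y, hY, rfl⟩ | ⟨Y, hY, rfl⟩ | ⟨Y, hY, rfl⟩ |
      ⟨Y, hY, rfl⟩
    · obtain ⟨ι', N', hr, hp⟩ := ih1 hY
      obtain ⟨x', hx, hd⟩ := hp.child h3
      refine ⟨_, _, .left hr r2 ((Ab.fresh_of_taus hp.1).1 h1) h2 hx h4, ?_⟩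
      rcases hd with ⟨rfl, hN⟩ | hs
      · exact .of_lt (by omega)
      · exact .of_step (.appL _ hs)
    · obtain ⟨ι', N', hr, hp⟩ := ih2 hY
      obtain ⟨x', hx, hd⟩ := hp.child h4
      refine ⟨_, _, .left r1 hr h1 ((Ab.fresh_of_taus hp.1).1 h2) h3 hx, ?_⟩
      rcases hd with ⟨rfl, hN⟩ | hs
      · exact .of_lt (by omega)
      · exact .of_step (.appR _ hs)
    · obtain ⟨-, σ, ι', N', T', hσ, ho, hr, hf, e⟩ := r1.com_col hY
      -- The component was fresh, so being read leaves its measure unchanged, and the collector's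
      -- unit makes the total drop.
      have hr := Rep.right (c := c) (x := x) hr r2 (ho.not_fresh h1) h2 h4
      refine ⟨_, _, hr.str (.res_congr (.res_congr (.parL _ (.symm (e.trans (.parL _ ?_)))))),
        .of_lt (by have := hf h1; omega)⟩
      rw [colL_inst, hσ, h3]
      exact .refl _
    · exact absurd (r2.com_col hY).1 (chL_ne_chR n)
  | @right n c s k x y ι₁ ι₂ N₁ N₂ T₁ T₂ r1 r2 h1 h2 h4 ih1 ih2 =>
    intro X h
    rcases tau_node r1 r2 (fun _ => not_tau_case) h with ⟨Y, hY, rfl⟩ | ⟨Y, hY, rfl⟩ | ⟨Y, hY, rfl⟩ |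
      ⟨Y, hY, rfl⟩
    · obtain ⟨ι', N', hr, hp⟩ := ih1 hY
      have := hp.lt h1
      exact ⟨_, _, .right hr r2 (mt (Ab.fresh_of_taus hp.1).2 h1) h2 h4, .of_lt (by omega)⟩
    · obtain ⟨ι', N', hr, hp⟩ := ih2 hY
      obtain ⟨x', hx, hd⟩ := hp.child h4
      refine ⟨_, _, .right r1 hr h1 ((Ab.fresh_of_taus hp.1).1 h2) hx, ?_⟩
      rcases hd with ⟨rfl, hN⟩ | hs
      · exact .of_lt (by omega)
      · exact .of_step (.appR _ hs)
    · exact absurd (r1.com_col hY).1.symm (chL_ne_chR n)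
    · obtain ⟨-, σ, ι', N', T', hσ, ho, hr, hf, e⟩ := r2.com_col hY
      -- The new machine uses neither component channel, so it leaves the scope of both
      -- restrictions; the rest of the node remains as a leftover.
      have hr := Rep.done (Rep.start c s k (.comp x y)) r1 hr h1 (ho.not_fresh h2)
      refine ⟨_, _, hr.str (.symm (.trans (.res_congr (.res_congr (.trans (.parL _ e) ?_)))
        (.trans (.res_congr (.symm (.extrude _ _))) (.symm (.extrude _ _))))),
        .of_lt (by have := hf h2; omega)⟩
      rw [colR_inst, hσ, h4]
      refine .trans (.assoc' _ _ _) (.par_congr ?_ (.trans (.par_comm _ _) (.parL _ (.symm (.zero_par _)))))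
      rw [Proc.wk_eq, Proc.wk_eq, start_subst, start_subst]
      simp only [← CPat.wk_eq_subst]
      exact .refl _
  | @done n c s k ι ι₁ ι₂ N N₁ N₂ T T₁ T₂ r r1 r2 h1 h2 ih ih1 ih2 =>
    intro X h
    cases h with
    | com h =>
      obtain ⟨Y, h, -⟩ := h.symm
      cases h with
      | res h => cases h with
        | res h => cases h with
          | parL _ h => cases h with
            | parL _ h => cases h
            | parR _ h =>
              obtain ⟨d, _, _, _, _, -, -, -, h, -⟩ := r1.com h
              exact absurd h (not_int_chL Set.subset_union_left)
          | parR _ h =>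
            obtain ⟨d, _, _, _, _, -, -, -, h, -⟩ := r2.com h
            exact absurd h (not_int_chR Set.subset_union_left)
    | parL _ h =>
      obtain ⟨ι', N', hr, ht, hp⟩ := ih h
      refine ⟨_, _, .done hr r1 r2 h1 h2, ht, hp.imp_left fun h => ⟨h.1, by omega⟩⟩
    | parR _ h =>
      rcases tau_node r1 r2 (fun _ h => by cases h) h with ⟨Y, hY, rfl⟩ | ⟨Y, hY, rfl⟩ | ⟨Y, hY, rfl⟩ |
        ⟨Y, hY, rfl⟩
      · obtain ⟨ι', N', hr, hp⟩ := ih1 hY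
        have := hp.lt h1
        exact ⟨_, _, .done r hr r2 (mt (Ab.fresh_of_taus hp.1).2 h1) h2, .of_lt (by omega)⟩
      · obtain ⟨ι', N', hr, hp⟩ := ih2 hY
        have := hp.lt h2
        exact ⟨_, _, .done r r1 hr h1 (mt (Ab.fresh_of_taus hp.1).2 h2), .of_lt (by omega)⟩
      · cases hY
      · cases hY
  | str _ e ih =>
    intro X h
    obtain ⟨X', h', e'⟩ := h.congr e.symm
    obtain ⟨ι', N', hr, hp⟩ := ih h'
    exact ⟨ι', N', hr.str e'.symm, hp⟩

/-! ### Realizing abstract steps -/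

theorem com_col_of {n : ℕ} {c d : CPat n} {T₀ T' : Proc n} (h : OutS T₀ (pubPat c d) T')
    (C : Proc (n + (0 + 1))) : ∃ σ, σ 0 = d ∧
      Red (.par (.caseOf (colPat c) C) T₀) (.par (C.inst σ) T') := by
  obtain ⟨σ, ρ, hu, hσ⟩ := unify_col_pub_of c d
  obtain ⟨Y, hY, e⟩ := h.com (.comm C .zero hu)
  refine ⟨σ, hσ, hY.toRed.congr (.par_comm _ _) (e.trans ?_)⟩
  exact .trans (.par_comm _ _) (.parL _ (.par_zero _))

/-- Every tree can expose its top machine. -/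
theorem Rep.to_core {n : ℕ} {c s k : CPat n} {ι : Ab n} {N : ℕ} {T : Proc n}
    (h : Rep c s k ι N T) : ∃ L G N₀, Wk T (.par (CPC.core c s k L) G) ∧
      Inv (s.wk 1) (k.wk 1) ι.wk N₀ L ∧ ∀ ι' N' L', Inv (s.wk 1) (k.wk 1) ι'.wk N' L' →
        ∃ N'', Rep c s k ι' N'' (.par (CPC.core c s k L') G) := by
  -- A fresh tree whose top machine can be exposed delivers its current value to a collector, even
  -- if it has already committed to a reduct.
  have out : ∀ {n : ℕ} {c s k x : CPat n} {ι : Ab n} {T : Proc n}, ι.Fresh → ι.val = x →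
      (∃ L G N₀, Wk T (.par (CPC.core c s k L) G) ∧
        Inv (s.wk 1) (k.wk 1) ι.wk N₀ L ∧ ∀ ι' N' L', Inv (s.wk 1) (k.wk 1) ι'.wk N' L' →
          ∃ N'', Rep c s k ι' N'' (.par (CPC.core c s k L') G)) →
      ∀ C : Proc (n + (0 + 1)), ∃ T' ι' N' σ, Rep c s k ι' N' T' ∧ ¬ ι'.Fresh ∧ σ 0 = x ∧
        Wk (.par (.caseOf (colPat c) C) T) (.par (C.inst σ) T') := by
    rintro n c s k _ ι T hf rfl ⟨L, G, N₀, hw, hi, hr⟩ C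
    obtain ⟨ι', ho, hf'⟩ := hf.exists_out
    obtain ⟨T₀, T', N', L', hw', hs, e, hi'⟩ := core_realize_out (c := c) hi ho
    obtain ⟨N'', hr⟩ := hr ι' N' L' hi'
    obtain ⟨σ, hσ, hred⟩ := com_col_of (OutS.parL G hs) C
    refine ⟨_, ι', N'', σ, hr.str (.parL _ e.symm), hf', hσ, ?_⟩
    exact ((hw.trans (hw'.parL _)).parR _).trans (.of_red hred)
  -- Once the left value is held, reading the right one starts the top machine. This is shared by
  -- the cases `left` and `right`.
  have top : ∀ {n : ℕ} {c s k x y : CPat n} {ι₁ : Ab (n + 1 + 1)} {N₁ : ℕ}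
      {T₁ T₂ : Proc (n + 1 + 1)}, Rep (chL n) s.w2 k.w2 ι₁ N₁ T₁ → ¬ ι₁.Fresh →
      (∀ C : Proc (n + 1 + 1 + (0 + 1)), ∃ T' ι' N' σ, Rep (chR n) s.w2 k.w2 ι' N' T' ∧
        ¬ ι'.Fresh ∧ σ 0 = y.w2 ∧
        Wk (.par (.caseOf (colPat (chR n)) C) T₂) (.par (C.inst σ) T')) →
      ∃ L G N₀, Wk (node (waitR c s k x) T₁ T₂) (.par (CPC.core c s k L) G) ∧
        Inv (s.wk 1) (k.wk 1) (Ab.live (.comp x y)).wk N₀ L ∧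
        ∀ ι' N' L', Inv (s.wk 1) (k.wk 1) ι'.wk N' L' →
          ∃ N'', Rep c s k ι' N'' (.par (CPC.core c s k L') G) := by
    intro n c s k x y ι₁ N₁ T₁ T₂ r1 h1 H
    obtain ⟨T₂', ι₂, N₂, σ, r2, h2, hσ, hw⟩ := H (CPC.start (c.w2.wk _) (s.w2.wk _) (k.w2.wk _)
      (.comp (x.w2.wk _) (bv (n + 1 + 1) (0 : Fin (0 + 1)))))
    refine ⟨[.msg .ev ((CPat.comp x y).wk 1)], node .zero T₁ T₂', wev (s.wk 1) ((CPat.comp x y).wk 1), ?_, ?_,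
      fun ι' N' L' hi => ⟨_, .done (.core hi) r1 r2 h1 h2⟩⟩
    · refine .trans (.of_strEq (.res_congr (.res_congr (.right_comm _ _ _)))) ?_
      refine .trans (hw.parL _).res.res (.of_strEq ?_)
      refine .symm (.trans (.extrude _ _) (.trans (.res_congr (.extrude _ _))
        (.symm (.res_congr (.res_congr ?_)))))
      rw [colR_inst, hσ]
      refine .trans (.assoc' _ _ _) (.par_congr ?_ (.trans (.par_comm _ _) (.parL _ (.symm (.zero_par _)))))
      rw [← CPC.start, Proc.wk_eq, Proc.wk_eq, start_subst, start_subst]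
      simp only [← CPat.wk_eq_subst]
      exact .refl _
    · rw [Ab.wk_live]
      exact .ev (B := []) (.refl _) (by simp)
  induction h with
  | @core n c s k ι N L hi =>
    exact ⟨L, .zero, _, .of_strEq (.symm (.par_zero _)), hi,
      fun ι' N' L' h => ⟨N', .str (.core h) (.symm (.par_zero _))⟩⟩
  | @left n c s k x y ι₁ ι₂ N₁ N₂ T₁ T₂ r1 r2 h1 h2 h3 h4 ih1 ih2 =>
    obtain ⟨T₁', ι', N', σ, hr, hf, hσ, hw⟩ := out h1 h3 ih1
      (colR ((chR n).wk _) (c.w2.wk _) (s.w2.wk _) (k.w2.wk _) (bv (n + 1 + 1) (0 : Fin (0 + 1))))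
    rw [colL_inst, hσ] at hw
    obtain ⟨L, G, N₀, hw', h⟩ := top (c := c) (x := x) hr hf (out h2 h4 ih2)
    exact ⟨L, G, N₀, (hw.parL _).res.res.trans hw', h⟩
  | right r1 r2 h1 h2 h4 ih1 ih2 => exact top r1 h1 (out h2 h4 ih2)
  | done r r1 r2 h1 h2 ih ih1 ih2 =>
    obtain ⟨L, G, N₀, hw, hi, h⟩ := ih
    refine ⟨L, _, N₀, (hw.parL _).trans (.of_strEq (.assoc' _ _ _)), hi, fun ι' N' L' h' => ?_⟩
    obtain ⟨N'', hr⟩ := h ι' N' L' h'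
    exact ⟨_, .str (.done hr r1 r2 h1 h2) (.assoc' _ _ _)⟩
  | str _ e ih =>
    obtain ⟨L, G, N₀, hw, h⟩ := ih
    exact ⟨L, G, N₀, (Wk.of_strEq e.symm).trans hw, h⟩

theorem Rep.realize {n : ℕ} {c s k : CPat n} {ι ι' : Ab n} {N : ℕ} {T : Proc n}
    (h : Rep c s k ι N T) (ht : Ab.Tau s k ι ι') : ∃ T' N', Wk T T' ∧ Rep c s k ι' N' T' := by
  obtain ⟨L, G, N₀, hw, hi, hr⟩ := h.to_core
  obtain ⟨N', L', hw', hi'⟩ := core_realize (c := c) hi ht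
  obtain ⟨N'', hr⟩ := hr ι' N' L' hi'
  exact ⟨_, N'', hw.trans (hw'.parL _), hr⟩

theorem Rep.realize_taus {n : ℕ} {c s k : CPat n} {ι ι' : Ab n} {N : ℕ} {T : Proc n}
    (h : Rep c s k ι N T) (ht : Relation.ReflTransGen (Ab.Tau s k) ι ι') :
    ∃ T' N', Wk T T' ∧ Rep c s k ι' N' T' := by
  induction ht with
  | refl => exact ⟨T, N, .refl _, h⟩
  | tail _ ht ih =>
    obtain ⟨T', N', hw, h⟩ := ih
    obtain ⟨T'', N'', hw', h⟩ := h.realize ht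
    exact ⟨T'', N'', hw.trans hw', h⟩

theorem Rep.realize_out {n : ℕ} {c s k d : CPat n} {ι ι' : Ab n} {N : ℕ} {T : Proc n}
    (h : Rep c s k ι N T) (ho : Ab.Out ι d ι') :
    ∃ T₀ T' N', Wk T T₀ ∧ OutS T₀ (pubPat c d) T' ∧ Rep c s k ι' N' T' := by
  obtain ⟨L, G, N₀, hw, hi, hr⟩ := h.to_core
  obtain ⟨T₀, T', N', L', hw', hs, e, hi'⟩ := core_realize_out (c := c) hi ho
  obtain ⟨N'', hr⟩ := hr ι' N' L' hi'
  exact ⟨_, _, N'', hw.trans (hw'.parL _), .parL G hs, hr.str (.parL _ e.symm)⟩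

/-- Trees in the same state. -/
def SameState {n : ℕ} (P Q : Proc n) : Prop :=
  ∃ (c s k : CPat n) (ι : Ab n) (N N' : ℕ), Rep c s k ι N P ∧ Rep c s k ι N' Q

/-- Every move of one tree is described by a move of the abstract state, and every tree in that
state can realise it. Measures play no role here, so the two trees may have quite different shapes.
-/
theorem isAgents_sameState : IsAgents @SameState where
  symm := fun ⟨c, s, k, ι, N, N', h, h'⟩ => ⟨c, s, k, ι, N', N, h', h⟩
  subst := fun θ ⟨c, s, k, ι, N, N', h, h'⟩ => by
    obtain ⟨M, h⟩ := h.subst θ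
    obtain ⟨M', h'⟩ := h'.subst θ
    exact ⟨_, _, _, _, M, M', h, h'⟩
  not_ok := fun ⟨c, s, k, ι, N, N', h, h'⟩ => h.not_hasOk
  barb := fun ⟨c, s, k, ι, N, N', h, h'⟩ hs => by
    obtain ⟨d, ι', ho, hb, rfl, rfl⟩ := h.sb hs
    obtain ⟨T₀, T', M, hw, hs, -⟩ := h'.realize_out ho
    exact ⟨T₀, hw, hs.sb hb⟩
  tau := fun ⟨c, s, k, ι, N, N', h, h'⟩ ht => by
    obtain ⟨ι', M, hr, hp⟩ := h.tau ht
    obtain ⟨Q', M', hw, hr'⟩ := h'.realize_taus hp.1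
    exact ⟨_, Q', .refl _, hw, c, s, k, ι', M, M', hr, hr'⟩
  com := fun ⟨c, s, k, ι, N, N', h, h'⟩ hc => by
    obtain ⟨d, ι', M, P', X₀, ho, hr, -, hi, e⟩ := h.com hc
    obtain ⟨T₀, T', M', hw, hs, hr'⟩ := h'.realize_out ho
    exact ⟨_, P', X₀, T₀, T', hi, e, hw, hs, c, s, k, ι', M, M', hr, hr'⟩

theorem Rep.bEq {c s k : CPat 0} {ι : Ab 0} {N N' : ℕ} {P Q : Proc 0} (h : Rep c s k ι N P)
    (h' : Rep c s k ι N' Q) : BEq P Q :=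
  isAgents_sameState.bEq ⟨c, s, k, ι, N, N', h, h'⟩

/-! ### The translation -/

/-- The construction of a combinator from patterns for `S` and `K`. -/
def constr {n : ℕ} (s k : CPat n) : SK → CPat n
  | .S => s
  | .K => k
  | .app M N => .comp (constr s k M) (constr s k N)

/-- The translation on the channel `c`. -/
def trans : {n : ℕ} → CPat n → CPat n → CPat n → SK → Proc n
  | _, c, s, k, .S => start c s k s
  | _, c, s, k, .K => start c s k k
  | n, c, s, k, .app M N =>
      node (waitL c s k) (trans (chL n) s.w2 k.w2 M) (trans (chR n) s.w2 k.w2 N)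

theorem constr_w2 {n : ℕ} (s k : CPat n) (M : SK) : (constr s k M).w2 = constr s.w2 k.w2 M := by
  induction M with
  | S => rfl
  | K => rfl
  | app M N h1 h2 =>
    rw [constr, constr, ← h1, ← h2]
    rfl

theorem trans_subst (M : SK) : ∀ {n m : ℕ} (θ : Var n → CPat m) (c s k : CPat n),
    (trans c s k M).subst θ = trans (c.subst θ) (s.subst θ) (k.subst θ) M := by
  induction M with
  | S => intro n m θ c s k; exact start_subst _ _ _ _ _
  | K => intro n m θ c s k; exact start_subst _ _ _ _ _
  | app M N h1 h2 =>
    intro n m θ c s k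
    simp only [trans, node_subst, waitL_subst, h1, h2, chL_subst, chR_subst, CPat.w2_subst]

theorem Rep.trans (M : SK) : ∀ {n : ℕ} (c s k : CPat n),
    ∃ N, Rep c s k (.live (constr s k M)) N (trans c s k M) := by
  induction M with
  | S => intro n c s k; exact ⟨_, .start _ _ _ _⟩
  | K => intro n c s k; exact ⟨_, .start _ _ _ _⟩
  | app M N h1 h2 =>
    intro n c s k
    obtain ⟨N₁, h1⟩ := h1 (chL n) s.w2 k.w2
    obtain ⟨N₂, h2⟩ := h2 (chR n) s.w2 k.w2
    exact ⟨_, .left h1 h2 trivial trivial (constr_w2 s k M).symm (constr_w2 s k N).symm⟩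

theorem Rep.red {n : ℕ} {c s k : CPat n} {ι : Ab n} {N : ℕ} {T X : Proc n} (h : Rep c s k ι N T)
    (hr : Red T X) : ∃ ι' N', Rep c s k ι' N' X ∧ Ab.Progress s k ι N ι' N' := by
  obtain ⟨Y, hY, e⟩ := hr.toTau
  obtain ⟨ι', N', h', hp⟩ := h.tau hY
  exact ⟨ι', N', h'.str e, hp⟩

/-! ### Reduction of combinators and of constructions -/

def nmf (a : Name) : CPat 0 := .nm (.free a)

theorem construct_eq (s k : Name) (M : SK) :
    SKtoCPC.construct s k M = constr (nmf s) (nmf k) M := by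
  induction M with
  | S => rfl
  | K => rfl
  | app M N h1 h2 => rw [SKtoCPC.construct, constr, h1, h2]

section

variable {s k : Name}

theorem constr_eq_comp {M : SK} {d e : CPat 0} (h : constr (nmf s) (nmf k) M = .comp d e) :
    ∃ M₁ M₂, M = .app M₁ M₂ ∧ d = constr (nmf s) (nmf k) M₁ ∧ e = constr (nmf s) (nmf k) M₂ := by
  cases M with
  | S => simp [constr, nmf] at h
  | K => simp [constr, nmf] at h
  | app M N =>
    simp only [constr, CPat.comp.injEq] at h
    exact ⟨M, N, rfl, h.1.symm, h.2.symm⟩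

theorem constr_eq_s (hsk : s ≠ k) {M : SK} (h : constr (nmf s) (nmf k) M = nmf s) : M = .S := by
  cases M with
  | S => rfl
  | K => simp [constr, nmf] at h; exact absurd h.symm hsk
  | app M N => simp [constr, nmf] at h

theorem constr_eq_k (hsk : s ≠ k) {M : SK} (h : constr (nmf s) (nmf k) M = nmf k) : M = .K := by
  cases M with
  | S => simp [constr, nmf] at h; exact absurd h hsk
  | K => rfl
  | app M N => simp [constr, nmf] at h

theorem constr_inj (hsk : s ≠ k) : Function.Injective (constr (nmf s) (nmf k)) := by
  intro M
  induction M with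
  | S => intro N h; exact (constr_eq_s hsk h.symm).symm
  | K => intro N h; exact (constr_eq_k hsk h.symm).symm
  | app M₁ M₂ h1 h2 =>
    intro N h
    obtain ⟨N₁, N₂, rfl, e1, e2⟩ := constr_eq_comp h.symm
    rw [h1 e1, h2 e2]

theorem constr_step {M N : SK} (h : SK.Step M N) :
    CStep (nmf s) (nmf k) (constr (nmf s) (nmf k) M) (constr (nmf s) (nmf k) N) := by
  induction h with
  | ruleS M N X => exact .ruleS _ _ _
  | ruleK X Y => exact .ruleK _ _
  | appL N _ ih => exact .appL _ ih
  | appR M _ ih => exact .appR _ ih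

/-- Reading a pattern back as a combinator needs `s ≠ k`; otherwise the `S`-rule would also apply to
`K`. -/
theorem constr_reflect (hsk : s ≠ k) {d e : CPat 0} (h : CStep (nmf s) (nmf k) d e) :
    ∀ {M : SK}, d = constr (nmf s) (nmf k) M →
      ∃ N, e = constr (nmf s) (nmf k) N ∧ SK.Step M N := by
  induction h with
  | ruleS x y z =>
    intro M hd
    obtain ⟨M₁, Z, rfl, h1, rfl⟩ := constr_eq_comp hd.symm
    obtain ⟨M₂, Y, rfl, h2, rfl⟩ := constr_eq_comp h1.symm
    obtain ⟨M₃, X, rfl, h3, rfl⟩ := constr_eq_comp h2.symm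
    obtain rfl := constr_eq_s hsk h3.symm
    exact ⟨.app (.app X Z) (.app Y Z), rfl, .ruleS _ _ _⟩
  | ruleK x y =>
    intro M hd
    obtain ⟨M₁, Y, rfl, h1, rfl⟩ := constr_eq_comp hd.symm
    obtain ⟨M₂, X, rfl, h2, rfl⟩ := constr_eq_comp h1.symm
    obtain rfl := constr_eq_k hsk h2.symm
    exact ⟨X, rfl, .ruleK _ _⟩
  | appL y _ ih =>
    intro M hd
    obtain ⟨M₁, Y, rfl, h1, rfl⟩ := constr_eq_comp hd.symm
    obtain ⟨N, rfl, hs⟩ := ih h1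
    exact ⟨.app N Y, rfl, .appL _ hs⟩
  | appR x _ ih =>
    intro M hd
    obtain ⟨X, M₁, rfl, rfl, h1⟩ := constr_eq_comp hd.symm
    obtain ⟨N, rfl, hs⟩ := ih h1
    exact ⟨.app X N, rfl, .appR _ hs⟩

theorem taus_of_steps {M N : SK} (h : SK.Steps M N) :
    Relation.ReflTransGen (Ab.Tau (nmf s) (nmf k)) (.live (constr (nmf s) (nmf k) M))
      (.live (constr (nmf s) (nmf k) N)) := by
  induction h with
  | refl => exact .refl
  | tail _ h ih => exact .tail (.tail ih (.commit (constr_step h))) (.withdraw _ _)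

/-- Without an environment no offer is consumed from outside, so only the states `live` and `com`
occur. -/
theorem steps_of_taus (hsk : s ≠ k) {M : SK} {ι : Ab 0}
    (h : Relation.ReflTransGen (Ab.Tau (nmf s) (nmf k)) (.live (constr (nmf s) (nmf k) M)) ι) :
    (∃ N, SK.Steps M N ∧ ι = .live (constr (nmf s) (nmf k) N)) ∨
      ∃ N N', SK.Steps M N ∧ SK.Step N N' ∧
        ι = .com (constr (nmf s) (nmf k) N) (constr (nmf s) (nmf k) N') := by
  induction h with
  | refl => exact .inl ⟨M, .refl, rfl⟩
  | tail _ h ih =>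
    rcases ih with ⟨N, hs, rfl⟩ | ⟨N, N', hs, h', rfl⟩
    · cases h with
      | commit h =>
        obtain ⟨N', rfl, h'⟩ := constr_reflect hsk h rfl
        exact .inr ⟨N, N', hs, h', rfl⟩
    · cases h with
      | withdraw => exact .inl ⟨N', .tail hs h', rfl⟩

end

/-! ### Properties of the translation -/

/-- The translation of combinators on the channel `c`. -/
def tr (s k c : Name) (M : SK) : Proc 0 := trans (nmf c) (nmf s) (nmf k) M

section

variable {s k c : Name}

/-- The only free names are `c`, `s` and `k`, so injectivity plays no role and the identity is one
of processes, not just of behaviours. -/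
theorem tr_rename (f : Name → Name) (hs : f s = s) (hk : f k = k) (M : SK) :
    tr s k (f c) M = (tr s k c M).rename f := by
  rw [Proc.rename, tr, tr, trans_subst]
  simp only [nmf, CPat.subst, hs, hk]

/-- The collector of an application. -/
def collector (s k c n₁ n₂ : Name) : Proc 0 := colL (nmf n₁) (nmf n₂) (nmf c) (nmf s) (nmf k)

noncomputable def bindTwo (n₁ n₂ : Name) : Var 0 → CPat (0 + 1 + 1) := fun x =>
  (vren (bindV (oneName n₂)) x).subst (lift (vren (bindV (oneName n₁))) 1)

theorem nu_nu (n₁ n₂ : Name) (P : Proc 0) :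
    nu n₁ (nu n₂ P) = .res (.res (P.subst (bindTwo n₁ n₂))) := by
  rw [nu_eq, nu_eq, Proc.bindNames_eq, Proc.bindNames_eq]
  show Proc.res (.res _) = _
  rw [Proc.subst_subst]
  rfl

theorem bindTwo_right (n₁ n₂ : Name) : (nmf n₂).subst (bindTwo n₁ n₂) = chR 0 := by
  have : bindV (n := 0) (oneName n₂) (.free n₂) = .bound (Fin.natAdd 0 0) := bindV_mem _ 0
  simp only [nmf, CPat.subst, bindTwo, vren, this]
  exact bv_subst_lift _ _

theorem bindTwo_left {n₁ n₂ : Name} (h : n₁ ≠ n₂) : (nmf n₁).subst (bindTwo n₁ n₂) = chL 0 := by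
  have h1 : bindV (n := 0) (oneName n₂) (.free n₁) = .free n₁ := bindV_notMem _ _ fun _ => h.symm
  have h2 : bindV (n := 0) (oneName n₁) (.free n₁) = .bound (Fin.natAdd 0 0) := bindV_mem _ 0
  simp only [nmf, CPat.subst, bindTwo, vren, h1, lift, h2]
  rfl

theorem bindTwo_other {n₁ n₂ a : Name} (h₁ : n₁ ≠ a) (h₂ : n₂ ≠ a) :
    (nmf a).subst (bindTwo n₁ n₂) = (nmf a).w2 := by
  have h1 : bindV (n := 0) (oneName n₂) (.free a) = .free a := bindV_notMem _ _ fun _ => h₂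
  have h2 : bindV (n := 0) (oneName n₁) (.free a) = .free a := bindV_notMem _ _ fun _ => h₁
  simp only [nmf, CPat.subst, bindTwo, vren, h1, lift, h2]
  rfl

/-- The inequalities prevent the two restrictions from capturing `s`, `k` or `c`, or from being
identified. -/
theorem tr_app {n₁ n₂ : Name} (h1s : n₁ ≠ s) (h1k : n₁ ≠ k) (h2s : n₂ ≠ s) (h2k : n₂ ≠ k)
    (h1c : n₁ ≠ c) (h2c : n₂ ≠ c) (h12 : n₁ ≠ n₂) (M N : SK) :
    tr s k c (.app M N) = nu n₁ (nu n₂ (.par (.par (collector s k c n₁ n₂) (tr s k n₁ M))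
      (tr s k n₂ N))) := by
  rw [nu_nu]
  simp only [Proc.subst, collector, tr, colL_subst, trans_subst, bindTwo_right, bindTwo_left h12,
    bindTwo_other h1s h2s, bindTwo_other h1k h2k, bindTwo_other h1c h2c]
  rfl

theorem Rep.tr (s k c : Name) (M : SK) : ∃ N, Rep (nmf c) (nmf s) (nmf k)
    (.live (constr (nmf s) (nmf k) M)) N (tr s k c M) := Rep.trans M _ _ _

/-! ### Operational correspondence and divergence reflection. -/

theorem reds_of_steps {M M' : SK} (h : SK.Steps M M') :
    ∃ T N, Reds (tr s k c M) T ∧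
      Rep (nmf c) (nmf s) (nmf k) (.live (constr (nmf s) (nmf k) M')) N T := by
  obtain ⟨N, hr⟩ := Rep.tr s k c M
  obtain ⟨T, N', hw, hr⟩ := hr.realize_taus (taus_of_steps h)
  obtain ⟨T', h, e⟩ := hw.toReds
  exact ⟨T', N', h, hr.str e.symm⟩

theorem tr_complete {M M' : SK} (h : SK.Steps M M') :
    ∃ T, Reds (tr s k c M) T ∧ BEq T (tr s k c M') := by
  obtain ⟨T, N, h, hr⟩ := reds_of_steps (c := c) h
  obtain ⟨N', hr'⟩ := Rep.tr s k c M'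
  exact ⟨T, h, hr.bEq hr'⟩

theorem Rep.reds {c s k : CPat 0} {ι : Ab 0} {N : ℕ} {T X : Proc 0} (h : Rep c s k ι N T)
    (hr : Reds T X) : ∃ ι' N', Rep c s k ι' N' X ∧ Relation.ReflTransGen (Ab.Tau s k) ι ι' := by
  induction hr with
  | refl => exact ⟨ι, N, h, .refl⟩
  | tail _ hr ih =>
    obtain ⟨ι', N', h', ht⟩ := ih
    obtain ⟨ι'', N'', h'', hp⟩ := h'.red hr
    exact ⟨ι'', N'', h'', Relation.ReflTransGen.trans ht hp.1⟩

theorem tr_sound (hsk : s ≠ k) {M : SK} {T : Proc 0} (h : Reds (tr s k c M) T) :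
    ∃ M' T', SK.Steps M M' ∧ Reds T T' ∧ BEq T' (tr s k c M') := by
  obtain ⟨N, hr⟩ := Rep.tr s k c M
  obtain ⟨ι, N', hr, ht⟩ := hr.reds h
  have key : ∃ M', SK.Steps M M' ∧ Relation.ReflTransGen (Ab.Tau (nmf s) (nmf k)) ι
      (.live (constr (nmf s) (nmf k) M')) := by
    rcases steps_of_taus hsk ht with ⟨M', hs, rfl⟩ | ⟨M₁, M', hs, h', rfl⟩
    · exact ⟨M', hs, .refl⟩
    -- A committed process still shows its old value, so it is equivalent to a translation only
    -- after the withdrawal is completed.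
    · exact ⟨M', .tail hs h', .single (.withdraw _ _)⟩
  obtain ⟨M', hs, ht⟩ := key
  obtain ⟨T', N'', hw, hr'⟩ := hr.realize_taus ht
  obtain ⟨T'', h', e⟩ := hw.toReds
  obtain ⟨N₁, hr₁⟩ := Rep.tr s k c M'
  exact ⟨M', T'', hs, h', (hr'.str e.symm).bEq hr₁⟩

/-- Lexicographic descent: the outer induction is along reductions of the combinator, the inner one
on the measure, which may be reset whenever the combinator reduces. -/
theorem Rep.not_diverges (hsk : s ≠ k) {c : CPat 0} {M : SK}
    (hM : Acc (fun M' M => SK.Step M M') M) : ∀ {N : ℕ} {ι : Ab 0} {T : Proc 0},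
      Rep c (nmf s) (nmf k) ι N T → ι.val = constr (nmf s) (nmf k) M → ¬ Diverges T := by
  induction hM with
  | intro M _ ih =>
    intro N
    induction N using Nat.strong_induction_on with
    | _ N ihN =>
      rintro ι T h hM ⟨f, rfl, hf⟩
      obtain ⟨ι', N', h', -, hp⟩ := h.red (hf 0)
      have hd : Diverges (f (0 + 1)) := ⟨fun i => f (i + 1), rfl, fun i => hf (i + 1)⟩
      rcases hp with ⟨e, hN⟩ | ⟨-, hs⟩
      · exact ihN N' hN h' (e ▸ hM) hd
      · obtain ⟨M', e, hs⟩ := constr_reflect hsk hs hM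
        exact ih M' hs h' e hd

theorem tr_diverges (hsk : s ≠ k) {M : SK} (h : Diverges (tr s k c M)) : SK.Diverges M := by
  by_contra hM
  have hacc : Acc (fun M' M => SK.Step M M') M := by
    by_contra hn
    exact hM (not_acc_iff_exists_descending_chain.1 hn)
  obtain ⟨N, hr⟩ := Rep.tr s k c M
  exact hr.not_diverges hsk hacc rfl h

/-! ### The success test. -/

theorem succeeds_of_steps {M N : SK} (h : SK.Steps M N) :
    Succeeds (.par (tr s k c M) (SKtoCPC.observer s k c N)) := by
  obtain ⟨T, n, hT, hr⟩ := reds_of_steps (c := c) h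
  obtain ⟨T₀, T', -, hw, ho, -⟩ := hr.realize_out (.live _)
  rw [succeeds_iff_wk]
  have hu := Unify.comp (.nm_prot (.free c)) (Unify_toPat_toPat (constr (nmf s) (nmf k) N))
  rw [SKtoCPC.observer, construct_eq]
  obtain ⟨Y, hY, e⟩ := ho.com (.comm (.ok : Proc (0 + (0 + 0))) .zero hu)
  refine ⟨Y, (((Wk.of_reds hT).trans hw).parL _).trans (.of_red hY.toRed), ?_⟩
  exact (HasOk.congr e).2 (hasOk_par.2 (.inr (hasOk_par.2 (.inl .ok))))

theorem observer_unify {N : SK} {d : CPat 0} {σ ρ} (h : Unify (.comp (.nm (.free c))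
    (SKtoCPC.construct s k N).toPat) (pubPat (nmf c) d) σ ρ) : constr (nmf s) (nmf k) N = d := by
  obtain ⟨_, _, _, _, -, h, -⟩ := runify_comp_some.1 (Unify_iff.1 h)
  rw [← construct_eq]
  exact (runify_toPat_toPat.1 h).1

/-- The tree contains no success process, so the observer has to fire. Until then the shown value is
a reduct of `M`; when it fires, that value is `⟨N⟩`, and constructions are injective. -/
theorem steps_of_succeeds (hsk : s ≠ k) {M N : SK}
    (h : Succeeds (.par (tr s k c M) (SKtoCPC.observer s k c N))) : SK.Steps M N := by
  obtain ⟨P, hP, hok⟩ := succeeds_iff.1 h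
  have key : SK.Steps M N ∨ ∃ ι n T M', StrEq P (.par T (SKtoCPC.observer s k c N)) ∧
      Rep (nmf c) (nmf s) (nmf k) ι n T ∧ ι.val = constr (nmf s) (nmf k) M' ∧ SK.Steps M M' := by
    clear hok
    induction hP with
    | refl =>
      obtain ⟨n, hr⟩ := Rep.tr s k c M
      exact .inr ⟨_, n, _, M, .refl _, hr, rfl, .refl⟩
    | tail _ hr ih =>
      rcases ih with h | ⟨ι, n, T, M', e, hT, hM, hs⟩
      · exact .inl h
      obtain ⟨X, hX, eX⟩ := (hr.congr e (.refl _)).toTau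
      cases hX with
      | com hX =>
        obtain ⟨d, ι', N', T', X₀, ho, -, -, hi, -⟩ := hT.com hX
        cases hi with
        | comm _ _ hu =>
          have := observer_unify hu
          rw [ho.val_eq, hM] at this
          exact .inl (constr_inj hsk this ▸ hs)
      | parL _ hX =>
        obtain ⟨ι', n', hT', -, hp⟩ := hT.tau hX
        rcases hp with ⟨e', -⟩ | ⟨-, h'⟩
        · exact .inr ⟨ι', n', _, M', eX.symm, hT', e' ▸ hM, hs⟩
        · obtain ⟨M'', e', h'⟩ := constr_reflect hsk h' hM
          exact .inr ⟨ι', n', _, M'', eX.symm, hT', e', .tail hs h'⟩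
      | parR _ hX => exact absurd hX not_tau_case
  rcases key with h | ⟨ι, n, T, M', e, hT, -⟩
  · exact h
  · rcases hasOk_par.1 ((HasOk.congr e).1 hok) with h | h
    · exact absurd h hT.not_hasOk
    · exact absurd h (not_hasOk_case _ _)

/-! ### Compositionality and the renaming policy. -/

theorem exists_two_names (s k c : ℕ) : ∃ n₁ n₂ : ℕ, n₁ ≠ s ∧ n₁ ≠ k ∧ n₂ ≠ s ∧ n₂ ≠ k ∧
    n₁ ≠ c ∧ n₂ ≠ c ∧ n₁ ≠ n₂ :=
  ⟨c + s + k + 1, c + s + k + 2, by omega, by omega, by omega, by omega, by omega, by omega,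
    by omega⟩

theorem tr_app_ctx (s k c : Name) : ∃ (C : Ctx 2) (d : Fin 2 → Name), C.Linear ∧
    (∀ i, d i ≠ s ∧ d i ≠ k) ∧ ∀ args : Fin 2 → SK,
      tr s k c (.app (args 0) (args 1)) = C.fill fun i => tr s k (d i) (args i) := by
  obtain ⟨n₁, n₂, h1s, h1k, h2s, h2k, h1c, h2c, h12⟩ := exists_two_names s k c
  obtain ⟨C, hC, h0⟩ := exists_ctx 2 _ (collector s k c n₁ n₂) le_rfl
  refine ⟨.nu n₁ (.nu n₂ (.par (.par C (.hole 0)) (.hole 1))), fun i => if i = 0 then n₁ else n₂,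
    fun i => ?_, fun i => ?_, fun args => ?_⟩
  · simp only [Ctx.count, h0]
    fin_cases i <;> rfl
  · dsimp only
    split
    · exact ⟨h1s, h1k⟩
    · exact ⟨h2s, h2k⟩
  · simp only [Ctx.fill, hC]
    exact tr_app h1s h1k h2s h2k h1c h2c h12 _ _

theorem tr_compositional (s k c : Name) (o : SK.Op) :
    ∃ (C : Ctx o.arity) (d : Fin o.arity → Name), C.Linear ∧ (∀ i, d i ≠ s ∧ d i ≠ k) ∧
      ∀ args : Fin o.arity → SK, tr s k c (o.apply args) = C.fill fun i => tr s k (d i) (args i) := by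
  cases o with
  | S =>
    obtain ⟨C, hC, -⟩ := exists_ctx SK.Op.S.arity _ (tr s k c .S) le_rfl
    exact ⟨C, fun i => i.elim0, fun i => i.elim0, fun i => i.elim0, fun _ => (hC _).symm⟩
  | K =>
    obtain ⟨C, hC, -⟩ := exists_ctx SK.Op.K.arity _ (tr s k c .K) le_rfl
    exact ⟨C, fun i => i.elim0, fun i => i.elim0, fun i => i.elim0, fun _ => (hC _).symm⟩
  | app => exact tr_app_ctx s k c

/-- The renaming policy avoids the reserved names. -/
def policy (s k a : ℕ) : ℕ := a + s + k + 1

theorem policy_ne (s k a : ℕ) : policy s k a ≠ s ∧ policy s k a ≠ k := by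
  unfold policy
  constructor <;> omega

theorem policy_inj {s k a b : ℕ} (h : policy s k a = policy s k b) : a = b := by
  unfold policy at h
  omega

end

end CPC

theorem mainTheorem9 (s k : CPC.Name) (hsk : s ≠ k) :
    ∃ (tr : CPC.Name → SK → CPC.Proc 0) (r : ℕ) (φ : CPC.Name → Fin r → CPC.Name),
      SKtoCPC.IsParallelEncoding s k tr φ ∧
      ∀ c, c ≠ s → c ≠ k → ∀ M N : SK,
        SK.Steps M N ↔ CPC.Succeeds (.par (tr c M) (SKtoCPC.observer s k c N)) := by
  refine ⟨CPC.tr s k, 1, fun a _ => CPC.policy s k a, ?_, fun c _ _ M N =>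
    ⟨CPC.succeeds_of_steps, CPC.steps_of_succeeds hsk⟩⟩
  exact {
    policy_pos := Nat.one_pos
    policy_reserved := fun a _ => CPC.policy_ne s k a
    policy_disjoint := fun a b _ _ h => CPC.policy_inj h
    compositionality := fun c _ _ o _ => by
      obtain ⟨C, d, hC, hd, h⟩ := CPC.tr_compositional s k c o
      exact ⟨C, d, hC, hd, fun args _ => h args⟩
    name_invariance := fun σ σ' hs hk _ c _ _ _ _ M =>
      -- The renaming identity holds for every `σ'` fixing `s` and `k`, so the non-injective clause
      -- reduces to reflexivity.
      ⟨fun _ => CPC.tr_rename σ' hs hk M, fun _ => by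
        rw [← CPC.tr_rename σ' hs hk M]
        exact CPC.BEq.refl _⟩
    completeness := fun c _ _ M M' h => CPC.tr_complete h
    soundness := fun c _ _ M T h => CPC.tr_sound hsk h
    divergence_reflection := fun c _ _ M h => CPC.tr_diverges hsk h
    parallelisation := ⟨CPC.collector s k, fun c n₁ n₂ _ _ h1s h1k h2s h2k h1c h2c h12 M N =>
      CPC.tr_app h1s h1k h2s h2k h1c h2c h12 M N⟩ }
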